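/- Let $N$ be a nonzero integer, $[N]=\frac{1-q^N}{1-q}$, and $R=\mathbb Z[q,q^{-1},[N]^{-1}]$. For $n\ge 0$ let $Br_n(N)$ be the $R$-algebra with generators $g_1,\dots,g_{n-1}$ and (if $n\ge 2$) $e$, and with the following relations, each imposed whenever the generators in it exist: * (H) $g_i^2=(q-1)g_i+q$, $\;g_ig_{i+1}g_i=g_{i+1}g_ig_{i+1}$, $\;g_ig_j=g_jg_i$ for $|i-j|>1$; * (E1) $e^2=[N]e$; * (E2) $eg_i=g_ie$ for $i>2$, $\;eg_1=g_1e=qe$, $\;eg_2e=q^Ne$, $\;eg_2^{-1}e=q^{-1}e$; * (E3) $g_2g_3g_1^{-1}g_2^{-1}e_{(2)}=e_{(2)}=e_{(2)}g_2g_3g_1^{-1}g_2^{-1}$, where $e_{(2)}=e\,g_2g_3g_1^{-1}g_2^{-1}\,e$. Let $H_n\subset Br_n(N)$ be the subalgebra generated by $g_1,\dots,g_{n-1}$ (so $H_0=H_1=R$), and map $Br_n(N)\to Br_{n+1}(N)$ by $g_i\mapsto g_i$, $e\mapsto e$. For $2k\le n$ put $e_{(0)}=1$, $e_{(1)}=e$,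 $e_{(k+1)}=e\,(g_2g_3\cdots g_{2k+1})(g_1^{-1}g_2^{-1}\cdots g_{2k}^{-1})\,e_{(k)}$ for $k\ge1$, and $\bar e_{(k)}=[N]^{-k}e_{(k)}$, $\bar e=\bar e_{(1)}$. There is exactly one family of $R$-linear functionals $tr: Br_n(N)\to R$ $(n\ge 0)$, called the extended trace, with the following properties. 1. On the Hecke algebras it is the Markov trace: $tr(1)=1$, $tr(ab)=tr(ba)$ for $a,b\in H_n$, and $tr(g_nh)=\frac{q^N}{[N]}tr(h)$ for $n\ge 1$, $h\in H_n$. 2. For $1\le k\le n/2$ there is a multiplicative $R$-linear bijection $\Psi_k:\bar e_{(k)}Br_n(N)\bar e_{(k)}\to Br_{n-2k}(N)$ with $\Psi_k(\bar e_{(k)}g_i)=g_{i-2k}$ for $2k<i<n$ and, if $2k+2\le n$, $\Psi_k(\bar e_{(k+1)})=\bar e$, such that for all $a,b\in H_n$ $$tr(a\bar e_{(k)}b)=tr(\bar e_{(k)}ba\bar e_{(k)})=\Big(\frac{q^{N-1}}{[N]^{2}}\Big)^{k}\,tr\big(\Psi_k(\bar e_{(k)}ba\bar e_{(k)})\big).$$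 This extended trace is compatible with the maps $Br_n(N)\to Br_{n+1}(N)$, and it has the Markov property: for all $n\ge1$ and all $c\in Br_n(N)$, $$tr(cg_n)=tr(c)\,tr(g_n),$$ where on the left $c$ is regarded as an element of $Br_{n+1}(N)$. -/

import Mathlib

noncomputable section

/-- Parameters of a `q`-Brauer algebra over a commutative ring `R`: units `q`, `r` and `d`
with `(q - 1) d = r - 1`.  So `d` stands for `(r - 1) / (q - 1)`. -/
structure BrParam (R : Type*) [CommRing R] where
  q : Rˣ
  r : Rˣ
  d : Rˣ
  rel : ((q : R) - 1) * (d : R) = (r : R) - 1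

/-- Generators: `g_i` for `1 ≤ i < n`, and `e` (present as soon as `2 ≤ n`). -/
inductive BrGen (n : ℕ) : Type
  | g (i : ℕ) (hi : 1 ≤ i ∧ i < n) : BrGen n
  | e (hn : 2 ≤ n) : BrGen n

/-- The free generator `g_i` (with value `0` outside of the range `1 ≤ i < n`). -/
def freeG (R : Type*) [CommRing R] (n i : ℕ) : FreeAlgebra R (BrGen n) :=
  if hi : 1 ≤ i ∧ i < n then FreeAlgebra.ι R (BrGen.g i hi) else 0

/-- The free generator `e` (with value `0` for `n < 2`). -/
def freeE (R : Type*) [CommRing R] (n : ℕ) : FreeAlgebra R (BrGen n) :=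
  if hn : 2 ≤ n then FreeAlgebra.ι R (BrGen.e hn) else 0

/-- `q⁻¹ x + (q⁻¹ - 1)`, the inverse of any `x` with `x² = (q - 1) x + q`. -/
def heckeInv {R A : Type*} [CommRing R] [Ring A] [Algebra R A] (p : BrParam R) (x : A) : A :=
  ((p.q⁻¹ : Rˣ) : R) • x + (((p.q⁻¹ : Rˣ) : R) - 1) • (1 : A)

/-- `g₂ g₃ g₁⁻¹ g₂⁻¹`. -/
def twistWord {R A : Type*} [CommRing R] [Ring A] [Algebra R A] (p : BrParam R) (g : ℕ → A) : A :=
  g 2 * g 3 * heckeInv p (g 1) * heckeInv p (g 2)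

/-- The defining relations of the `q`-Brauer algebra on `n` strands. -/
inductive BrRel {R : Type*} [CommRing R] (p : BrParam R) (n : ℕ) :
    FreeAlgebra R (BrGen n) → FreeAlgebra R (BrGen n) → Prop
  | quad (i : ℕ) (h1 : 1 ≤ i) (h2 : i < n) :
      BrRel p n (freeG R n i * freeG R n i) (((p.q : R) - 1) • freeG R n i + (p.q : R) • 1)
  | braid (i : ℕ) (h1 : 1 ≤ i) (h2 : i + 1 < n) :
      BrRel p n (freeG R n i * freeG R n (i + 1) * freeG R n i)
        (freeG R n (i + 1) * freeG R n i * freeG R n (i + 1))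
  | far (i j : ℕ) (h1 : 1 ≤ i) (h2 : i + 2 ≤ j) (h3 : j < n) :
      BrRel p n (freeG R n i * freeG R n j) (freeG R n j * freeG R n i)
  | e_sq (h : 2 ≤ n) : BrRel p n (freeE R n * freeE R n) ((p.d : R) • freeE R n)
  | e_far (i : ℕ) (h1 : 3 ≤ i) (h2 : i < n) :
      BrRel p n (freeE R n * freeG R n i) (freeG R n i * freeE R n)
  | e_g1 (h : 2 ≤ n) : BrRel p n (freeE R n * freeG R n 1) ((p.q : R) • freeE R n)
  | g1_e (h : 2 ≤ n) : BrRel p n (freeG R n 1 * freeE R n) ((p.q : R) • freeE R n)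
  | e_g2_e (h : 3 ≤ n) :
      BrRel p n (freeE R n * freeG R n 2 * freeE R n) ((p.r : R) • freeE R n)
  | e_g2inv_e (h : 3 ≤ n) :
      BrRel p n (freeE R n * heckeInv p (freeG R n 2) * freeE R n)
        (((p.q⁻¹ : Rˣ) : R) • freeE R n)
  | twist_left (h : 4 ≤ n) :
      BrRel p n
        (twistWord p (freeG R n) * (freeE R n * twistWord p (freeG R n) * freeE R n))
        (freeE R n * twistWord p (freeG R n) * freeE R n)
  | twist_right (h : 4 ≤ n) :
      BrRel p n
        (freeE R n * twistWord p (freeG R n) * freeE R n * twistWord p (freeG R n))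
        (freeE R n * twistWord p (freeG R n) * freeE R n)

/-- The `q`-Brauer algebra on `n` strands, by generators and relations. -/
abbrev QBr {R : Type*} [CommRing R] (p : BrParam R) (n : ℕ) : Type _ := RingQuot (BrRel p n)

/-- The generator `g_i` of the `q`-Brauer algebra. -/
def brG {R : Type*} [CommRing R] (p : BrParam R) (n i : ℕ) : QBr p n :=
  RingQuot.mkAlgHom R (BrRel p n) (freeG R n i)

/-- The generator `e` of the `q`-Brauer algebra. -/
def brE {R : Type*} [CommRing R] (p : BrParam R) (n : ℕ) : QBr p n :=
  RingQuot.mkAlgHom R (BrRel p n) (freeE R n)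

theorem brG_quad {R : Type*} [CommRing R] (p : BrParam R) (n i : ℕ) (h1 : 1 ≤ i) (h2 : i < n) :
    brG p n i * brG p n i = ((p.q : R) - 1) • brG p n i + (p.q : R) • 1 := by
  have h := RingQuot.mkAlgHom_rel R (BrRel.quad (p := p) i h1 h2)
  simpa [brG] using h

/-- The element `heckeInv p g_i` is the inverse of `g_i`. -/
theorem brG_mul_heckeInv {R : Type*} [CommRing R] (p : BrParam R) (n i : ℕ)
    (h1 : 1 ≤ i) (h2 : i < n) :
    brG p n i * heckeInv p (brG p n i) = 1 ∧ heckeInv p (brG p n i) * brG p n i = 1 := by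
  have h := brG_quad p n i h1 h2
  have hq : ((p.q⁻¹ : Rˣ) : R) * (p.q : R) = 1 := Units.inv_mul p.q
  constructor
  · rw [heckeInv, mul_add, mul_smul_comm, mul_smul_comm, h, smul_add, smul_smul, smul_smul, hq,
      mul_one, one_smul, add_right_comm, ← add_smul, mul_sub, hq]
    simp
  · rw [heckeInv, add_mul, smul_mul_assoc, smul_mul_assoc, h, smul_add, smul_smul, smul_smul, hq,
      one_mul, one_smul, add_right_comm, ← add_smul, mul_sub, hq]
    simp

/-- The image of a generator under the standard inclusion. -/
def inclGen {R : Type*} [CommRing R] (p : BrParam R) (n : ℕ) : BrGen n → QBr p (n + 1)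
  | .g i _ => brG p (n + 1) i
  | .e _ => brE p (n + 1)

theorem lift_freeG {R : Type*} [CommRing R] (p : BrParam R) (n i : ℕ) (h1 : 1 ≤ i) (h2 : i < n) :
    FreeAlgebra.lift R (inclGen p n) (freeG R n i) = brG p (n + 1) i := by
  simp [freeG, h1, h2, inclGen]

theorem lift_freeE {R : Type*} [CommRing R] (p : BrParam R) (n : ℕ) (h : 2 ≤ n) :
    FreeAlgebra.lift R (inclGen p n) (freeE R n) = brE p (n + 1) := by
  simp [freeE, h, inclGen]

theorem lift_heckeInv {R A B : Type*} [CommRing R] [Ring A] [Algebra R A] [Ring B] [Algebra R B]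
    (p : BrParam R) (f : A →ₐ[R] B) (x : A) : f (heckeInv p x) = heckeInv p (f x) := by
  simp [heckeInv]

theorem inclGen_rel {R : Type*} [CommRing R] (p : BrParam R) (n : ℕ)
    ⦃x y : FreeAlgebra R (BrGen n)⦄ (h : BrRel p n x y) :
    FreeAlgebra.lift R (inclGen p n) x = FreeAlgebra.lift R (inclGen p n) y := by
  cases h with
  | quad i h1 h2 =>
    simpa [lift_freeG p n i h1 h2, brG] using
      RingQuot.mkAlgHom_rel R (BrRel.quad (p := p) (n := n + 1) i h1 (by omega))
  | braid i h1 h2 =>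
    simpa [lift_freeG p n i h1 (by omega), lift_freeG p n (i + 1) (by omega) h2, brG] using
      RingQuot.mkAlgHom_rel R (BrRel.braid (p := p) (n := n + 1) i h1 (by omega))
  | far i j h1 h2 h3 =>
    simpa [lift_freeG p n i h1 (by omega), lift_freeG p n j (by omega) h3, brG] using
      RingQuot.mkAlgHom_rel R (BrRel.far (p := p) (n := n + 1) i j h1 h2 (by omega))
  | e_sq h =>
    simpa [lift_freeE p n h, brE] using
      RingQuot.mkAlgHom_rel R (BrRel.e_sq (p := p) (n := n + 1) (by omega))
  | e_far i h1 h2 =>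
    simpa [lift_freeG p n i (by omega) h2, lift_freeE p n (by omega), brG, brE] using
      RingQuot.mkAlgHom_rel R (BrRel.e_far (p := p) (n := n + 1) i h1 (by omega))
  | e_g1 h =>
    simpa [lift_freeG p n 1 le_rfl (by omega), lift_freeE p n h, brG, brE] using
      RingQuot.mkAlgHom_rel R (BrRel.e_g1 (p := p) (n := n + 1) (by omega))
  | g1_e h =>
    simpa [lift_freeG p n 1 le_rfl (by omega), lift_freeE p n h, brG, brE] using
      RingQuot.mkAlgHom_rel R (BrRel.g1_e (p := p) (n := n + 1) (by omega))
  | e_g2_e h =>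
    simpa [lift_freeG p n 2 (by omega) (by omega), lift_freeE p n (by omega), brG, brE] using
      RingQuot.mkAlgHom_rel R (BrRel.e_g2_e (p := p) (n := n + 1) (by omega))
  | e_g2inv_e h =>
    simpa [lift_freeG p n 2 (by omega) (by omega), lift_freeE p n (by omega), brG, brE,
      lift_heckeInv] using
      RingQuot.mkAlgHom_rel R (BrRel.e_g2inv_e (p := p) (n := n + 1) (by omega))
  | twist_left h =>
    simpa [lift_freeG p n 1 (by omega) (by omega), lift_freeG p n 2 (by omega) (by omega),
      lift_freeG p n 3 (by omega) (by omega), lift_freeE p n (by omega), brG, brE,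
      lift_heckeInv, twistWord] using
      RingQuot.mkAlgHom_rel R (BrRel.twist_left (p := p) (n := n + 1) (by omega))
  | twist_right h =>
    simpa [lift_freeG p n 1 (by omega) (by omega), lift_freeG p n 2 (by omega) (by omega),
      lift_freeG p n 3 (by omega) (by omega), lift_freeE p n (by omega), brG, brE,
      lift_heckeInv, twistWord] using
      RingQuot.mkAlgHom_rel R (BrRel.twist_right (p := p) (n := n + 1) (by omega))

/-- The standard homomorphism from the algebra on `n` strands to the one on `n + 1` strands,
with `g_i ↦ g_i` and `e ↦ e`. -/
def brIncl {R : Type*} [CommRing R] (p : BrParam R) (n : ℕ) : QBr p n →ₐ[R] QBr p (n + 1) :=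
  RingQuot.liftAlgHom R ⟨FreeAlgebra.lift R (inclGen p n), inclGen_rel p n⟩

/-- The ascending product `g_i g_{i+1} ⋯ g_j`. -/
def gUp {R : Type*} [CommRing R] (p : BrParam R) (n i j : ℕ) : QBr p n :=
  ((List.range' i (j + 1 - i)).map (fun l => brG p n l)).prod

/-- The ascending product `g_i⁻¹ g_{i+1}⁻¹ ⋯ g_j⁻¹`. -/
def gUpInv {R : Type*} [CommRing R] (p : BrParam R) (n i j : ℕ) : QBr p n :=
  ((List.range' i (j + 1 - i)).map (fun l => heckeInv p (brG p n l))).prod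

/-- The elements `e_(k)` (meaningful for `2 k ≤ n`): `e_(0) = 1`, `e_(1) = e` and
`e_(k+1) = e (g_2 ⋯ g_{2k+1}) (g_1⁻¹ ⋯ g_{2k}⁻¹) e_(k)`. -/
def eK {R : Type*} [CommRing R] (p : BrParam R) (n : ℕ) : ℕ → QBr p n
  | 0 => 1
  | 1 => brE p n
  | k + 2 => brE p n * gUp p n 2 (2 * (k + 1) + 1) * gUpInv p n 1 (2 * (k + 1)) * eK p n (k + 1)

/-- The idempotent `ē_(k) = d⁻ᵏ e_(k)`. -/
def eBar {R : Type*} [CommRing R] (p : BrParam R) (n k : ℕ) : QBr p n :=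
  (((p.d⁻¹) ^ k : Rˣ) : R) • eK p n k

/-- The Hecke algebra, as the subalgebra generated by the `g_i`, `1 ≤ i < n`. -/
def heckeSub {R : Type*} [CommRing R] (p : BrParam R) (n : ℕ) : Subalgebra R (QBr p n) :=
  Algebra.adjoin R {x | ∃ i, 1 ≤ i ∧ i < n ∧ x = brG p n i}

/-- The corner `ē_(k) B ē_(k)` of the algebra `B` on `n` strands. -/
def corner {R : Type*} [CommRing R] (p : BrParam R) (n k : ℕ) :
    NonUnitalSubalgebra R (QBr p n) where
  carrier := {x | ∃ h, x = eBar p n k * h * eBar p n k}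
  add_mem' := by
    rintro _ _ ⟨a, rfl⟩ ⟨b, rfl⟩
    exact ⟨a + b, by rw [mul_add, add_mul]⟩
  zero_mem' := ⟨0, by simp⟩
  mul_mem' := by
    rintro _ _ ⟨a, rfl⟩ ⟨b, rfl⟩
    exact ⟨a * eBar p n k * eBar p n k * b, by simp only [mul_assoc]⟩
  smul_mem' := by
    rintro c _ ⟨a, rfl⟩
    exact ⟨c • a, by simp⟩

/-- The element `ē_(k) h ē_(k)` of the corner. -/
def toCorner {R : Type*} [CommRing R] (p : BrParam R) (n k : ℕ) (h : QBr p n) : corner p n k :=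
  ⟨eBar p n k * h * eBar p n k, h, rfl⟩

/-- `Ψ` is the isomorphism from the corner `ē_(k) B_n ē_(k)` onto `B_{n-2k}` with
`ē_(k) g_i ↦ g_{i-2k}` for `2k < i < n` and `ē_(k+1) ↦ ē_(1)` (if `2k + 2 ≤ n`). -/
structure IsPsi {R : Type*} [CommRing R] (p : BrParam R) (n k : ℕ)
    (Ψ : corner p n k →ₙₐ[R] QBr p (n - 2 * k)) : Prop where
  bijective : Function.Bijective Ψ
  map_g : ∀ i, 2 * k < i → i < n →
    ∃ x : corner p n k, (x : QBr p n) = eBar p n k * brG p n i ∧ Ψ x = brG p (n - 2 * k) (i - 2 * k)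
  map_e : 2 * (k + 1) ≤ n →
    ∃ x : corner p n k, (x : QBr p n) = eBar p n (k + 1) ∧ Ψ x = eBar p (n - 2 * k) 1

/-- A family of functionals `tr n` on the `q`-Brauer algebras which on the Hecke algebras is the
Markov trace with `tr g_i = r / d`, and which is extended inductively by
`tr (a ē_(k) b) = tr (ē_(k) b a ē_(k)) = (r q⁻¹ d⁻²)ᵏ tr (Ψ_k (ē_(k) b a ē_(k)))` for `a`, `b` in
the Hecke algebra. -/
structure IsExtendedTrace {R : Type*} [CommRing R] (p : BrParam R)
    (tr : ∀ n : ℕ, QBr p n →ₗ[R] R) : Prop where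
  map_one : ∀ n, tr n 1 = 1
  hecke_trace : ∀ n, ∀ a ∈ heckeSub p n, ∀ b ∈ heckeSub p n, tr n (a * b) = tr n (b * a)
  hecke_markov : ∀ n, 1 ≤ n → ∀ h ∈ heckeSub p n,
    tr (n + 1) (brG p (n + 1) n * brIncl p n h) = ((p.r * p.d⁻¹ : Rˣ) : R) * tr n h
  extend : ∀ n k, 1 ≤ k → 2 * k ≤ n →
    ∃ Ψ : corner p n k →ₙₐ[R] QBr p (n - 2 * k), IsPsi p n k Ψ ∧
      ∀ a ∈ heckeSub p n, ∀ b ∈ heckeSub p n,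
        tr n (a * eBar p n k * b) = tr n (eBar p n k * (b * a) * eBar p n k) ∧
        tr n (eBar p n k * (b * a) * eBar p n k) =
          (((p.r * p.q⁻¹ * p.d⁻¹ * p.d⁻¹) ^ k : Rˣ) : R) *
            tr (n - 2 * k) (Ψ (toCorner p n k (b * a)))

/-- The Laurent polynomial `[N] = (1 - q ^ N) / (1 - q)`: `1 + q + ⋯ + q ^ (N - 1)` for `N ≥ 0`, and
`-(q⁻¹ + ⋯ + q ^ N)` for `N < 0`. -/
def qInt : ℤ → LaurentPolynomial ℤ
  | Int.ofNat m => ∑ i ∈ Finset.range m, LaurentPolynomial.T (i : ℤ)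
  | Int.negSucc m => -∑ i ∈ Finset.range (m + 1), LaurentPolynomial.T (-((i : ℤ) + 1))

theorem T_sub_one_mul_qInt (N : ℤ) :
    (LaurentPolynomial.T 1 - 1) * qInt N = LaurentPolynomial.T N - 1 := by
  cases N with
  | ofNat m =>
    induction m with
    | zero => simp [qInt]
    | succ m ih =>
      simp only [qInt, Int.ofNat_eq_natCast] at ih ⊢
      rw [Finset.sum_range_succ, mul_add, ih, sub_mul, one_mul, ← LaurentPolynomial.T_add]
      push_cast
      rw [add_comm (1 : ℤ)]
      ring
  | negSucc m =>
    induction m with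
    | zero =>
      simp only [qInt, zero_add, Finset.sum_range_one, Int.negSucc_eq]
      rw [mul_neg, sub_mul, one_mul, ← LaurentPolynomial.T_add]
      simp
    | succ m ih =>
      simp only [qInt, Int.negSucc_eq] at ih ⊢
      rw [Finset.sum_range_succ, neg_add, mul_add, ih, mul_neg, sub_mul, one_mul,
        ← LaurentPolynomial.T_add]
      push_cast
      rw [show (1 : ℤ) + -((m : ℤ) + 1 + 1) = -((m : ℤ) + 1) by ring]
      ring

/-- The ground ring `ℤ[q, q⁻¹, [N]⁻¹]`. -/
abbrev GroundRing (N : ℤ) : Type := Localization.Away (qInt N)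

/-- The unit `q` of the Laurent polynomial ring. -/
def laurentQ : (LaurentPolynomial ℤ)ˣ where
  val := LaurentPolynomial.T 1
  inv := LaurentPolynomial.T (-1)
  val_inv := by rw [← LaurentPolynomial.T_add]; simp
  inv_val := by rw [← LaurentPolynomial.T_add]; simp

theorem laurentQ_zpow (N : ℤ) :
    ((laurentQ ^ N : (LaurentPolynomial ℤ)ˣ) : LaurentPolynomial ℤ) = LaurentPolynomial.T N := by
  have hn : ∀ m : ℕ, ((laurentQ ^ m : (LaurentPolynomial ℤ)ˣ) : LaurentPolynomial ℤ) =
      LaurentPolynomial.T (m : ℤ) := by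
    intro m
    rw [Units.val_pow_eq_pow_val]
    simp [laurentQ, LaurentPolynomial.T_pow]
  cases N with
  | ofNat m => simpa using hn m
  | negSucc m =>
    rw [zpow_negSucc, Units.inv_eq_of_mul_eq_one_right]
    rw [hn, ← LaurentPolynomial.T_add, Int.negSucc_eq]
    push_cast
    simp

/-- The parameters `q`, `r = q ^ N` and `d = [N]` over `ℤ[q, q⁻¹, [N]⁻¹]`. -/
def brParam (N : ℤ) : BrParam (GroundRing N) where
  q := Units.map (algebraMap (LaurentPolynomial ℤ) (GroundRing N)).toMonoidHom laurentQ
  r := Units.map (algebraMap (LaurentPolynomial ℤ) (GroundRing N)).toMonoidHom laurentQ ^ N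
  d := (IsLocalization.Away.algebraMap_isUnit (S := GroundRing N) (qInt N)).unit
  rel := by
    rw [← map_zpow]
    simp only [Units.coe_map, IsUnit.unit_spec, RingHom.toMonoidHom_eq_coe, MonoidHom.coe_coe,
      laurentQ_zpow]
    rw [← map_one (algebraMap (LaurentPolynomial ℤ) (GroundRing N)), ← map_sub, ← map_sub,
      ← map_mul, ← T_sub_one_mul_qInt]
    rfl

end

/-! ### The presentation as a universal property -/

noncomputable section

/-! Put f = d⁻¹e. Everything rests on the multiplicative linear map Br_m → Br_{m+2} that inserts a
cup and cap to the left of the strands: 1 ↦ f, g_i ↦ f g_{i+2}, e ↦ d⁻¹e_(2) (`corner_brRelations`,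
`cupMap`). It sends ē_(k) to ē_(k+1) (`cupMap_eBar`), so facts about all ē_(k) reduce to
computations on few strands. Normal forms for ē_(k)H_n (`eBar_mul_heckeInt`) show that Br_n is
spanned by the elements aē_(k)b with a, b in H_n (`mem_span_hecke_eBar_hecke`) and that f Br_{m+2} f
is exactly the image of Br_m (`brF_mul_mul_brF_mem`).

Uniqueness. The generator values prescribed for Ψ_k force it to invert the k-fold cup insertion
(`IsPsi.apply_cupCorner`). Hence the formula for tr(aē_(k)b) with k ≥ 1 reduces to n - 2k strands,
while the Markov trace on the Hecke algebras is determined by its axioms (`IsExtendedTrace.unique`).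

Existence. It suffices to have functionals T_n that are invariant under Hecke conjugation,
compatible with inclusions, Markov on both sides of g_n, and correctly normalised on f
(`MarkovFamily`). For such a family an induction along H_n ⊂ H_{n+1} and H_{2k+2}ē_(k+1) =
H_{2k+1}ē_(k+1) (`hecke_eBar_induction`) proves T(hē_(k)) = T(ē_(k)hē_(k)), and that inserting a cup
multiplies T by r q⁻¹d⁻². If cup insertion is moreover injective, then Ψ_k can be taken to be its
inverse and T is the extended trace (`MarkovFamily.isExtendedTrace`). The Markov property of T is
two-sided by definition, so it holds for all c in Br_n and not only on the Hecke algebra; by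
uniqueness it holds for every extended trace.

Both ingredients are produced over the generic ring A = ℤ[q,d] with q, d and r = 1 + (q-1)d
inverted. For q = s², d = 1 + q + ⋯ + q^N, the algebra acts on functions on words in N+1 letters:
g_i through an R-matrix, e as a cup after a cap (`WordParam.relations`). The weighted trace of this
action is a Markov family with values in a power series ring. Taking all N at once, the values of
the resulting family are A-multiples of its value at 1 (`MarkovFamily.apply_mem_span`), and A embeds
in the product of the series rings, so the family descends to A (`genTrace`).

Injectivity follows from joint faithfulness of the word representations (`eq_zero_of_rep_eq_zero`),
because capping off an inserted cup recovers the original operator up to d². For faithfulness take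
the spanning set indexed by Brauer diagrams. At q = 1 its members act by 0/1 matrices up to powers
of d, triangular in the number of horizontal edges. Thus the coefficients of an element acting by
zero vanish at q = 1, d = N+1 for all large N, hence are divisible by q - 1; dividing and repeating,
Krull's intersection theorem makes them zero.

Any parameters are a base change of the generic ones. A Markov family extends linearly, and
injectivity survives because x ↦ f x f supplies a linear left inverse of cup insertion
(`genCorner`). This covers negative N as well, where no word representation is used directly. -/

/-- The defining relations of the `q`-Brauer algebra, for elements of an arbitrary algebra. -/
structure BrRelations {R B : Type*} [CommRing R] [Ring B] [Algebra R B] (p : BrParam R) (n : ℕ)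
    (G : ℕ → B) (E : B) : Prop where
  quad : ∀ i, 1 ≤ i → i < n → G i * G i = ((p.q : R) - 1) • G i + (p.q : R) • (1 : B)
  braid : ∀ i, 1 ≤ i → i + 1 < n → G i * G (i + 1) * G i = G (i + 1) * G i * G (i + 1)
  far : ∀ i j, 1 ≤ i → i + 2 ≤ j → j < n → G i * G j = G j * G i
  e_sq : 2 ≤ n → E * E = (p.d : R) • E
  e_far : ∀ i, 3 ≤ i → i < n → E * G i = G i * E
  e_g1 : 2 ≤ n → E * G 1 = (p.q : R) • E
  g1_e : 2 ≤ n → G 1 * E = (p.q : R) • E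
  e_g2_e : 3 ≤ n → E * G 2 * E = (p.r : R) • E
  e_g2inv_e : 3 ≤ n → E * heckeInv p (G 2) * E = ((p.q⁻¹ : Rˣ) : R) • E
  twist_left : 4 ≤ n →
    twistWord p G * (E * twistWord p G * E) = E * twistWord p G * E
  twist_right : 4 ≤ n →
    E * twistWord p G * E * twistWord p G = E * twistWord p G * E

section Lift

variable {R B : Type*} [CommRing R] [Ring B] [Algebra R B] {p : BrParam R} {n : ℕ}

/-- The assignment of values to the generators. -/
def genMap (n : ℕ) (G : ℕ → B) (E : B) : BrGen n → B
  | .g i _ => G i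
  | .e _ => E

theorem lift_genMap_g (G : ℕ → B) (E : B) {i : ℕ} (h1 : 1 ≤ i) (h2 : i < n) :
    FreeAlgebra.lift R (genMap n G E) (freeG R n i) = G i := by
  simp [freeG, h1, h2, genMap]

theorem lift_genMap_e (G : ℕ → B) (E : B) (h : 2 ≤ n) :
    FreeAlgebra.lift R (genMap n G E) (freeE R n) = E := by
  simp [freeE, h, genMap]

theorem BrRelations.lift_rel {G : ℕ → B} {E : B} (H : BrRelations p n G E)
    ⦃x y : FreeAlgebra R (BrGen n)⦄ (h : BrRel p n x y) :
    FreeAlgebra.lift R (genMap n G E) x = FreeAlgebra.lift R (genMap n G E) y := by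
  cases h with
  | quad i h1 h2 => simpa [lift_genMap_g G E h1 h2] using H.quad i h1 h2
  | braid i h1 h2 =>
    simpa [lift_genMap_g G E h1 (show i < n by omega), lift_genMap_g G E (i := i + 1) (by omega) h2]
      using H.braid i h1 h2
  | far i j h1 h2 h3 =>
    simpa [lift_genMap_g G E h1 (show i < n by omega), lift_genMap_g G E (i := j) (by omega) h3]
      using H.far i j h1 h2 h3
  | e_sq h => simpa [lift_genMap_e G E h] using H.e_sq h
  | e_far i h1 h2 =>
    simpa [lift_genMap_e G E (n := n) (by omega), lift_genMap_g G E (i := i) (by omega) h2]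
      using H.e_far i h1 h2
  | e_g1 h =>
    simpa [lift_genMap_e G E h, lift_genMap_g G E le_rfl h] using H.e_g1 h
  | g1_e h =>
    simpa [lift_genMap_e G E h, lift_genMap_g G E le_rfl h] using H.g1_e h
  | e_g2_e h =>
    simpa [lift_genMap_e G E (n := n) (by omega), lift_genMap_g G E (i := 2) (by omega) h]
      using H.e_g2_e h
  | e_g2inv_e h =>
    simpa [lift_genMap_e G E (n := n) (by omega), lift_genMap_g G E (i := 2) (by omega) h,
      lift_heckeInv] using H.e_g2inv_e h
  | twist_left h =>
    simpa [twistWord, lift_genMap_e G E (n := n) (by omega),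
      lift_genMap_g G E (i := 1) (n := n) (by omega) (by omega),
      lift_genMap_g G E (i := 2) (n := n) (by omega) (by omega),
      lift_genMap_g G E (i := 3) (n := n) (by omega) (by omega),
      lift_heckeInv] using H.twist_left h
  | twist_right h =>
    simpa [twistWord, lift_genMap_e G E (n := n) (by omega),
      lift_genMap_g G E (i := 1) (n := n) (by omega) (by omega),
      lift_genMap_g G E (i := 2) (n := n) (by omega) (by omega),
      lift_genMap_g G E (i := 3) (n := n) (by omega) (by omega),
      lift_heckeInv] using H.twist_right h

/-- The homomorphism out of the `q`-Brauer algebra given by elements satisfying the relations. -/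
def BrRelations.lift {G : ℕ → B} {E : B} (H : BrRelations p n G E) : QBr p n →ₐ[R] B :=
  RingQuot.liftAlgHom R ⟨FreeAlgebra.lift R (genMap n G E), H.lift_rel⟩

theorem BrRelations.lift_brG {G : ℕ → B} {E : B} (H : BrRelations p n G E) {i : ℕ} (h1 : 1 ≤ i)
    (h2 : i < n) : H.lift (brG p n i) = G i := by
  rw [BrRelations.lift, brG, RingQuot.liftAlgHom_mkAlgHom_apply, lift_genMap_g G E h1 h2]

theorem BrRelations.lift_brE {G : ℕ → B} {E : B} (H : BrRelations p n G E) (h : 2 ≤ n) :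
    H.lift (brE p n) = E := by
  rw [BrRelations.lift, brE, RingQuot.liftAlgHom_mkAlgHom_apply, lift_genMap_e G E h]

/-- With out-of-range generators equal to zero, the braid and commutation relations hold without an
upper bound on the indices. Only the invertibility of g_i still needs the range. -/
theorem brG_out {i : ℕ} (h : ¬ (1 ≤ i ∧ i < n)) : brG p n i = 0 := by
  simp [brG, freeG, h]

theorem brE_out (h : ¬ 2 ≤ n) : brE p n = 0 := by
  simp [brE, freeE, h]

/-- Induction over the `q`-Brauer algebra. -/
theorem QBr.induction {P : QBr p n → Prop} (hc : ∀ c : R, P (algebraMap R _ c))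
    (hg : ∀ i, 1 ≤ i → i < n → P (brG p n i)) (he : 2 ≤ n → P (brE p n))
    (hadd : ∀ x y, P x → P y → P (x + y)) (hmul : ∀ x y, P x → P y → P (x * y))
    (x : QBr p n) : P x := by
  obtain ⟨y, rfl⟩ := RingQuot.mkAlgHom_surjective R (BrRel p n) x
  induction y using FreeAlgebra.induction with
  | grade0 c => simpa using hc c
  | grade1 z =>
    cases z with
    | g i hi => simpa [brG, freeG, hi] using hg i hi.1 hi.2
    | e h => simpa [brE, freeE, h] using he h
  | mul a b ha hb => simpa using hmul _ _ ha hb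
  | add a b ha hb => simpa using hadd _ _ ha hb

theorem QBr.algHom_ext {f f' : QBr p n →ₐ[R] B}
    (hg : ∀ i, 1 ≤ i → i < n → f (brG p n i) = f' (brG p n i))
    (he : 2 ≤ n → f (brE p n) = f' (brE p n)) : f = f' := by
  refine AlgHom.ext fun x => ?_
  induction x using QBr.induction with
  | hc c => simp
  | hg i h1 h2 => exact hg i h1 h2
  | he h => exact he h
  | hadd x y hx hy => simp [hx, hy]
  | hmul x y hx hy => simp [hx, hy]

end Lift

/-! ### The relations inside the algebra, and the inverse generators -/

section Relations

variable {R : Type*} [CommRing R] (p : BrParam R) (n : ℕ)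

theorem brRelations : BrRelations p n (brG p n) (brE p n) where
  quad i h1 h2 := brG_quad p n i h1 h2
  braid i h1 h2 := by simpa [brG] using RingQuot.mkAlgHom_rel R (BrRel.braid (p := p) i h1 h2)
  far i j h1 h2 h3 := by
    simpa [brG] using RingQuot.mkAlgHom_rel R (BrRel.far (p := p) i j h1 h2 h3)
  e_sq h := by simpa [brE] using RingQuot.mkAlgHom_rel R (BrRel.e_sq (p := p) h)
  e_far i h1 h2 := by
    simpa [brE, brG] using RingQuot.mkAlgHom_rel R (BrRel.e_far (p := p) i h1 h2)
  e_g1 h := by simpa [brE, brG] using RingQuot.mkAlgHom_rel R (BrRel.e_g1 (p := p) h)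
  g1_e h := by simpa [brE, brG] using RingQuot.mkAlgHom_rel R (BrRel.g1_e (p := p) h)
  e_g2_e h := by simpa [brE, brG] using RingQuot.mkAlgHom_rel R (BrRel.e_g2_e (p := p) h)
  e_g2inv_e h := by
    simpa [brE, brG, lift_heckeInv] using RingQuot.mkAlgHom_rel R (BrRel.e_g2inv_e (p := p) h)
  twist_left h := by
    simpa [brE, brG, lift_heckeInv, twistWord] using
      RingQuot.mkAlgHom_rel R (BrRel.twist_left (p := p) h)
  twist_right h := by
    simpa [brE, brG, lift_heckeInv, twistWord] using
      RingQuot.mkAlgHom_rel R (BrRel.twist_right (p := p) h)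

theorem brG_braid (i : ℕ) :
    brG p n i * brG p n (i + 1) * brG p n i = brG p n (i + 1) * brG p n i * brG p n (i + 1) := by
  by_cases h1 : 1 ≤ i
  · by_cases h2 : i + 1 < n
    · exact (brRelations p n).braid i h1 h2
    · simp [brG_out (p := p) (n := n) (i := i + 1) (by omega)]
  · simp [brG_out (p := p) (n := n) (i := i) (by omega)]

theorem brG_far {i j : ℕ} (h : i + 2 ≤ j) : Commute (brG p n i) (brG p n j) := by
  by_cases h1 : 1 ≤ i
  · by_cases h2 : j < n
    · exact (brRelations p n).far i j h1 h h2
    · simp [brG_out (p := p) (n := n) (i := j) (by omega)]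
  · simp [brG_out (p := p) (n := n) (i := i) (by omega)]

theorem brE_far {i : ℕ} (h : 3 ≤ i) : Commute (brE p n) (brG p n i) := by
  by_cases h2 : i < n
  · exact (brRelations p n).e_far i h h2
  · simp [brG_out (p := p) (n := n) (i := i) (by omega)]

theorem brE_sq : brE p n * brE p n = (p.d : R) • brE p n := by
  by_cases h : 2 ≤ n
  · exact (brRelations p n).e_sq h
  · simp [brE_out (p := p) h]

theorem brE_mul_brG_one : brE p n * brG p n 1 = (p.q : R) • brE p n := by
  by_cases h : 2 ≤ n
  · exact (brRelations p n).e_g1 h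
  · simp [brE_out (p := p) h]

theorem brG_one_mul_brE : brG p n 1 * brE p n = (p.q : R) • brE p n := by
  by_cases h : 2 ≤ n
  · exact (brRelations p n).g1_e h
  · simp [brE_out (p := p) h]

/-- The inverse of the generator `g_i`. -/
def brI (i : ℕ) : QBr p n := heckeInv p (brG p n i)

variable {n}

theorem brG_mul_brI {i : ℕ} (h1 : 1 ≤ i) (h2 : i < n) : brG p n i * brI p n i = 1 :=
  (brG_mul_heckeInv p n i h1 h2).1

theorem brI_mul_brG {i : ℕ} (h1 : 1 ≤ i) (h2 : i < n) : brI p n i * brG p n i = 1 :=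
  (brG_mul_heckeInv p n i h1 h2).2

theorem Commute.heckeInv_right {B : Type*} [Ring B] [Algebra R B] {x y : B} (h : Commute x y) :
    Commute x (heckeInv p y) :=
  (h.smul_right _).add_right ((Commute.one_right x).smul_right _)

variable (n)

theorem brI_eq (i : ℕ) : brI p n i =
    ((p.q⁻¹ : Rˣ) : R) • brG p n i + (((p.q⁻¹ : Rˣ) : R) - 1) • (1 : QBr p n) := rfl

theorem brG_eq (i : ℕ) : brG p n i =
    (p.q : R) • brI p n i + ((p.q : R) - 1) • (1 : QBr p n) := by
  rw [brI_eq, smul_add, smul_smul, smul_smul, Units.mul_inv, one_smul, add_assoc, ← add_smul]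
  rw [mul_sub, Units.mul_inv]
  simp

theorem brI_far {i j : ℕ} (h : i + 2 ≤ j) : Commute (brI p n i) (brI p n j) :=
  ((brG_far p n h).heckeInv_right p).symm.heckeInv_right p |>.symm

theorem brG_brI_far {i j : ℕ} (h : i + 2 ≤ j) : Commute (brG p n i) (brI p n j) :=
  (brG_far p n h).heckeInv_right p

theorem brI_brG_far {i j : ℕ} (h : i + 2 ≤ j) : Commute (brI p n i) (brG p n j) :=
  ((brG_far p n h).symm.heckeInv_right p).symm

theorem brE_brI_far {i : ℕ} (h : 3 ≤ i) : Commute (brE p n) (brI p n i) :=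
  (brE_far p n h).heckeInv_right p

theorem brE_mul_brI_one : brE p n * brI p n 1 = ((p.q⁻¹ : Rˣ) : R) • brE p n := by
  rw [brI_eq, mul_add, mul_smul_comm, brE_mul_brG_one, smul_smul, mul_smul_comm, mul_one,
    ← add_smul, Units.inv_mul]
  simp

theorem brI_one_mul_brE : brI p n 1 * brE p n = ((p.q⁻¹ : Rˣ) : R) • brE p n := by
  rw [brI_eq, add_mul, smul_mul_assoc, brG_one_mul_brE, smul_smul, smul_mul_assoc, one_mul,
    ← add_smul, Units.inv_mul]
  simp

variable {n}

/-- `g_i⁻¹ g_{i+1}⁻¹ g_i = g_{i+1} g_i⁻¹ g_{i+1}⁻¹`. -/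
theorem brI_brI_brG {i : ℕ} (h1 : 1 ≤ i) (h2 : i + 1 < n) :
    brI p n i * brI p n (i + 1) * brG p n i = brG p n (i + 1) * brI p n i * brI p n (i + 1) := by
  have a1 := brG_mul_brI p h1 (show i < n by omega)
  have a2 := brI_mul_brG p h1 (show i < n by omega)
  have b1 := brG_mul_brI p (show 1 ≤ i + 1 by omega) h2
  have b2 := brI_mul_brG p (show 1 ≤ i + 1 by omega) h2
  have br := brG_braid p n i
  calc _ = brI p n i * brI p n (i + 1) * (brG p n i * brG p n (i + 1) * brG p n i) *
        brI p n i * brI p n (i + 1) := by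
        simp only [mul_assoc]; rw [← mul_assoc (brG p n i) (brI p n i), a1, one_mul, b1, mul_one]
    _ = _ := by
        rw [br]; simp only [mul_assoc]
        rw [← mul_assoc (brI p n (i + 1)) (brG p n (i + 1)), b2, one_mul,
          ← mul_assoc (brI p n i) (brG p n i), a2, one_mul]

end Relations

/-! ### Ascending and descending chains -/

section Chains

/-- The ascending product `f a * f (a + 1) * ⋯ * f (a + l - 1)`. -/
def upProd {M : Type*} [Monoid M] (f : ℕ → M) (a : ℕ) : ℕ → M
  | 0 => 1
  | l + 1 => upProd f a l * f (a + l)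

/-- The descending product `f (a + l - 1) * ⋯ * f (a + 1) * f a`. -/
def downProd {M : Type*} [Monoid M] (f : ℕ → M) (a : ℕ) : ℕ → M
  | 0 => 1
  | l + 1 => f (a + l) * downProd f a l

variable {M : Type*} [Monoid M]

theorem upProd_zero (f : ℕ → M) (a : ℕ) : upProd f a 0 = 1 := rfl

theorem upProd_succ (f : ℕ → M) (a l : ℕ) : upProd f a (l + 1) = upProd f a l * f (a + l) := rfl

theorem upProd_succ' (f : ℕ → M) (a l : ℕ) :
    upProd f a (l + 1) = f a * upProd f (a + 1) l := by
  induction l with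
  | zero => simp [upProd]
  | succ l ih => rw [upProd_succ, ih, upProd_succ, mul_assoc]; congr 3; omega

theorem downProd_zero (f : ℕ → M) (a : ℕ) : downProd f a 0 = 1 := rfl

theorem downProd_succ (f : ℕ → M) (a l : ℕ) :
    downProd f a (l + 1) = f (a + l) * downProd f a l := rfl

theorem prod_range'_map (f : ℕ → M) (a l : ℕ) :
    ((List.range' a l).map f).prod = upProd f a l := by
  induction l generalizing a with
  | zero => simp [upProd]
  | succ l ih => rw [List.range'_succ, List.map_cons, List.prod_cons, ih, upProd_succ']

theorem Commute.upProd_right {x : M} {f : ℕ → M} {a l : ℕ}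
    (h : ∀ i, a ≤ i → i < a + l → Commute x (f i)) : Commute x (upProd f a l) := by
  induction l with
  | zero => exact Commute.one_right x
  | succ l ih =>
    exact (ih fun i h1 h2 => h i h1 (by omega)).mul_right (h _ (by omega) (by omega))

theorem map_upProd {M' F : Type*} [Monoid M'] [FunLike F M M'] [MonoidHomClass F M M'] (φ : F)
    (f : ℕ → M) (a l : ℕ) : φ (upProd f a l) = upProd (fun i => φ (f i)) a l := by
  induction l with
  | zero => simp [upProd]
  | succ l ih => simp [upProd, ih]

theorem upProd_congr {f f' : ℕ → M} {a l : ℕ} (h : ∀ i, a ≤ i → i < a + l → f i = f' i) :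
    upProd f a l = upProd f' a l := by
  induction l with
  | zero => rfl
  | succ l ih =>
    rw [upProd_succ, upProd_succ, ih fun i h1 h2 => h i h1 (by omega), h _ (by omega) (by omega)]

/-- Conjugation by a chain raises the index. -/
theorem upProd_mul_shift {f g : ℕ → M} {a l : ℕ}
    (hfar : ∀ i j, i + 2 ≤ j ∨ j + 2 ≤ i → Commute (f i) (g j))
    (hbr : ∀ i, a ≤ i → i + 1 < a + l → f i * f (i + 1) * g i = g (i + 1) * (f i * f (i + 1)))
    {i : ℕ} (h1 : a ≤ i) (h2 : i + 1 < a + l) :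
    upProd f a l * g i = g (i + 1) * upProd f a l := by
  induction l with
  | zero => omega
  | succ l ih =>
    -- If the index is not at the end of the chain, the last letter commutes past and induction
    -- applies; otherwise the last two letters do the shifting and the rest of the chain commutes
    -- with the shifted generator.
    rcases Nat.lt_or_ge (i + 1) (a + l) with h | h
    · rw [upProd_succ, mul_assoc, hfar (a + l) i (by omega), ← mul_assoc,
        ih (fun j h3 h4 => hbr j h3 (by omega)) h, mul_assoc]
    · obtain ⟨l', rfl⟩ : ∃ l', l = l' + 1 := ⟨l - 1, by omega⟩
      obtain rfl : i = a + l' := by omega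
      have hc : Commute (g (a + l' + 1)) (upProd f a l') :=
        Commute.upProd_right fun j h3 h4 => (hfar j _ (by omega)).symm
      have hb := hbr (a + l') (by omega) (by omega)
      rw [upProd_succ, upProd_succ]
      calc _ = upProd f a l' * (f (a + l') * f (a + l' + 1) * g (a + l')) := by
            simp only [mul_assoc]; rfl
        _ = g (a + l' + 1) * (upProd f a l' * (f (a + l') * f (a + l' + 1))) := by
            rw [hb, ← mul_assoc, ← hc.eq, mul_assoc]
        _ = _ := by simp only [mul_assoc]; rfl

end Chains

section ChainRelations

variable {R : Type*} [CommRing R] (p : BrParam R) {n : ℕ}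

theorem upProd_brG_mul {a l i : ℕ} (h1 : a ≤ i) (h2 : i + 1 < a + l) :
    upProd (brG p n) a l * brG p n i = brG p n (i + 1) * upProd (brG p n) a l := by
  refine upProd_mul_shift ?_ ?_ h1 h2
  · rintro i j (h | h)
    · exact brG_far p n h
    · exact (brG_far p n h).symm
  · intro i _ _
    rw [← mul_assoc]; exact brG_braid p n i

/-- A chain of inverses also raises the index of a positive generator, thanks to the mixed braid
relation `brI_brI_brG`; that relation needs invertibility, hence the range hypotheses. -/
theorem upProd_brI_mul {a l i : ℕ} (ha : 1 ≤ a) (hl : a + l ≤ n) (h1 : a ≤ i)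
    (h2 : i + 1 < a + l) :
    upProd (brI p n) a l * brG p n i = brG p n (i + 1) * upProd (brI p n) a l := by
  refine upProd_mul_shift ?_ ?_ h1 h2
  · rintro i j (h | h)
    · exact brI_brG_far p n h
    · exact (brG_brI_far p n h).symm
  · intro i h3 h4
    rw [← mul_assoc]; exact brI_brI_brG p (by omega) (by omega)

end ChainRelations

/-! ### Parabolic subalgebras of the Hecke algebra -/

section HeckeSub

variable {R : Type*} [CommRing R] (p : BrParam R) (n : ℕ)

/-- The subalgebra generated by the `g_i` with `a ≤ i < b`. -/
def heckeInt (a b : ℕ) : Subalgebra R (QBr p n) :=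
  Algebra.adjoin R {x | ∃ i, a ≤ i ∧ i < b ∧ x = brG p n i}

variable {n}

theorem brG_mem {a b i : ℕ} (h1 : a ≤ i) (h2 : i < b) : brG p n i ∈ heckeInt p n a b :=
  Algebra.subset_adjoin ⟨i, h1, h2, rfl⟩

theorem heckeInv_mem {A : Type*} [Ring A] [Algebra R A] {S : Subalgebra R A} {x : A} (h : x ∈ S) :
    heckeInv p x ∈ S :=
  S.add_mem (S.smul_mem h _) (S.smul_mem S.one_mem _)

theorem brI_mem {a b i : ℕ} (h1 : a ≤ i) (h2 : i < b) : brI p n i ∈ heckeInt p n a b :=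
  heckeInv_mem p (brG_mem p h1 h2)

theorem heckeInt_mono {a b a' b' : ℕ} (h1 : a' ≤ a) (h2 : b ≤ b') :
    heckeInt p n a b ≤ heckeInt p n a' b' := by
  refine Algebra.adjoin_mono ?_
  rintro x ⟨i, h3, h4, rfl⟩
  exact ⟨i, by omega, by omega, rfl⟩

theorem upProd_mem {A : Type*} [Ring A] [Algebra R A] {S : Subalgebra R A} {f : ℕ → A} {a l : ℕ}
    (h : ∀ i, a ≤ i → i < a + l → f i ∈ S) : upProd f a l ∈ S := by
  induction l with
  | zero => exact S.one_mem
  | succ l ih => exact S.mul_mem (ih fun i h1 h2 => h i h1 (by omega)) (h _ (by omega) (by omega))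

theorem downProd_mem {A : Type*} [Ring A] [Algebra R A] {S : Subalgebra R A} {f : ℕ → A}
    {a l : ℕ} (h : ∀ i, a ≤ i → i < a + l → f i ∈ S) : downProd f a l ∈ S := by
  induction l with
  | zero => exact S.one_mem
  | succ l ih => exact S.mul_mem (h _ (by omega) (by omega)) (ih fun i h1 h2 => h i h1 (by omega))

/-- An element commuting with the generators commutes with the subalgebra. -/
theorem commute_of_mem_heckeInt {a b : ℕ} {y : QBr p n}
    (h : ∀ i, a ≤ i → i < b → Commute y (brG p n i)) {x : QBr p n} (hx : x ∈ heckeInt p n a b) :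
    Commute y x := by
  induction hx using Algebra.adjoin_induction with
  | mem x hx => obtain ⟨i, h1, h2, rfl⟩ := hx; exact h i h1 h2
  | algebraMap c => exact (Algebra.commutes c y).symm
  | add x y _ _ hx hy => exact hx.add_right hy
  | mul x y _ _ hx hy => exact hx.mul_right hy

theorem brG_commute_heckeInt {a b i : ℕ} (h : b < i ∨ i + 2 ≤ a) {x : QBr p n}
    (hx : x ∈ heckeInt p n a b) : Commute (brG p n i) x := by
  refine commute_of_mem_heckeInt p (fun j h1 h2 => ?_) hx
  rcases h with h | h
  · exact (brG_far p n (by omega)).symm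
  · exact brG_far p n (by omega)

theorem brI_commute_heckeInt {a b i : ℕ} (h : b < i ∨ i + 2 ≤ a) {x : QBr p n}
    (hx : x ∈ heckeInt p n a b) : Commute (brI p n i) x :=
  ((brG_commute_heckeInt p h hx).symm.heckeInv_right p).symm

/-- Induction over words in the generators, multiplying on the right. -/
theorem heckeInt_induction_right {a b : ℕ} {P : Submodule R (QBr p n)} (h1 : 1 ∈ P)
    (hmul : ∀ x ∈ P, ∀ i, a ≤ i → i < b → x * brG p n i ∈ P) {x : QBr p n}
    (hx : x ∈ heckeInt p n a b) : x ∈ P := by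
  suffices h : ∀ y ∈ P, y * x ∈ P by simpa using h 1 h1
  induction hx using Algebra.adjoin_induction with
  | mem x hx => obtain ⟨i, h3, h4, rfl⟩ := hx; exact fun y hy => hmul y hy i h3 h4
  | algebraMap c =>
    intro y hy
    rw [← Algebra.commutes, ← Algebra.smul_def]
    exact P.smul_mem c hy
  | add x y _ _ hx hy => intro z hz; rw [mul_add]; exact P.add_mem (hx z hz) (hy z hz)
  | mul x y _ _ hx hy => intro z hz; rw [← mul_assoc]; exact hy _ (hx z hz)

/-- The space H_b + H_b g_b H_b contains 1, so it is everything once it is stable under right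
multiplication by generators. The only product that is not visibly inside is x g_b y g_b, which is
isolated as `key`. -/
theorem heckeInt_succ_aux {a b : ℕ}
    (key : ∀ x ∈ heckeInt p n a b, ∀ y ∈ heckeInt p n a b,
      x * brG p n b * y * brG p n b ∈ Submodule.span R {z | z ∈ heckeInt p n a b ∨
        ∃ x ∈ heckeInt p n a b, ∃ y ∈ heckeInt p n a b, z = x * brG p n b * y})
    {P : Submodule R (QBr p n)} (h1 : ∀ x ∈ heckeInt p n a b, x ∈ P)
    (h2 : ∀ x ∈ heckeInt p n a b, ∀ y ∈ heckeInt p n a b, x * brG p n b * y ∈ P) {x : QBr p n}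
    (hx : x ∈ heckeInt p n a (b + 1)) : x ∈ P := by
  set D := Submodule.span R {z | z ∈ heckeInt p n a b ∨
        ∃ x ∈ heckeInt p n a b, ∃ y ∈ heckeInt p n a b, z = x * brG p n b * y} with hD
  have hDP : D ≤ P := by
    refine Submodule.span_le.2 ?_
    rintro z (hz | ⟨x, hx, y, hy, rfl⟩)
    · exact h1 z hz
    · exact h2 x hx y hy
  refine hDP (heckeInt_induction_right p (Submodule.subset_span (Or.inl (one_mem _))) ?_ hx)
  intro z hz i hi1 hi2
  induction hz using Submodule.span_induction with
  | zero => simp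
  | add x y _ _ hx hy => rw [add_mul]; exact D.add_mem hx hy
  | smul c x _ hx => rw [smul_mul_assoc]; exact D.smul_mem c hx
  | mem z hz =>
    rcases Nat.lt_or_ge i b with h | h
    · have hg : brG p n i ∈ heckeInt p n a b := brG_mem p hi1 h
      rcases hz with hz | ⟨x, hx, y, hy, rfl⟩
      · exact Submodule.subset_span (Or.inl (mul_mem hz hg))
      · exact Submodule.subset_span (Or.inr ⟨x, hx, _, mul_mem hy hg, by simp only [mul_assoc]⟩)
    · obtain rfl : i = b := by omega
      rcases hz with hz | ⟨x, hx, y, hy, rfl⟩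
      · exact Submodule.subset_span (Or.inr ⟨z, hz, 1, one_mem _, by simp⟩)
      · exact key x hx y hy

/-- `H_{b+1} = H_b + H_b g_b H_b`, as an induction principle. -/
theorem heckeInt_succ_induction {a b : ℕ} (ha : 1 ≤ a) (hab : a ≤ b) (hb : b < n)
    {P : Submodule R (QBr p n)} (h1 : ∀ x ∈ heckeInt p n a b, x ∈ P)
    (h2 : ∀ x ∈ heckeInt p n a b, ∀ y ∈ heckeInt p n a b, x * brG p n b * y ∈ P) {x : QBr p n}
    (hx : x ∈ heckeInt p n a (b + 1)) : x ∈ P := by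
  induction b, hab using Nat.le_induction generalizing P x with
  | base =>
    have key : ∀ x ∈ heckeInt p n a a, ∀ y ∈ heckeInt p n a a,
        x * brG p n a * y * brG p n a ∈ Submodule.span R
          {z | z ∈ heckeInt p n a a ∨
            ∃ x ∈ heckeInt p n a a, ∃ y ∈ heckeInt p n a a, z = x * brG p n a * y} := by
      intro x hx y hy
      have hc : Commute (brG p n a) y :=
        commute_of_mem_heckeInt p (fun i h3 h4 => by omega) hy
      rw [mul_assoc, ← hc.eq, ← mul_assoc, mul_assoc x, brG_quad p n a ha hb, mul_add, add_mul,
        mul_smul_comm, smul_mul_assoc, mul_smul_comm, mul_one, smul_mul_assoc]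
      exact Submodule.add_mem _ (Submodule.smul_mem _ _ (Submodule.subset_span
        (Or.inr ⟨x, hx, y, hy, rfl⟩))) (Submodule.smul_mem _ _ (Submodule.subset_span
        (Or.inl (mul_mem hx hy))))
    exact heckeInt_succ_aux p key h1 h2 hx
  | succ b hab ih =>
    have key : ∀ x ∈ heckeInt p n a (b + 1), ∀ y ∈ heckeInt p n a (b + 1),
        x * brG p n (b + 1) * y * brG p n (b + 1) ∈ Submodule.span R
          {z | z ∈ heckeInt p n a (b + 1) ∨
            ∃ x ∈ heckeInt p n a (b + 1), ∃ y ∈ heckeInt p n a (b + 1),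
              z = x * brG p n (b + 1) * y} := by
      intro x hx y hy
      have hm : heckeInt p n a b ≤ heckeInt p n a (b + 1) := heckeInt_mono p le_rfl (by omega)
      generalize hD : Submodule.span R (_ : Set (QBr p n)) = D
      -- Expand y by the induction hypothesis. A term from H_b commutes with g_{b+1} and the
      -- quadratic relation applies; for u g_b v the two outer letters g_{b+1} meet g_b and the
      -- braid relation turns them into a single g_{b+1}.
      suffices h : y ∈ Submodule.comap ((LinearMap.mulRight R (brG p n (b + 1))).comp
        (LinearMap.mulLeft R (x * brG p n (b + 1)))) D from h
      subst hD
      refine ih (by omega) ?_ ?_ hy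
      · intro y hy
        have hc : Commute (brG p n (b + 1)) y := brG_commute_heckeInt p (Or.inl (by omega)) hy
        simp only [Submodule.mem_comap, LinearMap.comp_apply, LinearMap.mulRight_apply,
          LinearMap.mulLeft_apply]
        rw [mul_assoc, ← hc.eq, ← mul_assoc, mul_assoc x, brG_quad p n (b + 1) (by omega) hb,
          mul_add, add_mul, mul_smul_comm, smul_mul_assoc, mul_smul_comm, mul_one, smul_mul_assoc]
        exact Submodule.add_mem _ (Submodule.smul_mem _ _ (Submodule.subset_span
          (Or.inr ⟨x, hx, y, hm hy, rfl⟩))) (Submodule.smul_mem _ _ (Submodule.subset_span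
          (Or.inl (mul_mem hx (hm hy)))))
      · intro u hu v hv
        have hcu : Commute (brG p n (b + 1)) u := brG_commute_heckeInt p (Or.inl (by omega)) hu
        have hcv : Commute (brG p n (b + 1)) v := brG_commute_heckeInt p (Or.inl (by omega)) hv
        simp only [Submodule.mem_comap, LinearMap.comp_apply, LinearMap.mulRight_apply,
          LinearMap.mulLeft_apply]
        have e : x * brG p n (b + 1) * (u * brG p n b * v) * brG p n (b + 1) =
            (x * u * brG p n b) * brG p n (b + 1) * (brG p n b * v) := by
          calc _ = x * (brG p n (b + 1) * u) * brG p n b * (v * brG p n (b + 1)) := by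
                simp only [mul_assoc]
            _ = x * u * (brG p n (b + 1) * brG p n b * brG p n (b + 1)) * v := by
                rw [hcu.eq, ← hcv.eq]; simp only [mul_assoc]
            _ = _ := by rw [← brG_braid]; simp only [mul_assoc]
        rw [e]
        have hg : brG p n b ∈ heckeInt p n a (b + 1) := brG_mem p hab (by omega)
        exact Submodule.subset_span (Or.inr ⟨_, mul_mem (mul_mem hx (hm hu)) hg, _,
          mul_mem hg (hm hv), rfl⟩)
    exact heckeInt_succ_aux p key h1 h2 hx

end HeckeSub

end


noncomputable section

/-! ### The corner of an idempotent as an algebra -/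

section CornerAlgebra

variable {R B : Type*} [CommRing R] [Ring B] [Algebra R B] {f : B} (idem : IsIdempotentElem f)

instance cornerSMul : SMul R idem.Corner where
  smul c x := ⟨c • x.1, by
    obtain ⟨y, hy⟩ := x.2
    exact ⟨c • y, by
      change f * (c • y) * f = c • x.1
      rw [mul_smul_comm, smul_mul_assoc]
      exact congrArg (c • ·) hy⟩⟩

theorem corner_val_one : (1 : idem.Corner).1 = f := rfl

theorem corner_val_mul (x y : idem.Corner) : (x * y).1 = x.1 * y.1 := rfl

theorem corner_val_add (x y : idem.Corner) : (x + y).1 = x.1 + y.1 := rfl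

theorem corner_val_smul (c : R) (x : idem.Corner) : (c • x).1 = c • x.1 := rfl

theorem corner_mul_val (x : idem.Corner) : f * x.1 = x.1 :=
  ((Subsemigroup.mem_corner_iff idem).mp x.2).1

theorem corner_val_mul_self (x : idem.Corner) : x.1 * f = x.1 :=
  ((Subsemigroup.mem_corner_iff idem).mp x.2).2

/-- The corner has its own unit f. As a unital algebra it can be the target of a homomorphism out of
the presentation, which is how `cupMap` is built. -/
instance cornerAlgebra : Algebra R idem.Corner where
  algebraMap :=
    { toFun := fun c => c • (1 : idem.Corner)
      map_one' := Subtype.ext (one_smul R f)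
      map_mul' := fun a b => Subtype.ext (by
        rw [corner_val_mul, corner_val_smul, corner_val_smul, corner_val_smul, corner_val_one,
          smul_mul_smul_comm, idem.eq])
      map_zero' := Subtype.ext (zero_smul R f)
      map_add' := fun a b => Subtype.ext (add_smul a b f) }
  commutes' := fun c x => Subtype.ext (by
    change (c • f) * x.1 = x.1 * (c • f)
    rw [smul_mul_assoc, mul_smul_comm, corner_mul_val, corner_val_mul_self])
  smul_def' := fun c x => Subtype.ext (by
    change c • x.1 = (c • f) * x.1
    rw [smul_mul_assoc, corner_mul_val])

/-- The element `f x f` of the corner. -/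
def toCornerElem (x : B) : idem.Corner := ⟨f * x * f, x, rfl⟩

theorem toCornerElem_val (x : B) : (toCornerElem idem x).1 = f * x * f := rfl

theorem heckeInv_corner_val (p : BrParam R) (x : B) :
    (heckeInv p (toCornerElem idem x)).1 = f * heckeInv p x * f := by
  rw [heckeInv, heckeInv, corner_val_add, corner_val_smul, corner_val_smul, corner_val_one,
    toCornerElem_val, mul_add, add_mul, mul_smul_comm, smul_mul_assoc, mul_smul_comm,
    smul_mul_assoc, mul_one, idem.eq]

/-- The inclusion of the corner. -/
def cornerVal : idem.Corner →ₗ[R] B where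
  toFun x := x.1
  map_add' _ _ := rfl
  map_smul' _ _ := rfl

end CornerAlgebra

/-! ### The idempotent f = d⁻¹e and the twist T = g₂g₃g₁⁻¹g₂⁻¹ -/

section

variable {R : Type*} [CommRing R] (p : BrParam R) (n : ℕ)

/-- The idempotent `d⁻¹ e`. -/
def brF : QBr p n := ((p.d⁻¹ : Rˣ) : R) • brE p n

theorem brE_eq_smul_brF : brE p n = (p.d : R) • brF p n := by
  rw [brF, smul_smul, Units.mul_inv, one_smul]

theorem brF_idem : IsIdempotentElem (brF p n) := by
  rw [IsIdempotentElem, brF, smul_mul_smul_comm, brE_sq, smul_smul, mul_assoc, Units.inv_mul,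
    mul_one]

theorem brF_far {i : ℕ} (h : 3 ≤ i) : Commute (brF p n) (brG p n i) :=
  (brE_far p n h).smul_left _

theorem brF_brI_far {i : ℕ} (h : 3 ≤ i) : Commute (brF p n) (brI p n i) :=
  (brE_brI_far p n h).smul_left _

theorem brF_mul_brG_one : brF p n * brG p n 1 = (p.q : R) • brF p n := by
  rw [brF, smul_mul_assoc, brE_mul_brG_one, smul_comm]

theorem brG_one_mul_brF : brG p n 1 * brF p n = (p.q : R) • brF p n := by
  rw [brF, mul_smul_comm, brG_one_mul_brE, smul_comm]

variable {n}

theorem brF_brG_two_brF (h : 3 ≤ n) :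
    brF p n * brG p n 2 * brF p n = ((p.r * p.d⁻¹ : Rˣ) : R) • brF p n := by
  rw [brF, smul_mul_assoc, smul_mul_smul_comm, (brRelations p n).e_g2_e h, smul_smul, smul_smul]
  push_cast; ring_nf

theorem brF_brI_two_brF (h : 3 ≤ n) :
    brF p n * brI p n 2 * brF p n = ((p.q⁻¹ * p.d⁻¹ : Rˣ) : R) • brF p n := by
  rw [brF, smul_mul_assoc, smul_mul_smul_comm, brI, (brRelations p n).e_g2inv_e h, smul_smul,
    smul_smul]
  push_cast; ring_nf

variable (n)

/-- The word `g₂ g₃ g₁⁻¹ g₂⁻¹`, shifted by `a`. -/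
def brT (a : ℕ) : QBr p n :=
  brG p n (a + 2) * brG p n (a + 3) * brI p n (a + 1) * brI p n (a + 2)

theorem twistWord_brG : twistWord p (brG p n) = brT p n 0 := rfl

/-- The inverse of the word `g₂ g₃ g₁⁻¹ g₂⁻¹`, shifted by `a`. -/
def brTinv (a : ℕ) : QBr p n :=
  brG p n (a + 2) * brG p n (a + 1) * brI p n (a + 3) * brI p n (a + 2)

variable {n}

theorem brT_mul_brTinv {a : ℕ} (h : a + 4 ≤ n) : brT p n a * brTinv p n a = 1 := by
  rw [brT, brTinv]
  calc _ = brG p n (a + 2) * brG p n (a + 3) * brI p n (a + 1) *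
        (brI p n (a + 2) * brG p n (a + 2)) * brG p n (a + 1) * brI p n (a + 3) *
          brI p n (a + 2) := by simp only [mul_assoc]
    _ = brG p n (a + 2) * brG p n (a + 3) * (brI p n (a + 1) * brG p n (a + 1)) * brI p n (a + 3) *
          brI p n (a + 2) := by
        rw [brI_mul_brG p (by omega) (by omega)]; simp only [mul_assoc, mul_one]
    _ = brG p n (a + 2) * (brG p n (a + 3) * brI p n (a + 3)) * brI p n (a + 2) := by
        rw [brI_mul_brG p (by omega) (by omega)]; simp only [mul_assoc, mul_one]
    _ = 1 := by
        rw [brG_mul_brI p (by omega) (by omega), mul_one, brG_mul_brI p (by omega) (by omega)]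

theorem brTinv_mul_brT {a : ℕ} (h : a + 4 ≤ n) : brTinv p n a * brT p n a = 1 := by
  rw [brT, brTinv]
  calc _ = brG p n (a + 2) * brG p n (a + 1) * brI p n (a + 3) *
        (brI p n (a + 2) * brG p n (a + 2)) * brG p n (a + 3) * brI p n (a + 1) *
          brI p n (a + 2) := by simp only [mul_assoc]
    _ = brG p n (a + 2) * brG p n (a + 1) * (brI p n (a + 3) * brG p n (a + 3)) * brI p n (a + 1) *
          brI p n (a + 2) := by
        rw [brI_mul_brG p (by omega) (by omega)]; simp only [mul_assoc, mul_one]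
    _ = brG p n (a + 2) * (brG p n (a + 1) * brI p n (a + 1)) * brI p n (a + 2) := by
        rw [brI_mul_brG p (by omega) (by omega)]; simp only [mul_assoc, mul_one]
    _ = 1 := by
        rw [brG_mul_brI p (by omega) (by omega), mul_one, brG_mul_brI p (by omega) (by omega)]

/-- The inverse half of the twist raises the index by one and the positive half raises it once more.
-/
theorem brT_mul_brG {a : ℕ} (h : a + 4 ≤ n) :
    brT p n a * brG p n (a + 1) = brG p n (a + 3) * brT p n a := by
  have h1 := brI_brI_brG p (n := n) (i := a + 1) (by omega) (by omega)
  have h2 := brG_braid p n (a + 2)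
  rw [brT]
  calc _ = brG p n (a + 2) * brG p n (a + 3) *
        (brI p n (a + 1) * brI p n (a + 1 + 1) * brG p n (a + 1)) := by simp only [mul_assoc]
    _ = (brG p n (a + 2) * brG p n (a + 2 + 1) * brG p n (a + 2)) * brI p n (a + 1) *
          brI p n (a + 2) := by rw [h1]; simp only [mul_assoc]
    _ = _ := by rw [h2]; simp only [mul_assoc]

theorem brTinv_mul_brG {a : ℕ} (h : a + 4 ≤ n) :
    brTinv p n a * brG p n (a + 3) = brG p n (a + 1) * brTinv p n a := by
  have h1 := brT_mul_brG p h
  calc _ = brTinv p n a * (brG p n (a + 3) * brT p n a) * brTinv p n a := by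
        rw [mul_assoc, mul_assoc, brT_mul_brTinv p h, mul_one]
    _ = _ := by rw [← h1, ← mul_assoc, brTinv_mul_brT p h, one_mul]

/-- A word in the generators commutes with `y` as soon as its letters do. -/
theorem commute_brT {a : ℕ} {y : QBr p n} (h1 : Commute y (brG p n (a + 1)))
    (h2 : Commute y (brG p n (a + 2))) (h3 : Commute y (brG p n (a + 3))) :
    Commute y (brT p n a) :=
  ((h2.mul_right h3).mul_right (h1.heckeInv_right p)).mul_right (h2.heckeInv_right p)

/-- The four-strand relations between `d⁻¹ e` and the twist. -/
theorem brT_brF (h : 4 ≤ n) :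
    brT p n 0 * (brF p n * brT p n 0 * brF p n) = brF p n * brT p n 0 * brF p n := by
  have := (brRelations p n).twist_left h
  rw [twistWord_brG] at this
  simp only [brF, smul_mul_assoc, mul_smul_comm, this]

theorem brF_brT (h : 4 ≤ n) :
    brF p n * brT p n 0 * brF p n * brT p n 0 = brF p n * brT p n 0 * brF p n := by
  have := (brRelations p n).twist_right h
  rw [twistWord_brG] at this
  simp only [brF, smul_mul_assoc, mul_smul_comm, this]

theorem brF_brTinv (h : 4 ≤ n) :
    brF p n * brT p n 0 * brF p n * brTinv p n 0 = brF p n * brT p n 0 * brF p n := by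
  conv_lhs => rw [← brF_brT p h, mul_assoc, brT_mul_brTinv p (by omega), mul_one]

/-- `t t'` with `t = g₂ g₃ g₁⁻¹ g₂⁻¹` and `t' = g₄ g₅ g₃⁻¹ g₄⁻¹` shifts the indices by two. -/
theorem brT_brT_eq (n : ℕ) : brT p n 0 * brT p n 2 =
    upProd (brG p n) 2 4 * upProd (brI p n) 1 4 := by
  have h1 : Commute (brI p n 2) (brG p n 4) := brI_brG_far p n (by omega)
  have h2 : Commute (brI p n 2) (brG p n 5) := brI_brG_far p n (by omega)
  have h3 : Commute (brI p n 1) (brG p n 4) := brI_brG_far p n (by omega)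
  have h4 : Commute (brI p n 1) (brG p n 5) := brI_brG_far p n (by omega)
  have h5 : Commute (brI p n 1 * brI p n 2) (brG p n 4 * brG p n 5) :=
    (h3.mul_right h4).mul_left (h1.mul_right h2)
  calc _ = brG p n 2 * brG p n 3 * ((brI p n 1 * brI p n 2) * (brG p n 4 * brG p n 5)) *
        (brI p n 3 * brI p n 4) := by simp only [brT, mul_assoc]
    _ = _ := by
        rw [h5.eq]
        simp only [upProd, mul_assoc, one_mul]

theorem brT_brT_mul_brG (h : 6 ≤ n) {i : ℕ} (h1 : 1 ≤ i) (h2 : i ≤ 3) :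
    brT p n 0 * brT p n 2 * brG p n i = brG p n (i + 2) * (brT p n 0 * brT p n 2) := by
  rw [brT_brT_eq, mul_assoc, upProd_brI_mul p le_rfl (by omega) h1 (by omega), ← mul_assoc,
    upProd_brG_mul p (by omega) (by omega), mul_assoc]

theorem brT_brT_mul_brI (h : 6 ≤ n) {i : ℕ} (h1 : 1 ≤ i) (h2 : i ≤ 3) :
    brT p n 0 * brT p n 2 * brI p n i = brI p n (i + 2) * (brT p n 0 * brT p n 2) := by
  simp only [brI_eq, mul_add, add_mul, mul_smul_comm, smul_mul_assoc, mul_one, one_mul,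
    brT_brT_mul_brG p h h1 h2]

/-- Moving the product of the two twists past a letter of index at most 3 raises that index by two,
so moving it past the first twist letter by letter produces the second one. -/
theorem brT_braid (h : 6 ≤ n) :
    brT p n 0 * brT p n 2 * brT p n 0 = brT p n 2 * brT p n 0 * brT p n 2 := by
  have e : brT p n 0 = brG p n 2 * brG p n 3 * brI p n 1 * brI p n 2 := rfl
  have e' : brT p n 2 = brG p n 4 * brG p n 5 * brI p n 3 * brI p n 4 := rfl
  have a1 := brT_brT_mul_brG p h (i := 2) (by omega) (by omega)
  have a2 := brT_brT_mul_brG p h (i := 3) (by omega) (by omega)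
  have a3 := brT_brT_mul_brI p h (i := 1) (by omega) (by omega)
  have a4 := brT_brT_mul_brI p h (i := 2) (by omega) (by omega)
  rw [mul_assoc (brT p n 2)]
  generalize brT p n 0 * brT p n 2 = x at *
  rw [e, e', ← mul_assoc, ← mul_assoc, ← mul_assoc, a1, mul_assoc (brG p n 4), a2,
    mul_assoc _ _ (brI p n 1), mul_assoc _ x, a3, mul_assoc _ _ (brI p n 2), mul_assoc _ _ (brI p n 2),
    mul_assoc _ x, a4]
  simp only [mul_assoc]

theorem brI_brG_brG {i : ℕ} (h1 : 1 ≤ i) (h2 : i + 1 < n) :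
    brI p n i * brG p n (i + 1) * brG p n i = brG p n (i + 1) * brG p n i * brI p n (i + 1) := by
  have a2 := brI_mul_brG p h1 (show i < n by omega)
  have b1 := brG_mul_brI p (show 1 ≤ i + 1 by omega) h2
  calc _ = brI p n i * (brG p n (i + 1) * brG p n i * brG p n (i + 1)) * brI p n (i + 1) := by
        simp only [mul_assoc, b1, mul_one]
    _ = (brI p n i * brG p n i) * brG p n (i + 1) * brG p n i * brI p n (i + 1) := by
        rw [← brG_braid]; simp only [mul_assoc]
    _ = _ := by rw [a2, one_mul]

theorem brG_brG_brI {i : ℕ} (h1 : 1 ≤ i) (h2 : i + 1 < n) :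
    brG p n i * brG p n (i + 1) * brI p n i = brI p n (i + 1) * brG p n i * brG p n (i + 1) := by
  have a2 := brG_mul_brI p h1 (show i < n by omega)
  have b1 := brI_mul_brG p (show 1 ≤ i + 1 by omega) h2
  calc _ = brI p n (i + 1) * (brG p n (i + 1) * brG p n i * brG p n (i + 1)) * brI p n i := by
        simp only [← mul_assoc, b1, one_mul]
    _ = brI p n (i + 1) * brG p n i * brG p n (i + 1) * (brG p n i * brI p n i) := by
        rw [← brG_braid]; simp only [mul_assoc]
    _ = _ := by rw [a2, mul_one]

/-- The right side is g₂ conjugated by g₄g₃⁻¹, an element that commutes with e. This reduces the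
relation e g₂ e = r e one level up to the original one. -/
theorem brTinv_brG_four (h : 5 ≤ n) : brTinv p n 0 * brG p n 4 * brT p n 0 =
    brG p n 4 * brI p n 3 * brG p n 2 * (brG p n 3 * brI p n 4) := by
  have c24 : Commute (brI p n 2) (brG p n 4) := brI_brG_far p n (by omega)
  have c14 : Commute (brG p n 1) (brG p n 4) := brG_far p n (by omega)
  have c24' : Commute (brG p n 2) (brG p n 4) := brG_far p n (by omega)
  have c13 : Commute (brG p n 1) (brG p n 3) := brG_far p n (by omega)
  have c14' : Commute (brG p n 1) (brI p n 4) := brG_brI_far p n (by omega)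
  have c2I4 : Commute (brI p n 2) (brI p n 4) := brI_far p n (by omega)
  have i2 := brI_mul_brG p (n := n) (i := 2) (by omega) (by omega)
  have i1 := brG_mul_brI p (n := n) (i := 1) (by omega) (by omega)
  calc _ = brG p n 2 * brG p n 1 * brI p n 3 * (brI p n 2 * brG p n 4) *
        brG p n 2 * brG p n 3 * brI p n 1 * brI p n 2 := by simp only [brT, brTinv, mul_assoc]
    _ = brG p n 2 * brG p n 1 * brI p n 3 * brG p n 4 * (brI p n 2 * brG p n 2) *
          brG p n 3 * brI p n 1 * brI p n 2 := by rw [c24.eq]; simp only [mul_assoc]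
    _ = brG p n 2 * brG p n 1 * (brI p n 3 * brG p n 4 * brG p n 3) * brI p n 1 * brI p n 2 := by
        rw [i2, mul_one]; simp only [mul_assoc]
    _ = brG p n 2 * (brG p n 1 * (brG p n 4 * brG p n 3 * brI p n 4)) * brI p n 1 * brI p n 2 := by
        rw [brI_brG_brG p (by omega) (by omega)]; simp only [mul_assoc]
    _ = brG p n 2 * brG p n 4 * brG p n 3 * brI p n 4 * (brG p n 1 * brI p n 1) * brI p n 2 := by
        rw [((c14.mul_right c13).mul_right c14').eq]; simp only [mul_assoc]
    _ = (brG p n 2 * brG p n 4) * brG p n 3 * (brI p n 4 * brI p n 2) := by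
        rw [i1, mul_one]; simp only [mul_assoc]
    _ = brG p n 4 * (brG p n 2 * brG p n 3 * brI p n 2) * brI p n 4 := by
        rw [c24'.eq, ← c2I4.eq]; simp only [mul_assoc]
    _ = _ := by
        rw [brG_brG_brI p (by omega) (by omega)]; simp only [mul_assoc]

theorem brTinv_brI_four (h : 5 ≤ n) : brTinv p n 0 * brI p n 4 * brT p n 0 =
    brG p n 4 * brI p n 3 * brI p n 2 * (brG p n 3 * brI p n 4) := by
  have h1 : brTinv p n 0 * brT p n 0 = brG p n 4 * brI p n 3 * (brG p n 3 * brI p n 4) := by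
    rw [brTinv_mul_brT p (by omega), mul_assoc, ← mul_assoc (brI p n 3),
      brI_mul_brG p (by omega) (by omega), one_mul, brG_mul_brI p (by omega) (by omega)]
  rw [brI_eq p n 4, brI_eq p n 2]
  simp only [mul_add, add_mul, mul_smul_comm, smul_mul_assoc, mul_one]
  rw [brTinv_brG_four p h, h1, brI_eq p n 4]
  simp only [mul_add, mul_smul_comm, mul_one]
  module

/-! ### Inserting a cup: the smaller algebra inside the corner of f -/

section CupMap

variable {m : ℕ}

theorem cornerG_val (i : ℕ) (h : 1 ≤ i) :
    (toCornerElem (brF_idem p n) (brG p n (i + 2))).1 = brF p n * brG p n (i + 2) := by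
  rw [toCornerElem_val, mul_assoc, ← (brF_far p n (show 3 ≤ i + 2 by omega)).eq, ← mul_assoc,
    (brF_idem p n).eq]

theorem cornerI_val (i : ℕ) (h : 1 ≤ i) :
    (heckeInv p (toCornerElem (brF_idem p n) (brG p n (i + 2)))).1 =
      brF p n * brI p n (i + 2) := by
  rw [heckeInv_corner_val]
  change brF p n * brI p n (i + 2) * brF p n = _
  rw [mul_assoc, ← (brF_brI_far p n (show 3 ≤ i + 2 by omega)).eq, ← mul_assoc,
    (brF_idem p n).eq]

theorem commute_idem_mul {B : Type*} [Semigroup B] {f x : B} (hf : IsIdempotentElem f)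
    (hx : Commute f x) (y : B) : f * x * (f * y) = f * (x * y) := by
  rw [mul_assoc, ← mul_assoc x, ← hx.eq, mul_assoc, ← mul_assoc, hf.eq]

theorem cornerT_val :
    (twistWord p (fun i => toCornerElem (brF_idem p n) (brG p n (i + 2)))).1 =
      brF p n * brT p n 2 := by
  have c4 := brF_far p n (i := 4) (by omega)
  have c5 := brF_far p n (i := 5) (by omega)
  have c3 := brF_brI_far p n (i := 3) (by omega)
  have hf := brF_idem p n
  rw [twistWord, corner_val_mul, corner_val_mul, corner_val_mul, cornerG_val p 2 (by omega),
    cornerG_val p 3 (by omega), cornerI_val p 1 (by omega), cornerI_val p 2 (by omega),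
    commute_idem_mul hf c4, commute_idem_mul hf (c4.mul_right c5),
    commute_idem_mul hf ((c4.mul_right c5).mul_right c3), brT]

variable (n) in
/-- The idempotent `d⁻² e_(2)`. -/
def brX : QBr p n := brF p n * brT p n 0 * brF p n

theorem brX_mul_brF : brX p n * brF p n = brX p n := by
  rw [brX, mul_assoc, (brF_idem p n).eq]

theorem brF_mul_brX : brF p n * brX p n = brX p n := by
  rw [brX, ← mul_assoc, ← mul_assoc, (brF_idem p n).eq]

theorem brX_idem (h : 4 ≤ n) : brX p n * brX p n = brX p n := by
  conv_lhs => enter [2]; rw [brX]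
  rw [← mul_assoc, ← mul_assoc, brX_mul_brF, brX, brF_brT p h, ← brX, brX_mul_brF]

/-- X absorbs f on both sides and f commutes with g₃ and g₄, so f can be carried through the
conjugating letters to sit next to y. Once f y f has become a multiple of f, the conjugating letters
cancel. -/
theorem brX_conj (h : 5 ≤ n) {y : QBr p n} {c : R} (hy : brF p n * y * brF p n = c • brF p n) :
    brX p n * (brG p n 4 * brI p n 3 * y * (brG p n 3 * brI p n 4)) * brX p n = c • brX p n := by
  have c1 : Commute (brF p n) (brG p n 4 * brI p n 3) :=
    (brF_far p n (by omega)).mul_right (brF_brI_far p n (by omega))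
  have c2 : Commute (brF p n) (brG p n 3 * brI p n 4) :=
    (brF_far p n (by omega)).mul_right (brF_brI_far p n (by omega))
  have e1 : brG p n 4 * brI p n 3 * (brG p n 3 * brI p n 4) = 1 := by
    rw [mul_assoc, ← mul_assoc (brI p n 3), brI_mul_brG p (by omega) (by omega), one_mul,
      brG_mul_brI p (by omega) (by omega)]
  calc _ = brX p n * brF p n * (brG p n 4 * brI p n 3) * y * ((brG p n 3 * brI p n 4) *
        (brF p n * brX p n)) := by rw [brX_mul_brF, brF_mul_brX]; simp only [mul_assoc]
    _ = brX p n * (brF p n * (brG p n 4 * brI p n 3)) * y *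
        (((brG p n 3 * brI p n 4) * brF p n) * brX p n) := by simp only [mul_assoc]
    _ = brX p n * (brG p n 4 * brI p n 3) * (brF p n * y * brF p n) *
        ((brG p n 3 * brI p n 4) * brX p n) := by
        rw [c1.eq, ← c2.eq]; simp only [mul_assoc]
    _ = c • (brX p n * (brG p n 4 * brI p n 3) * ((brF p n * (brG p n 3 * brI p n 4)) *
        brX p n)) := by
        rw [hy, mul_smul_comm, smul_mul_assoc]; simp only [mul_assoc]
    _ = c • (brX p n * ((brG p n 4 * brI p n 3) * (brG p n 3 * brI p n 4)) *
        (brF p n * brX p n)) := by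
        rw [c2.eq]; simp only [mul_assoc]
    _ = _ := by rw [e1, mul_one, brF_mul_brX, brX_idem p (by omega)]

theorem brX_mul_brTinv (h : 4 ≤ n) : brX p n * brTinv p n 0 = brX p n := brF_brTinv p h

theorem brT_mul_brX (h : 4 ≤ n) : brT p n 0 * brX p n = brX p n := brT_brF p h

theorem brX_mul_brT (h : 4 ≤ n) : brX p n * brT p n 0 = brX p n := brF_brT p h

/-- X absorbs T⁻¹ on its right and T on its left, so g₄ between two copies of X may be replaced by
T⁻¹g₄T, which `brX_conj` evaluates. -/
theorem brX_brG_four_brX (h : 5 ≤ n) :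
    brX p n * brG p n 4 * brX p n = ((p.r * p.d⁻¹ : Rˣ) : R) • brX p n := by
  rw [← brX_conj p h (brF_brG_two_brF p (by omega)), ← brTinv_brG_four p h]
  simp only [mul_assoc]
  rw [brT_mul_brX p (by omega), ← mul_assoc (brX p n) (brTinv p n 0), brX_mul_brTinv p (by omega)]

theorem brX_brI_four_brX (h : 5 ≤ n) :
    brX p n * brI p n 4 * brX p n = ((p.q⁻¹ * p.d⁻¹ : Rˣ) : R) • brX p n := by
  rw [← brX_conj p h (brF_brI_two_brF p (by omega)), ← brTinv_brI_four p h]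
  simp only [mul_assoc]
  rw [brT_mul_brX p (by omega), ← mul_assoc (brX p n) (brTinv p n 0), brX_mul_brTinv p (by omega)]

theorem brF_commute_brT_two : Commute (brF p n) (brT p n 2) := commute_brT p
  (brF_far p n (by omega)) (brF_far p n (by omega)) (brF_far p n (by omega))

theorem brX_brT_two_brX :
    brX p n * brT p n 2 * brX p n = brF p n * brT p n 0 * brT p n 2 * brX p n := by
  have c := brF_commute_brT_two p (n := n)
  conv_lhs => enter [1, 1]; rw [brX]
  rw [mul_assoc _ (brF p n) (brT p n 2), c.eq, ← mul_assoc, mul_assoc _ (brF p n) (brX p n),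
    brF_mul_brX]

theorem brX_brT_two_brX' :
    brX p n * brT p n 2 * brX p n = brX p n * brT p n 2 * brT p n 0 * brF p n := by
  have c := brF_commute_brT_two p (n := n)
  conv_lhs => enter [2]; rw [brX]
  rw [← mul_assoc, ← mul_assoc, mul_assoc (brX p n) (brT p n 2) (brF p n), ← c.eq, ← mul_assoc,
    brX_mul_brF]

/-- The shifted twist commutes with f, the braid relation for twists brings the unshifted one next
to X, and X absorbs it. -/
theorem brT_two_mul (h : 6 ≤ n) :
    brT p n 2 * (brX p n * brT p n 2 * brX p n) = brX p n * brT p n 2 * brX p n := by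
  have c := brF_commute_brT_two p (n := n)
  rw [brX_brT_two_brX p]
  calc _ = (brT p n 2 * brF p n) * brT p n 0 * brT p n 2 * brX p n := by simp only [mul_assoc]
    _ = brF p n * (brT p n 2 * brT p n 0 * brT p n 2) * brX p n := by
        rw [← c.eq]; simp only [mul_assoc]
    _ = brF p n * brT p n 0 * brT p n 2 * (brT p n 0 * brX p n) := by
        rw [← brT_braid p h]; simp only [mul_assoc]
    _ = _ := by rw [brT_mul_brX p (by omega)]

theorem mul_brT_two (h : 6 ≤ n) :
    brX p n * brT p n 2 * brX p n * brT p n 2 = brX p n * brT p n 2 * brX p n := by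
  have c := brF_commute_brT_two p (n := n)
  rw [brX_brT_two_brX' p]
  calc _ = brX p n * brT p n 2 * brT p n 0 * (brF p n * brT p n 2) := by simp only [mul_assoc]
    _ = brX p n * (brT p n 2 * brT p n 0 * brT p n 2) * brF p n := by
        rw [c.eq]; simp only [mul_assoc]
    _ = (brX p n * brT p n 0) * brT p n 2 * brT p n 0 * brF p n := by
        rw [← brT_braid p h]; simp only [mul_assoc]
    _ = _ := by rw [brX_mul_brT p (by omega)]

/-- The generators of the smaller algebra in the corner of `d⁻¹ e`. -/
theorem corner_brRelations (h : m + 2 ≤ n) : BrRelations p m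
    (fun i => toCornerElem (brF_idem p n) (brG p n (i + 2)))
    ((p.d : R) • toCornerElem (brF_idem p n) (brT p n 0)) := by
  have hf := brF_idem p n
  have gg : ∀ i, 1 ≤ i → ∀ y, brF p n * brG p n (i + 2) * (brF p n * y) =
      brF p n * (brG p n (i + 2) * y) := fun i hi y =>
    commute_idem_mul hf (brF_far p n (by omega)) y
  have xv : (toCornerElem (brF_idem p n) (brT p n 0)).1 = brX p n := rfl
  constructor
  · intro i h1 h2
    refine Subtype.ext ?_
    rw [corner_val_mul, corner_val_add, corner_val_smul, corner_val_smul, corner_val_one,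
      cornerG_val p i h1, gg i h1, brG_quad p n (i + 2) (by omega) (by omega), mul_add,
      mul_smul_comm, mul_smul_comm, mul_one]
  · intro i h1 h2
    refine Subtype.ext ?_
    have c1 := brF_far p n (i := i + 2) (by omega)
    have c2 := brF_far p n (i := i + 1 + 2) (by omega)
    simp only [corner_val_mul]
    rw [cornerG_val p i h1, cornerG_val p (i + 1) (by omega), commute_idem_mul hf c1,
      commute_idem_mul hf (c1.mul_right c2), commute_idem_mul hf c2,
      commute_idem_mul hf (c2.mul_right c1)]
    congr 1
    exact brG_braid p n (i + 2)
  · intro i j h1 h2 h3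
    refine Subtype.ext ?_
    have c1 := brF_far p n (i := i + 2) (by omega)
    have c2 := brF_far p n (i := j + 2) (by omega)
    simp only [corner_val_mul]
    rw [cornerG_val p i h1, cornerG_val p j (by omega), commute_idem_mul hf c1,
      commute_idem_mul hf c2, (brG_far p n (show i + 2 + 2 ≤ j + 2 by omega)).eq]
  · intro h2
    refine Subtype.ext ?_
    simp only [corner_val_mul, corner_val_smul, smul_mul_smul_comm]
    rw [xv, brX_idem p (by omega), mul_smul]
  · intro i h1 h2
    refine Subtype.ext ?_
    have c : Commute (brG p n (i + 2)) (brT p n 0) := commute_brT p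
      (brG_far p n (by omega)).symm (brG_far p n (by omega)).symm (brG_far p n (by omega)).symm
    have c1 := brF_far p n (i := i + 2) (by omega)
    have c2 : Commute (brG p n (i + 2)) (brX p n) := (c1.symm.mul_right c).mul_right c1.symm
    simp only [corner_val_mul, corner_val_smul, smul_mul_assoc, mul_smul_comm]
    rw [cornerG_val p i (by omega), xv, ← mul_assoc, brX_mul_brF, ← c2.eq, c1.eq, mul_assoc,
      brF_mul_brX]
  · intro h2
    refine Subtype.ext ?_
    simp only [corner_val_mul, corner_val_smul, smul_mul_assoc]
    -- X = X T⁻¹, and T⁻¹ converts g₃ into g₁, which f absorbs with the factor q.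
    have e : brX p n * brG p n (0 + 3) = (p.q : R) • brX p n := by
      conv_lhs => rw [← brX_mul_brTinv p (show 4 ≤ n by omega), mul_assoc,
        brTinv_mul_brG p (show 0 + 4 ≤ n by omega), ← brX_mul_brF]
      rw [← mul_assoc, mul_assoc _ (brF p n), brF_mul_brG_one, mul_smul_comm, smul_mul_assoc,
        brX_mul_brF, brX_mul_brTinv p (by omega)]
    rw [cornerG_val p 1 le_rfl, xv, ← mul_assoc, brX_mul_brF]
    rw [show brG p n (1 + 2) = brG p n (0 + 3) from rfl, e, smul_comm]
  · intro h2
    refine Subtype.ext ?_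
    simp only [corner_val_mul, corner_val_smul, mul_smul_comm]
    have e := brT_mul_brG p (n := n) (a := 0) (by omega)
    have e2 : brF p n * brG p n (1 + 2) * brX p n = (p.q : R) • brX p n := by
      rw [(brF_far p n (show 3 ≤ 1 + 2 by omega)).eq, mul_assoc, brF_mul_brX, brX,
        mul_assoc (brF p n), ← mul_assoc (brG p n (1 + 2)),
        ← (brF_far p n (show 3 ≤ 1 + 2 by omega)).eq, mul_assoc (brF p n),
        ← mul_assoc (brG p n (1 + 2))]
      rw [show brG p n (1 + 2) * brT p n 0 = brT p n 0 * brG p n 1 from e.symm,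
        mul_assoc (brT p n 0), brG_one_mul_brF, mul_smul_comm, mul_smul_comm]
    rw [cornerG_val p 1 le_rfl, xv, e2, smul_comm]
  · intro h2
    refine Subtype.ext ?_
    simp only [corner_val_mul, corner_val_smul, smul_mul_assoc, mul_smul_comm, smul_smul]
    rw [cornerG_val p 2 (by omega), xv, ← mul_assoc, brX_mul_brF, brX_brG_four_brX p (by omega),
      smul_smul]
    congr 1
    rw [Units.val_mul, mul_assoc (p.d : R), mul_left_comm (p.d : R) (p.r : R), Units.mul_inv]
    ring
  · intro h2
    refine Subtype.ext ?_
    simp only [corner_val_mul, corner_val_smul, smul_mul_assoc, mul_smul_comm, smul_smul]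
    rw [cornerI_val p 2 (by omega), xv, ← mul_assoc, brX_mul_brF, brX_brI_four_brX p (by omega),
      smul_smul]
    congr 1
    rw [Units.val_mul, mul_assoc (p.d : R), mul_left_comm (p.d : R) ((p.q⁻¹ : Rˣ) : R), Units.mul_inv]
    ring
  · intro h2
    refine Subtype.ext ?_
    simp only [corner_val_mul, corner_val_smul, smul_mul_assoc, mul_smul_comm, smul_smul]
    rw [cornerT_val, xv, ← mul_assoc (brX p n), brX_mul_brF,
      mul_assoc (brF p n), brT_two_mul p (by omega), ← mul_assoc, ← mul_assoc, brF_mul_brX]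
  · intro h2
    refine Subtype.ext ?_
    simp only [corner_val_mul, corner_val_smul, smul_mul_assoc, mul_smul_comm, smul_smul]
    rw [cornerT_val, xv, ← mul_assoc (brX p n), brX_mul_brF, ← mul_assoc, mul_assoc _ _ (brF p n),
      brX_mul_brF, mul_brT_two p (by omega)]

/-- The homomorphism from the algebra on `m` strands to the corner of `d⁻¹ e` in the algebra on
`n ≥ m + 2` strands. -/
def cornerHom (h : m + 2 ≤ n) : QBr p m →ₐ[R] (brF_idem p n).Corner := (corner_brRelations p h).lift

/-- The multiplicative map from the algebra on `m` strands to the algebra on `n ≥ m + 2` strands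
which inserts `d⁻¹ e` to the left of the strands. -/
def cupMap (h : m + 2 ≤ n) : QBr p m →ₗ[R] QBr p n :=
  (cornerVal (brF_idem p n)).comp (cornerHom p h).toLinearMap

theorem cupMap_one (h : m + 2 ≤ n) : cupMap p h 1 = brF p n :=
  congrArg Subtype.val (map_one (cornerHom p h))

theorem cupMap_mul (h : m + 2 ≤ n) (x y : QBr p m) :
    cupMap p h (x * y) = cupMap p h x * cupMap p h y :=
  congrArg Subtype.val (map_mul (cornerHom p h) x y)

theorem brF_mul_cupMap (h : m + 2 ≤ n) (x : QBr p m) : brF p n * cupMap p h x = cupMap p h x :=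
  corner_mul_val _ _

theorem cupMap_mul_brF (h : m + 2 ≤ n) (x : QBr p m) : cupMap p h x * brF p n = cupMap p h x :=
  corner_val_mul_self _ _

theorem cupMap_brG (h : m + 2 ≤ n) {i : ℕ} (h1 : 1 ≤ i) (h2 : i < m) :
    cupMap p h (brG p m i) = brF p n * brG p n (i + 2) := by
  rw [← cornerG_val p i h1]
  exact congrArg Subtype.val ((corner_brRelations p h).lift_brG h1 h2)

theorem cupMap_brE (h : m + 2 ≤ n) (h2 : 2 ≤ m) :
    cupMap p h (brE p m) = (p.d : R) • brX p n :=
  congrArg Subtype.val ((corner_brRelations p h).lift_brE h2)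

theorem cupMap_brF (h : m + 2 ≤ n) (h2 : 2 ≤ m) : cupMap p h (brF p m) = brX p n := by
  rw [brF, map_smul, cupMap_brE p h h2, smul_smul, Units.inv_mul, one_smul]

theorem cupMap_brI (h : m + 2 ≤ n) {i : ℕ} (h1 : 1 ≤ i) (h2 : i < m) :
    cupMap p h (brI p m i) = brF p n * brI p n (i + 2) := by
  rw [brI_eq, brI_eq, map_add, map_smul, map_smul, cupMap_brG p h h1 h2, cupMap_one, mul_add,
    mul_smul_comm, mul_smul_comm, mul_one]

end CupMap

end

end


noncomputable section

/-! ### The anti-automorphism reversing words -/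

section Reversal

variable {R : Type*} [CommRing R] (p : BrParam R) {n : ℕ}

theorem brX_mul_brG_one : brX p n * brG p n 1 = (p.q : R) • brX p n := by
  conv_lhs => rw [brX, mul_assoc, brF_mul_brG_one, mul_smul_comm, ← brX]

theorem brG_one_mul_brX : brG p n 1 * brX p n = (p.q : R) • brX p n := by
  conv_lhs => rw [brX, mul_assoc, ← mul_assoc, brG_one_mul_brF, smul_mul_assoc, ← mul_assoc, ← brX]

theorem brX_mul_brG_three (h : 4 ≤ n) : brX p n * brG p n 3 = (p.q : R) • brX p n := by
  have e := brTinv_mul_brG p (n := n) (a := 0) (by omega)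
  simp only [zero_add] at e
  conv_lhs => rw [← brX_mul_brTinv p h, mul_assoc, e, ← mul_assoc, brX_mul_brG_one p,
    smul_mul_assoc, brX_mul_brTinv p h]

theorem brG_three_mul_brX (h : 4 ≤ n) : brG p n 3 * brX p n = (p.q : R) • brX p n := by
  have e := brT_mul_brG p (n := n) (a := 0) (by omega)
  simp only [zero_add] at e
  conv_lhs => rw [← brT_mul_brX p h, ← mul_assoc, ← e, mul_assoc, brG_one_mul_brX p,
    mul_smul_comm, brT_mul_brX p h]

/-- T equals g₂g₃(g₂g₁)⁻¹, so this exchange is another form of the absorption of T by X. -/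
theorem brX_mul_brG_brG (h : 4 ≤ n) :
    brX p n * brG p n 2 * brG p n 3 = brX p n * brG p n 2 * brG p n 1 := by
  have e : brT p n 0 * (brG p n 2 * brG p n 1) = brG p n 2 * brG p n 3 := by
    rw [brT]
    simp only [zero_add, mul_assoc]
    rw [← mul_assoc (brI p n 2), brI_mul_brG p (by omega) (by omega), one_mul,
      brI_mul_brG p (by omega) (by omega), mul_one]
  rw [mul_assoc, mul_assoc, ← e, ← mul_assoc, brX_mul_brT p h]

/-- The mirror image cannot be obtained by reversal, which is not yet available. Absorption of T on
the left gives the exchange with all letters inverted; since g and g⁻¹ are affine functions of each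
other, and g₁, g₃ act on X by the same scalar, the letters can be made positive one at a time. -/
theorem brG_brG_mul_brX (h : 4 ≤ n) :
    brG p n 3 * (brG p n 2 * brX p n) = brG p n 1 * (brG p n 2 * brX p n) := by
  have e : brG p n 1 * brI p n 3 * brI p n 2 * brT p n 0 = brI p n 2 := by
    have e1 : brG p n 1 * brI p n 3 * brI p n 2 = brI p n 2 * brTinv p n 0 := by
      rw [brTinv]
      simp only [zero_add, ← mul_assoc]
      rw [brI_mul_brG p (by omega) (by omega), one_mul]
    rw [e1, mul_assoc, brTinv_mul_brT p (by omega), mul_one]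
  have e2 : brI p n 1 * (brI p n 2 * brX p n) = brI p n 3 * (brI p n 2 * brX p n) := by
    conv_lhs => rw [← e, mul_assoc, brT_mul_brX p h]
    simp only [← mul_assoc]
    rw [brI_mul_brG p (by omega) (by omega), one_mul]
  have e3 : brI p n 1 * brX p n = brI p n 3 * brX p n := by
    simp only [brI_eq, add_mul, smul_mul_assoc, one_mul, brG_one_mul_brX p, brG_three_mul_brX p h]
  have e4 : brI p n 3 * (brG p n 2 * brX p n) = brI p n 1 * (brG p n 2 * brX p n) := by
    rw [brG_eq p n 2]
    simp only [mul_add, add_mul, smul_mul_assoc, mul_smul_comm, one_mul, e2, e3]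
  rw [brG_eq p n 3, brG_eq p n 1, add_mul, add_mul, smul_mul_assoc, e4]
  simp only [smul_mul_assoc]

/-- The reversed word of `g₂ g₃ g₁⁻¹ g₂⁻¹`. -/
def brTrev (n : ℕ) : QBr p n := brI p n 2 * brI p n 1 * brG p n 3 * brG p n 2

theorem brTrev_mul_brX (h : 4 ≤ n) : brTrev p n * brX p n = brX p n := by
  rw [brTrev]
  simp only [mul_assoc]
  rw [brG_brG_mul_brX p h, ← mul_assoc (brI p n 1), brI_mul_brG p (by omega) (by omega), one_mul,
    ← mul_assoc, brI_mul_brG p (by omega) (by omega), one_mul]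

theorem brX_mul_brTrev (h : 4 ≤ n) : brX p n * brTrev p n = brX p n := by
  have e3 : brX p n * brI p n 1 = brX p n * brI p n 3 := by
    simp only [brI_eq, mul_add, mul_smul_comm, mul_one, brX_mul_brG_one p, brX_mul_brG_three p h]
  have e5 := brX_mul_brG_brG p h
  have e4 : brX p n * brG p n 2 * brI p n 1 = brX p n * brG p n 2 * brI p n 3 := by
    simp only [brI_eq, mul_add, mul_smul_comm, mul_one, e5]
  have e : brX p n * brI p n 2 * brI p n 1 = brX p n * brI p n 2 * brI p n 3 := by
    rw [brI_eq p n 2]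
    simp only [mul_add, add_mul, mul_smul_comm, smul_mul_assoc, mul_one, e3, e4]
  rw [brTrev]
  simp only [← mul_assoc]
  rw [e, mul_assoc _ (brI p n 3), brI_mul_brG p (by omega) (by omega), mul_one, mul_assoc,
    brI_mul_brG p (by omega) (by omega), mul_one]

theorem brF_mul_brI_one : brF p n * brI p n 1 = ((p.q⁻¹ : Rˣ) : R) • brF p n := by
  rw [brF, smul_mul_assoc, brE_mul_brI_one, smul_comm]

theorem brI_one_mul_brF : brI p n 1 * brF p n = ((p.q⁻¹ : Rˣ) : R) • brF p n := by
  rw [brF, mul_smul_comm, brI_one_mul_brE, smul_comm]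

/-- Expand the letter g₂⁻¹ of both words in terms of g₂. The leading terms agree because g₁⁻¹ and g₃
commute, and the remainders are the same multiple of f g₃. -/
theorem brF_brTrev_brF (h : 4 ≤ n) : brF p n * brTrev p n * brF p n = brX p n := by
  have c3 := brF_far p n (i := 3) (by omega)
  have c13 : Commute (brI p n 1) (brG p n 3) := brI_brG_far p n (by omega)
  have e1 : brF p n * (brG p n 3 * (brI p n 1 * (brG p n 2 * brF p n))) =
      brF p n * (brG p n 2 * (brG p n 3 * (brI p n 1 * brF p n))) := by
    rw [← mul_assoc (brF p n) (brG p n 3), c3.eq, mul_assoc, ← mul_assoc (brF p n) (brI p n 1),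
      brF_mul_brI_one, smul_mul_assoc, mul_smul_comm, brI_one_mul_brF, mul_smul_comm,
      mul_smul_comm, mul_smul_comm, ← c3.eq, ← mul_assoc (brG p n 2), ← mul_assoc (brF p n) _ (brG p n 3),
      ← mul_assoc (brF p n), brF_brG_two_brF p (by omega), smul_mul_assoc, mul_smul_comm, c3.eq]
  rw [brX, brT, brTrev]
  simp only [zero_add, mul_assoc]
  rw [← mul_assoc (brI p n 1), c13.eq, brI_eq p n 2]
  simp only [mul_add, add_mul, mul_smul_comm, smul_mul_assoc, one_mul, mul_assoc, e1]

/-- Only the twist relations are not visibly symmetric: T reversed is a different word. It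
nevertheless has the same compression to the corner of f and is likewise absorbed by X. -/
theorem rev_brRelations : BrRelations p n (fun i => MulOpposite.op (brG p n i))
    (MulOpposite.op (brE p n)) where
  quad i h1 h2 := by
    rw [← MulOpposite.op_mul, brG_quad p n i h1 h2]; rfl
  braid i h1 h2 := by
    simp only [← MulOpposite.op_mul, ← mul_assoc, brG_braid]
  far i j h1 h2 h3 := by
    simp only [← MulOpposite.op_mul, (brG_far p n h2).eq]
  e_sq h := by rw [← MulOpposite.op_mul, brE_sq]; rfl
  e_far i h1 h2 := by simp only [← MulOpposite.op_mul, (brE_far p n h1).eq]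
  e_g1 h := by rw [← MulOpposite.op_mul, brG_one_mul_brE]; rfl
  g1_e h := by rw [← MulOpposite.op_mul, brE_mul_brG_one]; rfl
  e_g2_e h := by
    simp only [← MulOpposite.op_mul, ← mul_assoc]
    rw [(brRelations p n).e_g2_e h]; rfl
  e_g2inv_e h := by
    change MulOpposite.op (brE p n * (brI p n 2 * brE p n)) = _
    rw [← mul_assoc, brI, (brRelations p n).e_g2inv_e h]; rfl
  twist_left h := by
    change MulOpposite.op ((brE p n * ((brI p n 2 * (brI p n 1 * (brG p n 3 * brG p n 2))) *
      brE p n)) * (brI p n 2 * (brI p n 1 * (brG p n 3 * brG p n 2)))) =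
        MulOpposite.op (brE p n * ((brI p n 2 * (brI p n 1 * (brG p n 3 * brG p n 2))) *
      brE p n))
    have e : brI p n 2 * (brI p n 1 * (brG p n 3 * brG p n 2)) = brTrev p n := by
      simp only [brTrev, mul_assoc]
    rw [e, ← mul_assoc, brE_eq_smul_brF]
    simp only [smul_mul_assoc, mul_smul_comm]
    rw [brF_brTrev_brF p h, brX_mul_brTrev p h]
  twist_right h := by
    change MulOpposite.op ((brI p n 2 * (brI p n 1 * (brG p n 3 * brG p n 2))) *
      (brE p n * ((brI p n 2 * (brI p n 1 * (brG p n 3 * brG p n 2))) *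
      brE p n))) =
        MulOpposite.op (brE p n * ((brI p n 2 * (brI p n 1 * (brG p n 3 * brG p n 2))) *
      brE p n))
    have e : brI p n 2 * (brI p n 1 * (brG p n 3 * brG p n 2)) = brTrev p n := by
      simp only [brTrev, mul_assoc]
    rw [e, ← mul_assoc (brE p n), brE_eq_smul_brF]
    simp only [smul_mul_assoc, mul_smul_comm]
    rw [brF_brTrev_brF p h, brTrev_mul_brX p h]

variable (n) in
/-- The reversal of words. -/
def brRev : QBr p n →ₗ[R] QBr p n :=
  (MulOpposite.opLinearEquiv R).symm.toLinearMap.comp (rev_brRelations p).lift.toLinearMap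

theorem brRev_mul (x y : QBr p n) : brRev p n (x * y) = brRev p n y * brRev p n x := by
  simp [brRev]

theorem brRev_one : brRev p n 1 = 1 := by
  simp [brRev]

theorem brRev_brG (i : ℕ) : brRev p n (brG p n i) = brG p n i := by
  by_cases h : 1 ≤ i ∧ i < n
  · simp [brRev, (rev_brRelations p).lift_brG h.1 h.2]
  · simp [brG_out h]

theorem brRev_brE : brRev p n (brE p n) = brE p n := by
  by_cases h : 2 ≤ n
  · simp [brRev, (rev_brRelations p).lift_brE h]
  · simp [brE_out h]

theorem brRev_brF : brRev p n (brF p n) = brF p n := by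
  rw [brF, map_smul, brRev_brE]

theorem brRev_brI (i : ℕ) : brRev p n (brI p n i) = brI p n i := by
  rw [brI_eq, map_add, map_smul, map_smul, brRev_brG, brRev_one]

theorem brRev_brRev (x : QBr p n) : brRev p n (brRev p n x) = x := by
  induction x using QBr.induction with
  | hc c => rw [Algebra.algebraMap_eq_smul_one, map_smul, map_smul, brRev_one, brRev_one]
  | hg i h1 h2 => rw [brRev_brG, brRev_brG]
  | he h => rw [brRev_brE, brRev_brE]
  | hadd x y hx hy => rw [map_add, map_add, hx, hy]
  | hmul x y hx hy => rw [brRev_mul, brRev_mul, hx, hy]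

theorem brRev_brX (h : 4 ≤ n) : brRev p n (brX p n) = brX p n := by
  conv_rhs => rw [← brF_brTrev_brF p h]
  rw [brX, brT, brTrev]
  simp only [brRev_mul, brRev_brF, brRev_brI, brRev_brG, zero_add, mul_assoc]

theorem brRev_cupMap {m : ℕ} (h : m + 2 ≤ n) (x : QBr p m) :
    brRev p n (cupMap p h x) = cupMap p h (brRev p m x) := by
  induction x using QBr.induction with
  | hc c =>
    rw [Algebra.algebraMap_eq_smul_one, map_smul, map_smul, map_smul, map_smul, brRev_one,
      cupMap_one, brRev_brF]
  | hg i h1 h2 =>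
    rw [brRev_brG, cupMap_brG p h h1 h2, brRev_mul, brRev_brF, brRev_brG,
      (brF_far p n (by omega)).eq]
  | he h2 => rw [brRev_brE, cupMap_brE p h h2, map_smul, brRev_brX p (by omega)]
  | hadd x y hx hy => simp only [map_add, hx, hy]
  | hmul x y hx hy => rw [brRev_mul, cupMap_mul, cupMap_mul, brRev_mul, hx, hy]

theorem brRev_mem {a b : ℕ} {x : QBr p n} (hx : x ∈ heckeInt p n a b) :
    brRev p n x ∈ heckeInt p n a b := by
  induction hx using Algebra.adjoin_induction with
  | mem x hx => obtain ⟨i, h3, h4, rfl⟩ := hx; rw [brRev_brG]; exact brG_mem p h3 h4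
  | algebraMap c =>
    rw [Algebra.algebraMap_eq_smul_one, map_smul, brRev_one]
    exact Subalgebra.smul_mem _ (one_mem _) c
  | add x y _ _ hx hy => rw [map_add]; exact add_mem hx hy
  | mul x y _ _ hx hy => rw [brRev_mul]; exact mul_mem hy hx

end Reversal

/-! ### The idempotents ē_(k) -/

section Idempotents

variable {R : Type*} [CommRing R] (p : BrParam R) {n : ℕ}

theorem eBar_zero : eBar p n 0 = 1 := by simp [eBar, eK]

theorem eBar_one : eBar p n 1 = brF p n := by simp [eBar, eK, brF]

theorem gUp_eq (i j : ℕ) : gUp p n i j = upProd (brG p n) i (j + 1 - i) := prod_range'_map _ _ _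

theorem gUpInv_eq (i j : ℕ) : gUpInv p n i j = upProd (brI p n) i (j + 1 - i) :=
  prod_range'_map _ _ _

theorem eBar_succ_succ (k : ℕ) : eBar p n (k + 2) =
    brF p n * upProd (brG p n) 2 (2 * k + 2) * upProd (brI p n) 1 (2 * k + 2) *
      eBar p n (k + 1) := by
  rw [eBar, eK, gUp_eq, gUpInv_eq, eBar, brF, smul_mul_assoc, smul_mul_assoc, smul_mul_smul_comm,
    pow_succ' _ (k + 1), Units.val_mul,
    show 2 * (k + 1) + 1 + 1 - 2 = 2 * k + 2 by omega,
    show 2 * (k + 1) + 1 - 1 = 2 * k + 2 by omega]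

theorem brF_mul_eBar_succ (k : ℕ) : brF p n * eBar p n (k + 1) = eBar p n (k + 1) := by
  cases k with
  | zero => rw [eBar_one, (brF_idem p n).eq]
  | succ k => rw [eBar_succ_succ, ← mul_assoc, ← mul_assoc, ← mul_assoc, (brF_idem p n).eq]

theorem cupMap_upProd {m : ℕ} (h : m + 2 ≤ n) {f : ℕ → QBr p m} {f' : ℕ → QBr p n} {a l : ℕ}
    (hf : ∀ i, a ≤ i → i < a + l →
      cupMap p h (f i) = brF p n * f' (i + 2) ∧ Commute (brF p n) (f' (i + 2))) :
    cupMap p h (upProd f a l) = brF p n * upProd f' (a + 2) l := by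
  induction l with
  | zero => rw [upProd_zero, upProd_zero, cupMap_one, mul_one]
  | succ l ih =>
    have hl := hf (a + l) (by omega) (by omega)
    rw [upProd_succ, cupMap_mul, hl.1, ih fun i h1 h2 => hf i h1 (by omega), upProd_succ,
      commute_idem_mul (brF_idem p n) (Commute.upProd_right fun i h1 h2 => ?_)]
    · congr 3; omega
    · obtain ⟨i, rfl⟩ : ∃ i', i = i' + 2 := ⟨i - 2, by omega⟩
      exact (hf i (by omega) (by omega)).2

/-- The defining recursion of ē_(k) lengthens its chains at every step. This gives a uniform
recursion instead, by which identities for few cups propagate to all k. -/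
theorem cupMap_eBar {m : ℕ} (h : m + 2 ≤ n) (k : ℕ) (hk : 2 * k ≤ m) :
    cupMap p h (eBar p m k) = eBar p n (k + 1) := by
  induction k with
  | zero => rw [eBar_zero, eBar_one, cupMap_one]
  | succ k ih =>
    cases k with
    | zero =>
      rw [eBar_one, cupMap_brF p h (by omega), eBar_succ_succ, eBar_one, brX, brT]
      simp only [upProd, mul_assoc, one_mul]
    | succ k =>
      have cU : ∀ l, Commute (brF p n) (upProd (brG p n) 4 l) := fun l =>
        Commute.upProd_right fun i h1 _ => brF_far p n (by omega)
      have cI : ∀ l, Commute (brF p n) (upProd (brI p n) 3 l) := fun l =>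
        Commute.upProd_right fun i h1 _ => brF_brI_far p n (by omega)
      have c1 : ∀ l, Commute (brI p n 1 * brI p n 2) (upProd (brG p n) 4 l) := fun l =>
        Commute.upProd_right fun i h1 _ =>
          (brI_brG_far p n (by omega)).mul_left (brI_brG_far p n (by omega))
      rw [eBar_succ_succ, cupMap_mul, cupMap_mul, cupMap_mul, ih (by omega),
        cupMap_brF p h (by omega)]
      rw [cupMap_upProd p h (f' := brG p n), cupMap_upProd p h (f' := brI p n)]
      rotate_left
      · exact fun i h1 h2 => ⟨cupMap_brI p h (by omega) (by omega), brF_brI_far p n (by omega)⟩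
      · exact fun i h1 h2 => ⟨cupMap_brG p h (by omega) (by omega), brF_far p n (by omega)⟩
      -- The first two letters of the two chains form T once g₁⁻¹g₂⁻¹ has been moved left past the
      -- positive letters of index at least 4.
      have eU : upProd (brG p n) 2 (2 * (k + 1) + 2) =
          brG p n 2 * (brG p n 3 * upProd (brG p n) 4 (2 * k + 2)) := by
        rw [show 2 * (k + 1) + 2 = 2 * k + 2 + 1 + 1 by omega, upProd_succ', upProd_succ']
      have eI : upProd (brI p n) 1 (2 * (k + 1) + 2) =
          brI p n 1 * (brI p n 2 * upProd (brI p n) 3 (2 * k + 2)) := by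
        rw [show 2 * (k + 1) + 2 = 2 * k + 2 + 1 + 1 by omega, upProd_succ', upProd_succ']
      rw [eBar_succ_succ p (k + 1), eU, eI]
      have e := cU (2 * k + 2)
      have e' := cI (2 * k + 2)
      have e1 := c1 (2 * k + 2)
      change brX p n * (brF p n * upProd (brG p n) 4 _) * (brF p n * upProd (brI p n) 3 _) * _ =
        brF p n * (brG p n 2 * (brG p n 3 * upProd (brG p n) 4 _)) *
          (brI p n 1 * (brI p n 2 * upProd (brI p n) 3 _)) * _
      calc _ = brX p n * (brF p n * upProd (brG p n) 4 (2 * k + 2) *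
            (brF p n * upProd (brI p n) 3 (2 * k + 2))) * eBar p n (k + 1 + 1) := by
            simp only [mul_assoc]
        _ = brX p n * brF p n * (upProd (brG p n) 4 (2 * k + 2) *
            upProd (brI p n) 3 (2 * k + 2)) * eBar p n (k + 1 + 1) := by
            rw [commute_idem_mul (brF_idem p n) e]; simp only [mul_assoc]
        _ = brF p n * brT p n 0 * (brF p n * (upProd (brG p n) 4 (2 * k + 2) *
            upProd (brI p n) 3 (2 * k + 2))) * eBar p n (k + 1 + 1) := by
            rw [brX_mul_brF, brX]; simp only [mul_assoc]
        _ = brF p n * brT p n 0 * (upProd (brG p n) 4 (2 * k + 2) *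
            upProd (brI p n) 3 (2 * k + 2)) * (brF p n * eBar p n (k + 1 + 1)) := by
            rw [(e.mul_right e').eq]; simp only [mul_assoc]
        _ = brF p n * brG p n 2 * brG p n 3 * ((brI p n 1 * brI p n 2) *
            upProd (brG p n) 4 (2 * k + 2)) *
            upProd (brI p n) 3 (2 * k + 2) * eBar p n (k + 1 + 1) := by
            rw [brF_mul_eBar_succ, brT]; simp only [mul_assoc, zero_add]
        _ = _ := by rw [e1.eq]; simp only [mul_assoc]

/-- The largest smaller algebra whose image under `cupMap` is the corner. -/
theorem exists_add_two (h : 2 ≤ n) : ∃ m, n = m + 2 := ⟨n - 2, by omega⟩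

theorem eBar_idem {k : ℕ} (hk : 2 * k ≤ n) : IsIdempotentElem (eBar p n k) := by
  induction k generalizing n with
  | zero => rw [eBar_zero]; exact IsIdempotentElem.one
  | succ k ih =>
    obtain ⟨m, rfl⟩ := exists_add_two (show 2 ≤ n by omega)
    rw [← cupMap_eBar p (m := m) le_rfl k (by omega), IsIdempotentElem, ← cupMap_mul,
      (ih (by omega)).eq]

theorem brRev_eBar {k : ℕ} (hk : 2 * k ≤ n) : brRev p n (eBar p n k) = eBar p n k := by
  induction k generalizing n with
  | zero => rw [eBar_zero, brRev_one]
  | succ k ih =>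
    obtain ⟨m, rfl⟩ := exists_add_two (show 2 ≤ n by omega)
    rw [← cupMap_eBar p (m := m) le_rfl k (by omega), brRev_cupMap, ih (by omega)]

theorem eBar_mul_eBar {j k : ℕ} (hjk : j ≤ k) (hk : 2 * k ≤ n) :
    eBar p n k * eBar p n j = eBar p n k := by
  induction k generalizing n j with
  | zero => obtain rfl : j = 0 := by omega
            rw [eBar_zero, mul_one]
  | succ k ih =>
    obtain ⟨m, rfl⟩ := exists_add_two (show 2 ≤ n by omega)
    cases j with
    | zero => rw [eBar_zero, mul_one]
    | succ j =>
      rw [← cupMap_eBar p (m := m) le_rfl k (by omega),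
        ← cupMap_eBar p (m := m) le_rfl j (by omega), ← cupMap_mul, ih (by omega) (by omega)]

theorem eBar_mul_eBar' {j k : ℕ} (hjk : j ≤ k) (hk : 2 * k ≤ n) :
    eBar p n j * eBar p n k = eBar p n k := by
  have h := congrArg (brRev p n) (eBar_mul_eBar p hjk hk)
  rwa [brRev_mul, brRev_eBar p hk, brRev_eBar p (by omega)] at h

theorem eBar_far {k i : ℕ} (hk : 2 * k ≤ n) (hi : 2 * k < i) :
    Commute (eBar p n k) (brG p n i) := by
  by_cases hin : i < n
  swap
  · rw [brG_out (by omega)]; exact Commute.zero_right _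
  induction k generalizing n i with
  | zero => rw [eBar_zero]; exact Commute.one_left _
  | succ k ih =>
    obtain ⟨m, rfl⟩ := exists_add_two (show 2 ≤ n by omega)
    obtain ⟨i, rfl⟩ := exists_add_two (show 2 ≤ i by omega)
    have e := (ih (n := m) (i := i) (by omega) (by omega) (by omega)).eq
    have h : m + 2 ≤ m + 2 := le_rfl
    have e' := congrArg (cupMap p h) e
    rw [cupMap_mul, cupMap_mul, cupMap_eBar p h k (by omega), cupMap_brG p h (by omega) (by omega),
      ← mul_assoc] at e'
    rw [Commute, SemiconjBy]
    have a1 : eBar p (m + 2) (k + 1) * brF p (m + 2) = eBar p (m + 2) (k + 1) := by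
      rw [← eBar_one]; exact eBar_mul_eBar p (by omega) (by omega)
    rw [a1, (brF_far p (m + 2) (show 3 ≤ i + 2 by omega)).eq, mul_assoc, brF_mul_eBar_succ] at e'
    exact e'

theorem eBar_commute_heckeInt {k a b : ℕ} (hk : 2 * k ≤ n) (ha : 2 * k < a) {x : QBr p n}
    (hx : x ∈ heckeInt p n a b) : Commute (eBar p n k) x :=
  commute_of_mem_heckeInt p (fun _ h1 _ => eBar_far p hk (by omega)) hx

theorem eBar_succ_mul_brF {k : ℕ} (hk : 2 * (k + 1) ≤ n) :
    eBar p n (k + 1) * brF p n = eBar p n (k + 1) := by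
  rw [← eBar_one]; exact eBar_mul_eBar p (by omega) (by omega)

theorem eBar_mul_brG_last {k : ℕ} (hk : 2 * (k + 1) ≤ n) :
    eBar p n (k + 1) * brG p n (2 * k + 1) = (p.q : R) • eBar p n (k + 1) := by
  induction k generalizing n with
  | zero => rw [eBar_one]; exact brF_mul_brG_one p n
  | succ k ih =>
    obtain ⟨m, rfl⟩ := exists_add_two (show 2 ≤ n by omega)
    have h : m + 2 ≤ m + 2 := le_rfl
    have e := congrArg (cupMap p h) (ih (n := m) (by omega))
    rwa [cupMap_mul, map_smul, cupMap_eBar p h (k + 1) (by omega),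
      cupMap_brG p h (by omega) (by omega), ← mul_assoc, eBar_succ_mul_brF p hk] at e

/-- For two cups this is `brX_mul_brG_brG`; each cup insertion raises all the indices by two. -/
theorem eBar_mul_brG_brG {k : ℕ} (hk : 2 * (k + 2) ≤ n) :
    eBar p n (k + 2) * brG p n (2 * k + 2) * brG p n (2 * k + 3) =
      eBar p n (k + 2) * brG p n (2 * k + 2) * brG p n (2 * k + 1) := by
  induction k generalizing n with
  | zero =>
    obtain ⟨m, rfl⟩ := exists_add_two (show 2 ≤ n by omega)
    rw [← cupMap_eBar p (m := m) le_rfl 1 (by omega), eBar_one, cupMap_brF p le_rfl (by omega)]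
    exact brX_mul_brG_brG p (by omega)
  | succ k ih =>
    obtain ⟨m, rfl⟩ := exists_add_two (show 2 ≤ n by omega)
    have h : m + 2 ≤ m + 2 := le_rfl
    have e := congrArg (cupMap p h) (ih (n := m) (by omega))
    have key : ∀ i j, 1 ≤ i → i < m → 1 ≤ j → j < m →
        cupMap p h (eBar p m (k + 2) * brG p m i * brG p m j) =
          eBar p (m + 2) (k + 1 + 2) * brG p (m + 2) (i + 2) * brG p (m + 2) (j + 2) := by
      intro i j h1 h2 h3 h4
      rw [cupMap_mul, cupMap_mul, cupMap_eBar p h (k + 2) (by omega), cupMap_brG p h h1 h2,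
        cupMap_brG p h h3 h4, ← mul_assoc, ← mul_assoc,
        mul_assoc _ (brG p (m + 2) (i + 2)) (brF p (m + 2)),
        ← (brF_far p (m + 2) (show 3 ≤ i + 2 by omega)).eq, ← mul_assoc, 
        eBar_succ_mul_brF p (by omega), eBar_succ_mul_brF p (by omega)]
    rwa [key _ _ (by omega) (by omega) (by omega) (by omega),
      key _ _ (by omega) (by omega) (by omega) (by omega)] at e

end Idempotents

end


noncomputable section

/-! ### Normal forms for ē_(k) times the Hecke algebra -/

section Spanning

variable {R : Type*} [CommRing R] (p : BrParam R) {n : ℕ}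

theorem brG_heckeInv_smul (i : ℕ) (x y : QBr p n) :
    x * brG p n i * y = (p.q : R) • (x * brI p n i * y) + ((p.q : R) - 1) • (x * y) := by
  rw [brG_eq p n i]
  simp only [mul_add, add_mul, mul_smul_comm, smul_mul_assoc, mul_one]

theorem heckeInt_self {a b : ℕ} (h : b ≤ a) {x : QBr p n} (hx : x ∈ heckeInt p n a b) :
    ∃ c : R, x = c • 1 := by
  induction hx using Algebra.adjoin_induction with
  | mem x hx => obtain ⟨i, h1, h2, rfl⟩ := hx; omega
  | algebraMap c => exact ⟨c, Algebra.algebraMap_eq_smul_one c⟩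
  | add x y _ _ hx hy =>
    obtain ⟨c, rfl⟩ := hx; obtain ⟨d, rfl⟩ := hy
    exact ⟨c + d, (add_smul c d 1).symm⟩
  | mul x y _ _ hx hy =>
    obtain ⟨c, rfl⟩ := hx; obtain ⟨d, rfl⟩ := hy
    exact ⟨c * d, by rw [smul_mul_smul_comm, mul_one]⟩

/-- Right coset representatives of `H_b` in `H_{b+1}`. -/
theorem heckeInt_succ_le_span {a b : ℕ} (ha : 1 ≤ a) (hab : a ≤ b + 1) (hb : b < n) {x : QBr p n}
    (hx : x ∈ heckeInt p n a (b + 1)) : x ∈ Submodule.span R {z : QBr p n |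
      ∃ y ∈ heckeInt p n a b, ∃ j l, a ≤ j ∧ j + l = b + 1 ∧ z = y * downProd (brG p n) j l} := by
  induction b generalizing x with
  | zero =>
    obtain rfl : a = 1 := by omega
    obtain ⟨c, rfl⟩ := heckeInt_self p le_rfl hx
    exact Submodule.smul_mem _ _ (Submodule.subset_span
      ⟨1, one_mem _, 1, 0, le_rfl, rfl, by rw [downProd_zero, mul_one]⟩)
  | succ b ih =>
    set D := Submodule.span R {z : QBr p n | ∃ y ∈ heckeInt p n a (b + 1), ∃ j l, a ≤ j ∧
      j + l = b + 1 + 1 ∧ z = y * downProd (brG p n) j l} with hD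
    have h1 : ∀ x ∈ heckeInt p n a (b + 1), x ∈ D := fun x hx =>
      Submodule.subset_span ⟨x, hx, b + 2, 0, hab, rfl, by rw [downProd_zero, mul_one]⟩
    rcases Nat.lt_or_ge (b + 1) a with h | h
    · obtain ⟨c, rfl⟩ := heckeInt_self p (by omega) hx
      exact h1 _ (Subalgebra.smul_mem _ (one_mem _) c)
    refine heckeInt_succ_induction p ha h hb h1 (fun x hx y hy => ?_) hx
    have hy' := ih h (by omega) hy
    clear hy
    induction hy' using Submodule.span_induction with
    | zero => simp
    | add y z _ _ hy hz => rw [mul_add]; exact D.add_mem hy hz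
    | smul c y _ hy => rw [mul_smul_comm]; exact D.smul_mem c hy
    | mem z hz =>
      obtain ⟨y, hy, j, l, hj, hjl, rfl⟩ := hz
      refine Submodule.subset_span ⟨x * y, mul_mem hx (heckeInt_mono p le_rfl (by omega) hy), j,
        l + 1, hj, by omega, ?_⟩
      rw [downProd_succ, hjl, mul_assoc x, ← mul_assoc (brG p n (b + 1)),
        (brG_commute_heckeInt p (Or.inl (by omega)) hy).eq]
      simp only [mul_assoc]

/-- Once all 2k+2 points lie on cups, the top generator g_{2k+1} can be eliminated: it is absorbed
when it reaches ē_(k+1), and when a lower letter shields it, the exchange of g_{2k+2}g_{2k+3} for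
g_{2k+2}g_{2k+1} lowers the top index. -/
theorem eBar_mul_heckeInt_cup {k : ℕ} (hk : 2 * (k + 1) ≤ n) {x : QBr p n}
    (hx : x ∈ heckeInt p n 1 (2 * k + 2)) :
    ∃ y ∈ heckeInt p n 1 (2 * k + 1), eBar p n (k + 1) * x = eBar p n (k + 1) * y := by
  suffices h : x ∈ ((Subalgebra.toSubmodule (heckeInt p n 1 (2 * k + 1))).map
      (LinearMap.mulLeft R (eBar p n (k + 1)))).comap (LinearMap.mulLeft R (eBar p n (k + 1))) by
    obtain ⟨y, hy, e⟩ := h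
    exact ⟨y, hy, e.symm⟩
  induction k generalizing x with
  | zero =>
    refine heckeInt_succ_induction p (b := 1) le_rfl le_rfl hk (fun x hx => ?_)
      (fun x hx y hy => ?_) hx
    · exact ⟨x, hx, rfl⟩
    obtain ⟨c, rfl⟩ := heckeInt_self p le_rfl hx
    refine ⟨(c * (p.q : R)) • y, Subalgebra.smul_mem _ hy _, ?_⟩
    have e : eBar p n (0 + 1) * brG p n 1 = _ := eBar_mul_brG_last p hk
    simp only [LinearMap.mulLeft_apply, mul_smul_comm, smul_mul_assoc, one_mul, mul_smul]
    rw [← mul_assoc, e, smul_mul_assoc]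
  | succ k ih =>
    refine heckeInt_succ_induction p (b := 2 * k + 3) le_rfl (by omega) (by omega)
      (fun x hx => ?_) (fun x hx y hy => ?_) hx
    · exact ⟨x, hx, rfl⟩
    change x ∈ (((Subalgebra.toSubmodule (heckeInt p n 1 (2 * k + 3))).map
      (LinearMap.mulLeft R (eBar p n (k + 1 + 1)))).comap
        (LinearMap.mulLeft R (eBar p n (k + 1 + 1)))).comap
          ((LinearMap.mulRight R y).comp (LinearMap.mulRight R (brG p n (2 * k + 3))))
    have e3 := eBar_mul_brG_brG p hk
    have e4 : eBar p n (k + 1 + 1) * brG p n (2 * k + 3) = _ := eBar_mul_brG_last p hk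
    refine heckeInt_succ_induction p (b := 2 * k + 2) le_rfl (by omega) (by omega)
      (fun x hx => ?_) (fun u hu v hv => ?_) hx
    · have c := brG_commute_heckeInt p (i := 2 * k + 3) (Or.inl (by omega)) hx
      refine ⟨(p.q : R) • (x * y), Subalgebra.smul_mem _
        (mul_mem (heckeInt_mono p le_rfl (by omega) hx) hy) _, ?_⟩
      simp only [LinearMap.mulLeft_apply, LinearMap.mulRight_apply, LinearMap.comp_apply]
      rw [← c.eq, mul_assoc, ← mul_assoc (eBar p n _), e4, smul_mul_assoc,
        mul_smul_comm]
    · obtain ⟨u', hu', e⟩ := ih (by omega) hu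
      simp only [LinearMap.mulLeft_apply] at e
      have hm : heckeInt p n 1 (2 * k + 2) ≤ heckeInt p n 1 (2 * k + 3) :=
        heckeInt_mono p le_rfl (by omega)
      have hu'' := heckeInt_mono p le_rfl (show 2 * k + 1 ≤ 2 * k + 2 by omega) hu'
      have hmem : brG p n (2 * k + 2) * brG p n (2 * k + 1) * (u' * v * y) ∈
          heckeInt p n 1 (2 * k + 3) := mul_mem (mul_mem
        (brG_mem p (by omega) (by omega)) (brG_mem p (by omega) (by omega)))
          (mul_mem (mul_mem (hm hu'') (hm hv)) hy)
      refine ⟨_, hmem, ?_⟩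
      have e2 : eBar p n (k + 2) * u = eBar p n (k + 2) * u' := by
        rw [← eBar_mul_eBar p (show k + 1 ≤ k + 2 by omega) hk, mul_assoc, ← e, mul_assoc]
      have c1 := brG_commute_heckeInt p (i := 2 * k + 3) (Or.inl (by omega)) hv
      have c2 := brG_commute_heckeInt p (i := 2 * k + 3) (Or.inl (by omega)) hu'
      have c3 := brG_commute_heckeInt p (i := 2 * k + 2) (Or.inl (by omega)) hu'
      simp only [LinearMap.mulLeft_apply, LinearMap.mulRight_apply, LinearMap.comp_apply]
      calc _ = eBar p n (k + 2) * brG p n (2 * k + 2) * brG p n (2 * k + 1) * (u' * v * y) := by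
            simp only [mul_assoc]
        _ = eBar p n (k + 2) * (brG p n (2 * k + 2) * ((brG p n (2 * k + 3) * u') * (v * y))) := by
            rw [← e3]; simp only [mul_assoc]
        _ = eBar p n (k + 2) * ((brG p n (2 * k + 2) * u') * ((brG p n (2 * k + 3) * v) * y)) := by
            rw [c2.eq]; simp only [mul_assoc]
        _ = (eBar p n (k + 2) * u) * (brG p n (2 * k + 2) * (v * (brG p n (2 * k + 3) * y))) := by
            rw [c3.eq, c1.eq, e2]
            simp only [mul_assoc]
        _ = _ := by simp only [mul_assoc]

/-- The two generating sets distinguish whether the last point is off the cups or is carried to the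
end of the last cup by a chain. The Hecke factor in front uses only indices beyond the cups, so it
commutes with ē_(k+1). -/
theorem eBar_mul_heckeInt_succ {k b : ℕ} (hk : 2 * (k + 1) ≤ b + 1) (hb : b < n) {x : QBr p n}
    (hx : x ∈ heckeInt p n 1 (b + 1)) :
    eBar p n (k + 1) * x ∈ Submodule.span R ({z | 2 * (k + 1) ≤ b ∧
        ∃ h ∈ heckeInt p n (2 * k + 3) (b + 1), ∃ y ∈ heckeInt p n 1 b,
          z = h * (eBar p n (k + 1) * y)} ∪
      {z | ∃ h ∈ heckeInt p n (2 * k + 3) (b + 1), ∃ y ∈ heckeInt p n 1 b,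
          z = h * (eBar p n (k + 1) * (upProd (brI p n) (2 * k + 2) (b - (2 * k + 1)) * y))}) := by
  obtain ⟨l, rfl⟩ : ∃ l, b = 2 * k + 1 + l := ⟨b - (2 * k + 1), by omega⟩
  clear hk
  induction l generalizing x with
  | zero =>
    obtain ⟨y, hy, e⟩ := eBar_mul_heckeInt_cup p hb hx
    rw [e]
    exact Submodule.subset_span (Or.inr ⟨1, one_mem _, y, hy, by
      rw [Nat.sub_self, upProd_zero, one_mul, one_mul]⟩)
  | succ l ih =>
    rw [← add_assoc] at hb hx ⊢
    generalize hD : Submodule.span R (_ ∪ _ : Set (QBr p n)) = D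
    have hD1 : ∀ h ∈ heckeInt p n (2 * k + 3) (2 * k + 1 + l + 1 + 1),
        ∀ y ∈ heckeInt p n 1 (2 * k + 1 + l + 1), h * (eBar p n (k + 1) * y) ∈ D :=
      fun h hh y hy => hD ▸ Submodule.subset_span (Or.inl ⟨by omega, h, hh, y, hy, rfl⟩)
    have hD2 : ∀ h ∈ heckeInt p n (2 * k + 3) (2 * k + 1 + l + 1 + 1),
        ∀ y ∈ heckeInt p n 1 (2 * k + 1 + l + 1),
        h * (eBar p n (k + 1) * (upProd (brI p n) (2 * k + 2) (l + 1) * y)) ∈ D :=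
      fun h hh y hy => hD ▸ Submodule.subset_span (Or.inr ⟨h, hh, y, hy, by
        rw [show 2 * k + 1 + l + 1 - (2 * k + 1) = l + 1 by omega]⟩)
    change x ∈ D.comap (LinearMap.mulLeft R (eBar p n (k + 1)))
    refine heckeInt_succ_induction p le_rfl (by omega) hb (fun x hx => ?_)
      (fun u hu v hv => ?_) hx
    · have := hD1 1 (one_mem _) x hx
      rwa [one_mul] at this
    · have hu' := ih (by omega) hu
      simp only [Submodule.mem_comap, LinearMap.mulLeft_apply]
      rw [mul_assoc, ← mul_assoc]
      generalize eBar p n (k + 1) * u = w at hu'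
      have hm : heckeInt p n 1 (2 * k + 1 + l) ≤ heckeInt p n 1 (2 * k + 1 + l + 1) :=
        heckeInt_mono p le_rfl (by omega)
      have hm' : heckeInt p n (2 * k + 3) (2 * k + 1 + l + 1) ≤
        heckeInt p n (2 * k + 3) (2 * k + 1 + l + 1 + 1) := heckeInt_mono p le_rfl (by omega)
      induction hu' using Submodule.span_induction with
      | zero => simp
      | add y z _ _ hy hz => rw [add_mul]; exact D.add_mem hy hz
      | smul c y _ hy => rw [smul_mul_assoc]; exact D.smul_mem c hy
      | mem z hz =>
        rcases hz with ⟨hl, h, hh, y, hy, rfl⟩ | ⟨h, hh, y, hy, rfl⟩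
        · have c := brG_commute_heckeInt p (i := 2 * k + 1 + l + 1) (Or.inl (by omega)) hy
          have c2 := eBar_far p (n := n) (k := k + 1) (i := 2 * k + 1 + l + 1) (by omega)
            (by omega)
          have := hD1 (h * brG p n (2 * k + 1 + l + 1)) (mul_mem (hm' hh)
            (brG_mem p (by omega) (by omega))) (y * v) (mul_mem (hm hy) hv)
          convert this using 1
          calc _ = h * (eBar p n (k + 1) * (y * brG p n (2 * k + 1 + l + 1) * v)) := by
                simp only [mul_assoc]
            _ = h * ((eBar p n (k + 1) * brG p n (2 * k + 1 + l + 1)) * (y * v)) := by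
                rw [← c.eq]; simp only [mul_assoc]
            _ = _ := by rw [c2.eq]; simp only [mul_assoc]
        · have c := brG_commute_heckeInt p (i := 2 * k + 1 + l + 1) (Or.inl (by omega)) hy
          rw [show 2 * k + 1 + l - (2 * k + 1) = l by omega]
          have e : h * (eBar p n (k + 1) * (upProd (brI p n) (2 * k + 2) l * y)) *
              (brG p n (2 * k + 1 + l + 1) * v) =
              (h * eBar p n (k + 1) * upProd (brI p n) (2 * k + 2) l) *
                brG p n (2 * k + 1 + l + 1) * (y * v) := by
            calc _ = h * (eBar p n (k + 1) * (upProd (brI p n) (2 * k + 2) l *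
                  (y * brG p n (2 * k + 1 + l + 1) * v))) := by simp only [mul_assoc]
              _ = _ := by rw [← c.eq]; simp only [mul_assoc]
          -- Trading g for q g⁻¹ + (q - 1) extends the chain by an inverse letter, as the normal
          -- form requires; the correction lies in the first generating set.
          rw [e, brG_heckeInv_smul]
          refine D.add_mem (D.smul_mem _ ?_) (D.smul_mem _ ?_)
          · have := hD2 h (hm' hh) (y * v) (mul_mem (hm hy) hv)
            rw [upProd_succ, show 2 * k + 2 + l = 2 * k + 1 + l + 1 by omega] at this
            simpa only [mul_assoc] using this
          · have := hD1 h (hm' hh) (upProd (brI p n) (2 * k + 2) l * (y * v))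
              (mul_mem (upProd_mem fun i h1 h2 => brI_mem p (by omega) (by omega))
                (mul_mem (hm hy) hv))
            simpa only [mul_assoc] using this

/-- Index set for the right coset representatives adapted to `k` cups on `n` strands. -/
inductive RIdx : ℕ → ℕ → Type
  | nil (n : ℕ) : RIdx 0 n
  | keep {k n : ℕ} (y : RIdx (k + 1) n) : RIdx (k + 1) (n + 1)
  | cup {k n : ℕ} (y : RIdx k n) (j : Fin (n + 1)) : RIdx (k + 1) (n + 2)

/-- The word with the given index, for an arbitrary choice of the `g_i` and their inverses. -/
def rVal {M : Type*} [Monoid M] (g I : ℕ → M) : {k n : ℕ} → RIdx k n → M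
  | _, _, .nil _ => 1
  | _, _, .keep y => rVal g I y
  | k + 1, n + 2, .cup y j =>
      upProd I (2 * k + 2) (n - 2 * k) * upProd I (2 * k + 1) (n - 2 * k) * rVal g I y *
        downProd g (j + 1) (n - j)

/-- Each of the two chains raises every index by one, so the pair moves a parabolic subalgebra past
the two ends of a new cup. -/
theorem chain_chain_mul_heckeInt {a l : ℕ} (ha : 1 ≤ a) (hl : a + l + 1 ≤ n) {x : QBr p n}
    (hx : x ∈ heckeInt p n a (a + l - 1)) : ∃ y ∈ heckeInt p n (a + 2) (a + l + 1),
      upProd (brI p n) (a + 1) l * upProd (brI p n) a l * x =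
        y * (upProd (brI p n) (a + 1) l * upProd (brI p n) a l) := by
  induction hx using Algebra.adjoin_induction with
  | mem x hx =>
    obtain ⟨i, h1, h2, rfl⟩ := hx
    refine ⟨brG p n (i + 2), brG_mem p (by omega) (by omega), ?_⟩
    rw [mul_assoc, upProd_brI_mul p ha (by omega) h1 (by omega), ← mul_assoc,
      upProd_brI_mul p (by omega) (by omega) (by omega) (by omega), mul_assoc]
  | algebraMap c => exact ⟨algebraMap R _ c, Subalgebra.algebraMap_mem _ c,
      (Algebra.commutes c _).symm⟩
  | add x y _ _ hx hy =>
    obtain ⟨x', hx, ex⟩ := hx; obtain ⟨y', hy, ey⟩ := hy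
    exact ⟨x' + y', add_mem hx hy, by rw [mul_add, ex, ey, add_mul]⟩
  | mul x y _ _ hx hy =>
    obtain ⟨x', hx, ex⟩ := hx; obtain ⟨y', hy, ey⟩ := hy
    exact ⟨x' * y', mul_mem hx hy, by rw [← mul_assoc, ex, mul_assoc x', ey, mul_assoc]⟩

theorem upProd_brI_isUnit {a l : ℕ} (ha : 1 ≤ a) (hl : a + l ≤ n) :
    upProd (brI p n) a l * downProd (brG p n) a l = 1 := by
  induction l with
  | zero => rw [upProd_zero, downProd_zero, mul_one]
  | succ l ih =>
    rw [upProd_succ, downProd_succ, mul_assoc, ← mul_assoc (brI p n _),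
      brI_mul_brG p (by omega) (by omega), one_mul, ih (by omega)]

/-- The last point either lies on no cup, which is the index `keep`, or ends the last cup, which is
the index `cup` with j recording the partner. In the second case deleting that cup leaves k cups on
two strands fewer. -/
theorem eBar_mul_heckeInt {k b : ℕ} (hk : 2 * k ≤ b) (hb : b ≤ n) {x : QBr p n}
    (hx : x ∈ heckeInt p n 1 b) :
    eBar p n k * x ∈ Submodule.span R {z | ∃ h ∈ heckeInt p n (2 * k + 1) b, ∃ y : RIdx k b,
      z = h * (eBar p n k * rVal (brG p n) (brI p n) y)} := by
  induction k generalizing b x with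
  | zero =>
    refine Submodule.subset_span ⟨x, hx, .nil b, ?_⟩
    rw [rVal, mul_one, eBar_zero, one_mul, mul_one]
  | succ k ihk =>
    induction b generalizing x with
    | zero => omega
    | succ b ihb =>
      obtain ⟨m, rfl⟩ : ∃ m, b = m + 1 := ⟨b - 1, by omega⟩
      have h := eBar_mul_heckeInt_succ p hk (by omega) hx
      generalize eBar p n (k + 1) * x = w at h
      set D := Submodule.span R {z | ∃ h ∈ heckeInt p n (2 * (k + 1) + 1) (m + 1 + 1),
        ∃ y : RIdx (k + 1) (m + 1 + 1),
          z = h * (eBar p n (k + 1) * rVal (brG p n) (brI p n) y)} with hD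
      have hmul : ∀ h ∈ heckeInt p n (2 * (k + 1) + 1) (m + 1 + 1), ∀ z ∈ D, h * z ∈ D := by
        intro h hh z hz
        induction hz using Submodule.span_induction with
        | zero => simp
        | add y z _ _ hy hz => rw [mul_add]; exact D.add_mem hy hz
        | smul c y _ hy => rw [mul_smul_comm]; exact D.smul_mem c hy
        | mem z hz =>
          obtain ⟨h', hh', y, rfl⟩ := hz
          rw [← mul_assoc]
          exact Submodule.subset_span ⟨h * h', mul_mem hh hh', y, rfl⟩
      induction h using Submodule.span_induction with
      | zero => simp
      | add y z _ _ hy hz => exact D.add_mem hy hz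
      | smul c y _ hy => exact D.smul_mem c hy
      | mem z hz =>
        rcases hz with ⟨hkm, h, hh, y, hy, rfl⟩ | ⟨h, hh, y, hy, rfl⟩
        · refine hmul h hh _ ?_
          refine Submodule.span_mono ?_ (ihb hkm (by omega) hy)
          rintro z ⟨h, hh, y, rfl⟩
          exact ⟨h, heckeInt_mono p le_rfl (by omega) hh, y.keep, rfl⟩
        · refine hmul h hh _ ?_
          obtain ⟨c1, hc1⟩ : ∃ c1, upProd (brI p n) (2 * k + 1) (m - 2 * k) = c1 := ⟨_, rfl⟩
          obtain ⟨c2, hc2⟩ : ∃ c2, upProd (brI p n) (2 * k + 2) (m - 2 * k) = c2 := ⟨_, rfl⟩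
          -- The `cup` word starts with two inverse chains but only one is present. The second is
          -- split off from y, at the cost of a descending product that stays in the Hecke algebra.
          have ey : y = c1 * (downProd (brG p n) (2 * k + 1) (m - 2 * k) * y) := by
            rw [← hc1, ← mul_assoc, upProd_brI_isUnit p (by omega) (by omega), one_mul]
          have hy' : downProd (brG p n) (2 * k + 1) (m - 2 * k) * y ∈ heckeInt p n 1 (m + 1) :=
            mul_mem (downProd_mem fun i h1 h2 => brG_mem p (by omega) (by omega)) hy
          generalize downProd (brG p n) (2 * k + 1) (m - 2 * k) * y = y' at ey hy'
          rw [ey, show m + 1 - (2 * k + 1) = m - 2 * k by omega, hc2]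
          clear ey
          have hy'' := heckeInt_succ_le_span p le_rfl (by omega) (by omega) hy'
          clear hy'
          induction hy'' using Submodule.span_induction with
          | zero => simp
          | add y z _ _ hy hz => simp only [mul_add]; exact D.add_mem hy hz
          | smul c y _ hy => simp only [mul_smul_comm]; exact D.smul_mem c hy
          | mem z hz =>
            obtain ⟨u, hu, j, l, hj, hjl, rfl⟩ := hz
            have e1 : Commute (eBar p n k) (c2 * c1) := by
              rw [← hc1, ← hc2]
              exact (Commute.upProd_right fun i h1 h2 => by
                exact (eBar_far p (by omega) (by omega)).heckeInv_right p).mul_right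
                (Commute.upProd_right fun i h1 h2 => by
                exact (eBar_far p (by omega) (by omega)).heckeInv_right p)
            -- ē_(k+1) absorbs ē_(k), and ē_(k) commutes with both chains. A copy of ē_(k) can
            -- therefore be placed next to u, where the induction on the number of cups applies.
            have e2 : eBar p n (k + 1) * (c2 * (c1 * (u * downProd (brG p n) j l))) =
                eBar p n (k + 1) * ((c2 * c1) * (eBar p n k * u)) * downProd (brG p n) j l := by
              have e0 := eBar_mul_eBar p (n := n) (show k ≤ k + 1 by omega) (by omega)
              rw [← mul_assoc (c2 * c1), ← e1.eq]
              simp only [← mul_assoc]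
              rw [e0]
            rw [e2]
            have hu' := ihk (by omega) (by omega) hu
            generalize eBar p n k * u = w at hu'
            induction hu' using Submodule.span_induction with
            | zero => simp
            | add y z _ _ hy hz => simp only [mul_add, add_mul]; exact D.add_mem hy hz
            | smul c y _ hy => simp only [mul_smul_comm, smul_mul_assoc]; exact D.smul_mem c hy
            | mem z hz =>
              obtain ⟨h, hh, y, rfl⟩ := hz
              obtain ⟨h', hh', e3⟩ := chain_chain_mul_heckeInt p (a := 2 * k + 1) (l := m - 2 * k)
                (by omega) (by omega)
                (heckeInt_mono p (b' := 2 * k + 1 + (m - 2 * k) - 1) le_rfl (by omega) hh)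
              rw [show 2 * k + 1 + 1 = 2 * k + 2 by rfl, hc1, hc2] at e3
              have e4 : Commute (eBar p n (k + 1)) h' :=
                eBar_commute_heckeInt p (by omega) (by omega) hh'
              refine Submodule.subset_span ⟨h', heckeInt_mono p (by omega) (by omega) hh',
                y.cup ⟨j - 1, by omega⟩, ?_⟩
              rw [rVal, hc1, hc2]
              rw [show j - 1 + 1 = j by omega, show m - (j - 1) = l by omega]
              calc _ = eBar p n (k + 1) * (c2 * c1 * h) * (eBar p n k *
                    rVal (brG p n) (brI p n) y) * downProd (brG p n) j l := by
                    simp only [mul_assoc]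
                _ = h' * (eBar p n (k + 1) * eBar p n k) * (c2 * c1) *
                      rVal (brG p n) (brI p n) y * downProd (brG p n) j l := by
                    rw [e3, ← mul_assoc, ← mul_assoc, e4.eq]
                    simp only [mul_assoc]
                    have e5 : ∀ t, c2 * (c1 * (eBar p n k * t)) =
                        eBar p n k * (c2 * (c1 * t)) := fun t => by
                      rw [← mul_assoc c2, ← mul_assoc, ← e1.eq]; simp only [mul_assoc]
                    rw [e5]
                _ = _ := by
                    rw [eBar_mul_eBar p (by omega) (by omega)]
                    simp only [mul_assoc]

end Spanning

end


noncomputable section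

/-! ### The corners of ē_(k), and spanning by aē_(k)b -/

section Corners

variable {R : Type*} [CommRing R] (p : BrParam R) {m n : ℕ}

theorem brF_commute_heckeInt {a b : ℕ} (ha : 3 ≤ a) {x : QBr p n} (hx : x ∈ heckeInt p n a b) :
    Commute (brF p n) x :=
  commute_of_mem_heckeInt p (fun _ h1 _ => brF_far p n (by omega)) hx

theorem cupMap_heckeInt (h : m + 2 ≤ n) {a b : ℕ} (ha : 1 ≤ a) (hb : b ≤ m) {x : QBr p m}
    (hx : x ∈ heckeInt p m a b) :
    ∃ y ∈ heckeInt p n (a + 2) (b + 2), cupMap p h x = brF p n * y := by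
  induction hx using Algebra.adjoin_induction with
  | mem x hx =>
    obtain ⟨i, h1, h2, rfl⟩ := hx
    exact ⟨_, brG_mem p (by omega) (by omega), cupMap_brG p h (by omega) (by omega)⟩
  | algebraMap c =>
    exact ⟨c • 1, Subalgebra.smul_mem _ (one_mem _) c, by
      rw [Algebra.algebraMap_eq_smul_one, map_smul, cupMap_one, mul_smul_comm, mul_one]⟩
  | add x y _ _ hx hy =>
    obtain ⟨x', hx, ex⟩ := hx; obtain ⟨y', hy, ey⟩ := hy
    exact ⟨x' + y', add_mem hx hy, by rw [map_add, ex, ey, mul_add]⟩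
  | mul x y _ _ hx hy =>
    obtain ⟨x', hx, ex⟩ := hx; obtain ⟨y', hy, ey⟩ := hy
    exact ⟨x' * y', mul_mem hx hy, by
      rw [cupMap_mul, ex, ey,
        commute_idem_mul (brF_idem p n) (brF_commute_heckeInt p (by omega) hx)]⟩

theorem exists_cupMap_eq_brF_mul (h : m + 2 ≤ n) {a b : ℕ} (ha : 1 ≤ a) (hb : b ≤ m) {y : QBr p n}
    (hy : y ∈ heckeInt p n (a + 2) (b + 2)) :
    ∃ x ∈ heckeInt p m a b, cupMap p h x = brF p n * y := by
  induction hy using Algebra.adjoin_induction with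
  | mem x hx =>
    obtain ⟨i, h1, h2, rfl⟩ := hx
    obtain ⟨i, rfl⟩ := exists_add_two (show 2 ≤ i by omega)
    exact ⟨_, brG_mem p (by omega) (by omega), cupMap_brG p h (by omega) (by omega)⟩
  | algebraMap c =>
    exact ⟨c • 1, Subalgebra.smul_mem _ (one_mem _) c, by
      rw [Algebra.algebraMap_eq_smul_one, map_smul, cupMap_one, mul_smul_comm, mul_one]⟩
  | add x y _ _ hx hy =>
    obtain ⟨x', hx, ex⟩ := hx; obtain ⟨y', hy, ey⟩ := hy
    exact ⟨x' + y', add_mem hx hy, by rw [map_add, ex, ey, mul_add]⟩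
  | mul x y hx' _ hx hy =>
    obtain ⟨x', hx, ex⟩ := hx; obtain ⟨y', hy, ey⟩ := hy
    exact ⟨x' * y', mul_mem hx hy, by
      rw [cupMap_mul, ex, ey,
        commute_idem_mul (brF_idem p n) (brF_commute_heckeInt p (by omega) hx')]⟩

theorem range_cupMap_mul (h : m + 2 ≤ n) {x y : QBr p n} (hx : x ∈ (cupMap p h).range)
    (hy : y ∈ (cupMap p h).range) : x * y ∈ (cupMap p h).range := by
  obtain ⟨x, rfl⟩ := hx; obtain ⟨y, rfl⟩ := hy
  exact ⟨x * y, cupMap_mul p h x y⟩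

theorem brF_mem_range_cupMap (h : m + 2 ≤ n) : brF p n ∈ (cupMap p h).range :=
  ⟨1, cupMap_one p h⟩

theorem brF_mul_mem_range_cupMap (h : m + 2 ≤ n) {y : QBr p n}
    (hy : y ∈ heckeInt p n 3 (m + 2)) : brF p n * y ∈ (cupMap p h).range := by
  obtain ⟨x, _, e⟩ := exists_cupMap_eq_brF_mul p h le_rfl le_rfl hy
  exact ⟨x, e⟩

theorem brF_mul_mul_brF {w y : QBr p n} (hy : y ∈ heckeInt p n 3 n) :
    brF p n * (w * y) * brF p n = brF p n * w * brF p n * (brF p n * y) := by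
  have c := brF_commute_heckeInt p le_rfl hy
  simp only [mul_assoc]
  rw [← c.eq, ← mul_assoc (brF p n) (brF p n), (brF_idem p n).eq]

theorem upProd_brI_mul_downProd {a j l : ℕ} (ha : 1 ≤ a) (hl : a + (j + l) ≤ n) :
    upProd (brI p n) a (j + l) * downProd (brG p n) (a + j) l = upProd (brI p n) a j := by
  induction l with
  | zero => rw [downProd_zero, mul_one, add_zero]
  | succ l ih =>
    rw [← add_assoc, upProd_succ, downProd_succ, mul_assoc, ← mul_assoc (brI p n _), add_assoc a,
      brI_mul_brG p (by omega) (by omega), one_mul, ih (by omega)]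

/-- Letters of index at least 3 commute with f and lie over the smaller algebra, so they can be
split off. What remains between two copies of f is at most g₂⁻¹g₃⁻¹g₁⁻¹g₂⁻¹, which is the twist up
to terms already treated. -/
theorem brF_chain_brF_mem (h : m + 2 ≤ n) {s j : ℕ} (hs : s ≤ m) (hj : j ≤ s) :
    brF p n * (upProd (brI p n) 2 s * upProd (brI p n) 1 j) * brF p n ∈ (cupMap p h).range := by
  have mem : ∀ a l, 3 ≤ a → a + l ≤ m + 2 → upProd (brI p n) a l ∈ heckeInt p n 3 (m + 2) :=
    fun a l h1 h2 => upProd_mem fun i h3 h4 => brI_mem p (by omega) (by omega)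
  have mem' : ∀ {y}, y ∈ heckeInt p n 3 (m + 2) → y ∈ heckeInt p n 3 n := fun hy =>
    heckeInt_mono p le_rfl h hy
  have hf := brF_mem_range_cupMap p h
  have h0 : brF p n * upProd (brI p n) 2 s * brF p n ∈ (cupMap p h).range := by
    cases s with
    | zero => rwa [upProd_zero, mul_one, (brF_idem p n).eq]
    | succ s =>
      have hm := mem 3 s le_rfl (by omega)
      rw [upProd_succ', brF_mul_mul_brF p (mem' hm), brF_brI_two_brF p (by omega)]
      exact range_cupMap_mul p h (Submodule.smul_mem _ _ hf) (brF_mul_mem_range_cupMap p h hm)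
  rcases j with _ | _ | j
  · rwa [upProd_zero, mul_one]
  · rw [upProd_succ, upProd_zero, one_mul, ← mul_assoc, mul_assoc, brI_one_mul_brF, mul_smul_comm]
    exact Submodule.smul_mem _ _ h0
  · obtain ⟨s, rfl⟩ := exists_add_two (show 2 ≤ s by omega)
    have c1 : Commute (brI p n 1) (brI p n 3 * upProd (brI p n) 4 s) :=
      (brI_far p n (by omega)).mul_right (Commute.upProd_right fun i _ _ => brI_far p n (by omega))
    have c2 : Commute (brI p n 2) (upProd (brI p n) 4 s) :=
      Commute.upProd_right fun i _ _ => brI_far p n (by omega)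
    have c1' : Commute (brI p n 1) (upProd (brI p n) 4 s) :=
      Commute.upProd_right fun i _ _ => brI_far p n (by omega)
    have e : upProd (brI p n) 2 (s + 2) * upProd (brI p n) 1 (j + 1 + 1) =
        (brI p n 2 * brI p n 3 * brI p n 1 * brI p n 2) *
          (upProd (brI p n) 4 s * upProd (brI p n) 3 j) := by
      rw [upProd_succ', upProd_succ', upProd_succ' _ 1, upProd_succ' _ 2]
      calc _ = brI p n 2 * brI p n 3 * (upProd (brI p n) 4 s * brI p n 1) *
            (brI p n 2 * upProd (brI p n) 3 j) := by simp only [mul_assoc]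
        _ = brI p n 2 * brI p n 3 * brI p n 1 * (upProd (brI p n) 4 s *
            brI p n 2) * upProd (brI p n) 3 j := by rw [← c1'.eq]; simp only [mul_assoc]
        _ = _ := by rw [← c2.eq]; simp only [mul_assoc]
    have hm := mul_mem (mem 4 s (by omega) (by omega)) (mem 3 j le_rfl (by omega))
    rw [e, brF_mul_mul_brF p (mem' hm)]
    refine range_cupMap_mul p h ?_ (brF_mul_mem_range_cupMap p h hm)
    have hX : brF p n * (brG p n 2 * brG p n 3 * brI p n 1 * brI p n 2) * brF p n ∈
        (cupMap p h).range := by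
      have := cupMap_brF p h (by omega)
      exact ⟨_, this⟩
    have e1 : brF p n * (brG p n 2 * brI p n 1 * brI p n 2) * brF p n ∈ (cupMap p h).range := by
      rw [← brI_brI_brG p le_rfl (by omega), mul_assoc, mul_assoc _ (brG p n 1), brG_one_mul_brF,
        mul_assoc (brI p n 1), ← mul_assoc (brF p n), brF_mul_brI_one, mul_smul_comm,
        mul_smul_comm, smul_mul_assoc, ← mul_assoc, brF_brI_two_brF p (by omega)]
      exact Submodule.smul_mem _ _ (Submodule.smul_mem _ _ (Submodule.smul_mem _ _ hf))
    have e2 : brF p n * (brI p n 3 * brI p n 1 * brI p n 2) * brF p n ∈ (cupMap p h).range := by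
      have c3 := brF_brI_far p n (le_refl 3)
      rw [mul_assoc (brI p n 3), ← mul_assoc (brF p n), c3.eq, mul_assoc (brI p n 3),
        ← mul_assoc (brF p n), brF_mul_brI_one, smul_mul_assoc, mul_smul_comm, smul_mul_assoc,
        mul_assoc, brF_brI_two_brF p (by omega), mul_smul_comm, ← c3.eq]
      exact Submodule.smul_mem _ _ (Submodule.smul_mem _ _ (brF_mul_mem_range_cupMap p h
        (brI_mem p le_rfl (by omega))))
    -- The first two inverse letters are rewritten as positive ones. The leading term is then f T f,
    -- the image of f under cup insertion, and the corrections contain only one g₂-type letter or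
    -- are reduced to one by a braid move.
    have e3 : brF p n * (brI p n 2 * brI p n 3 * brI p n 1 * brI p n 2) * brF p n =
        ((p.q⁻¹ : Rˣ) : R) • (((p.q⁻¹ : Rˣ) : R) •
          (brF p n * (brG p n 2 * brG p n 3 * brI p n 1 * brI p n 2) * brF p n) +
          (((p.q⁻¹ : Rˣ) : R) - 1) •
            (brF p n * (brG p n 2 * brI p n 1 * brI p n 2) * brF p n)) +
        (((p.q⁻¹ : Rˣ) : R) - 1) •
          (brF p n * (brI p n 3 * brI p n 1 * brI p n 2) * brF p n) := by
      simp only [brI_eq p n 2, brI_eq p n 3, add_mul, mul_add, smul_mul_assoc, mul_smul_comm,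
        one_mul, mul_one]
      module
    rw [e3]
    exact add_mem (Submodule.smul_mem _ _ (add_mem (Submodule.smul_mem _ _ hX)
      (Submodule.smul_mem _ _ e1))) (Submodule.smul_mem _ _ e2)

theorem brF_rVal_brF_mem (h : m + 2 ≤ n) {b : ℕ} (hb : b ≤ m + 2) (y : RIdx 1 b) :
    brF p n * rVal (brG p n) (brI p n) y * brF p n ∈ (cupMap p h).range := by
  induction b with
  | zero => cases y
  | succ b ih =>
    cases y with
    | keep y => exact ih (by omega) y
    | cup y j =>
      rename_i s
      cases y
      obtain ⟨j, hj⟩ := j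
      simp only [rVal, mul_zero, Nat.sub_zero, mul_one, zero_add]
      -- The descending product cancels the tail of the second inverse chain, leaving only its first
      -- j letters.
      have e := upProd_brI_mul_downProd p (n := n) (a := 1) (j := j) (l := s - j) le_rfl
        (by omega)
      rw [show j + (s - j) = s by omega, add_comm 1 j] at e
      rw [mul_assoc (upProd _ 2 _), e]
      exact brF_chain_brF_mem p h (by omega) (by omega)

theorem brF_mul_hecke_mul_brF {x : QBr p (m + 2)} (hx : x ∈ heckeSub p (m + 2)) :
    brF p (m + 2) * x * brF p (m + 2) ∈ (cupMap p (le_refl (m + 2))).range := by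
  have h := eBar_mul_heckeInt p (k := 1) (b := m + 2) (by omega) le_rfl hx
  rw [eBar_one] at h
  generalize brF p (m + 2) * x = w at h
  induction h using Submodule.span_induction with
  | zero => simp
  | add y z _ _ hy hz => rw [add_mul]; exact add_mem hy hz
  | smul c y _ hy => rw [smul_mul_assoc]; exact Submodule.smul_mem _ c hy
  | mem z hz =>
    obtain ⟨h, hh, y, rfl⟩ := hz
    have c := brF_commute_heckeInt p (by omega) hh
    rw [mul_assoc]
    have : h * (brF p (m + 2) * rVal (brG p (m + 2)) (brI p (m + 2)) y * brF p (m + 2)) =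
        (brF p (m + 2) * h) *
          (brF p (m + 2) * rVal (brG p (m + 2)) (brI p (m + 2)) y * brF p (m + 2)) := by
      rw [c.eq]
      simp only [mul_assoc]
      rw [← mul_assoc (brF p (m + 2)) (brF p (m + 2)), (brF_idem p _).eq]
    rw [this]
    exact range_cupMap_mul p _ (brF_mul_mem_range_cupMap p _ hh)
      (brF_rVal_brF_mem p le_rfl le_rfl y)

theorem mem_heckeSub_of_heckeInt {a b : ℕ} (ha : 1 ≤ a) (hb : b ≤ n) {x : QBr p n}
    (hx : x ∈ heckeInt p n a b) : x ∈ heckeSub p n := heckeInt_mono p ha hb hx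

/-- The algebra is spanned by the elements `a ē_(k) b` with `a` and `b` in the Hecke algebra. -/
theorem mem_span_hecke_eBar_hecke (x : QBr p n) : x ∈ Submodule.span R {z : QBr p n |
    ∃ k a b, 2 * k ≤ n ∧ a ∈ heckeSub p n ∧ b ∈ heckeSub p n ∧ z = a * eBar p n k * b} := by
  induction n using Nat.strong_induction_on with
  | _ n ih =>
    set W := Submodule.span R {z : QBr p n |
      ∃ k a b, 2 * k ≤ n ∧ a ∈ heckeSub p n ∧ b ∈ heckeSub p n ∧ z = a * eBar p n k * b} with hW
    have hmul : ∀ u : QBr p n, (∀ k a b, 2 * k ≤ n → a ∈ heckeSub p n → b ∈ heckeSub p n →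
        u * (a * eBar p n k * b) ∈ W) → ∀ y ∈ W, u * y ∈ W := by
      intro u hu y hy
      induction hy using Submodule.span_induction with
      | zero => simp
      | add y z _ _ hy hz => rw [mul_add]; exact W.add_mem hy hz
      | smul c y _ hy => rw [mul_smul_comm]; exact W.smul_mem c hy
      | mem z hz =>
        obtain ⟨k, a, b, hk, ha, hb, rfl⟩ := hz
        exact hu k a b hk ha hb
    -- The span contains 1, so it is enough that it is a left ideal; left multiplication by g_i is
    -- immediate and only e requires work.
    suffices h : ∀ y ∈ W, x * y ∈ W by
      simpa using h 1 (Submodule.subset_span ⟨0, 1, 1, by omega, one_mem _, one_mem _, by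
        rw [eBar_zero, one_mul, one_mul]⟩)
    induction x using QBr.induction with
    | hc c =>
      intro y hy
      rw [← Algebra.smul_def]
      exact W.smul_mem c hy
    | hg i h1 h2 =>
      refine hmul _ fun k a b hk ha hb => Submodule.subset_span
        ⟨k, brG p n i * a, b, hk, mul_mem (brG_mem p h1 h2) ha, hb, by simp only [mul_assoc]⟩
    | he h =>
      obtain ⟨m, rfl⟩ := exists_add_two h
      refine hmul _ fun k a b hk ha hb => ?_
      rw [brE_eq_smul_brF, smul_mul_assoc]
      refine W.smul_mem _ ?_
      rcases k with _ | k
      · exact Submodule.subset_span ⟨1, 1, a * b, by omega, one_mem _,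
          mul_mem ha hb, by rw [eBar_zero, eBar_one, mul_one, one_mul]⟩
      -- ē_(k+1) absorbs f on its left, so f a f appears and comes from an element z of the algebra
      -- on two strands fewer. The product becomes the cup insertion of z ē_(k) times b, and the
      -- strong induction on strands expands z ē_(k).
      · obtain ⟨z, hz⟩ := brF_mul_hecke_mul_brF p ha
        have e : brF p (m + 2) * (a * eBar p (m + 2) (k + 1) * b) =
            cupMap p (le_refl (m + 2)) (z * eBar p m k) * b := by
          rw [cupMap_mul, hz, cupMap_eBar p le_rfl k (by omega)]
          conv_lhs => rw [← brF_mul_eBar_succ]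
          simp only [mul_assoc]
        rw [e]
        have h2 := ih m (by omega) (z * eBar p m k)
        generalize z * eBar p m k = w at h2
        induction h2 using Submodule.span_induction with
        | zero => simp
        | add y z _ _ hy hz => rw [map_add, add_mul]; exact W.add_mem hy hz
        | smul c y _ hy => rw [map_smul, smul_mul_assoc]; exact W.smul_mem c hy
        | mem z hz =>
          obtain ⟨j, a', b', hj, ha', hb', rfl⟩ := hz
          obtain ⟨a2, ha2, ea⟩ := cupMap_heckeInt p (le_refl (m + 2)) le_rfl le_rfl ha'
          obtain ⟨b2, hb2, eb⟩ := cupMap_heckeInt p (le_refl (m + 2)) le_rfl le_rfl hb'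
          refine Submodule.subset_span ⟨j + 1, a2, b2 * b, by omega,
            heckeInt_mono p (by omega) le_rfl ha2,
            mul_mem (heckeInt_mono p (by omega) le_rfl hb2) hb, ?_⟩
          rw [cupMap_mul, cupMap_mul, ea, eb, cupMap_eBar p le_rfl j hj,
            (brF_commute_heckeInt p (by omega) ha2).eq, mul_assoc a2, brF_mul_eBar_succ,
            mul_assoc a2, ← mul_assoc (eBar p _ _), eBar_succ_mul_brF p (by omega)]
          simp only [mul_assoc]
    | hadd x y hx hy => intro z hz; rw [add_mul]; exact W.add_mem (hx z hz) (hy z hz)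
    | hmul x y hx hy => intro z hz; rw [mul_assoc]; exact hx _ (hy _ hz)

theorem brF_mul_mul_brF_mem (x : QBr p (m + 2)) :
    brF p (m + 2) * x * brF p (m + 2) ∈ (cupMap p (le_refl (m + 2))).range := by
  have h := mem_span_hecke_eBar_hecke p x
  induction h using Submodule.span_induction with
  | zero => simp
  | add y z _ _ hy hz => rw [mul_add, add_mul]; exact add_mem hy hz
  | smul c y _ hy => rw [mul_smul_comm, smul_mul_assoc]; exact Submodule.smul_mem _ c hy
  | mem z hz =>
    obtain ⟨k, a, b, hk, ha, hb, rfl⟩ := hz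
    rcases k with _ | k
    · rw [eBar_zero, mul_one]
      exact brF_mul_hecke_mul_brF p (mul_mem ha hb)
    · have e : brF p (m + 2) * (a * eBar p (m + 2) (k + 1) * b) * brF p (m + 2) =
          (brF p (m + 2) * a * brF p (m + 2)) * eBar p (m + 2) (k + 1) *
            (brF p (m + 2) * b * brF p (m + 2)) := by
        calc _ = brF p (m + 2) * a * eBar p (m + 2) (k + 1) * (b * brF p (m + 2)) := by
              simp only [mul_assoc]
          _ = brF p (m + 2) * a * (brF p (m + 2) * (eBar p (m + 2) (k + 1) * brF p (m + 2))) *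
              (b * brF p (m + 2)) := by
              rw [eBar_succ_mul_brF p hk, brF_mul_eBar_succ]
          _ = _ := by simp only [mul_assoc]
      rw [e]
      exact range_cupMap_mul p _ (range_cupMap_mul p _ (brF_mul_hecke_mul_brF p ha)
        ⟨_, cupMap_eBar p le_rfl k (by omega)⟩) (brF_mul_hecke_mul_brF p hb)

/-- The iterated inclusion of `Br_m` into `Br_{m+2k}`, with image the corner of `ē_(k)`. -/
def cupPow : (k : ℕ) → {m n : ℕ} → m + 2 * k = n → QBr p m →ₗ[R] QBr p n
  | 0, _, _, h => h ▸ LinearMap.id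
  | k + 1, _, n, h => (cupMap p (show n - 2 + 2 ≤ n by omega)).comp
      (cupPow k (show _ + 2 * k = n - 2 by omega))

theorem cupPow_zero (h : m + 2 * 0 = m) (x : QBr p m) : cupPow p 0 h x = x := rfl

theorem cupPow_succ {k : ℕ} (h : m + 2 * (k + 1) = n + 2) (x : QBr p m) :
    cupPow p (k + 1) h x =
      cupMap p (le_refl (n + 2)) (cupPow p k (show m + 2 * k = n by omega) x) := rfl

theorem cupPow_one_arg {k : ℕ} (h : m + 2 * k = n) : cupPow p k h 1 = eBar p n k := by
  induction k generalizing n with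
  | zero => obtain rfl : m = n := h; rw [cupPow_zero, eBar_zero]
  | succ k ih =>
    obtain ⟨n, rfl⟩ := exists_add_two (show 2 ≤ n by omega)
    rw [cupPow_succ, ih, cupMap_eBar p le_rfl k (by omega)]

theorem cupPow_mul {k : ℕ} (h : m + 2 * k = n) (x y : QBr p m) :
    cupPow p k h (x * y) = cupPow p k h x * cupPow p k h y := by
  induction k generalizing n with
  | zero => obtain rfl : m = n := h; rfl
  | succ k ih =>
    obtain ⟨n, rfl⟩ := exists_add_two (show 2 ≤ n by omega)
    rw [cupPow_succ, ih, cupMap_mul, ← cupPow_succ p h, ← cupPow_succ p h]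

theorem cupPow_brG {k : ℕ} (h : m + 2 * k = n) {i : ℕ} (h1 : 1 ≤ i) (h2 : i < m) :
    cupPow p k h (brG p m i) = eBar p n k * brG p n (i + 2 * k) := by
  induction k generalizing n with
  | zero => obtain rfl : m = n := h; rw [cupPow_zero, eBar_zero, one_mul]; rfl
  | succ k ih =>
    obtain ⟨n, rfl⟩ := exists_add_two (show 2 ≤ n by omega)
    rw [cupPow_succ, ih, cupMap_mul, cupMap_eBar p le_rfl k (by omega),
      cupMap_brG p le_rfl (by omega) (by omega), ← mul_assoc, eBar_succ_mul_brF p (by omega)]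
    rfl

theorem cupPow_eBar {k j : ℕ} (h : m + 2 * k = n) (hj : 2 * j ≤ m) :
    cupPow p k h (eBar p m j) = eBar p n (j + k) := by
  induction k generalizing n with
  | zero => obtain rfl : m = n := h; rfl
  | succ k ih =>
    obtain ⟨n, rfl⟩ := exists_add_two (show 2 ≤ n by omega)
    rw [cupPow_succ, ih, cupMap_eBar p le_rfl _ (by omega)]
    rfl

/-- Compressing by f and then by the remaining cups peels off two strands at a time. This is the
half of the bijectivity of Ψ_k that needs no faithfulness argument. -/
theorem eBar_mul_mul_eBar_mem {k : ℕ} (h : m + 2 * k = n) (x : QBr p n) :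
    ∃ z, cupPow p k h z = eBar p n k * x * eBar p n k := by
  induction k generalizing n with
  | zero =>
    obtain rfl : m = n := h
    exact ⟨x, by rw [cupPow_zero, eBar_zero, one_mul, mul_one]⟩
  | succ k ih =>
    obtain ⟨n, rfl⟩ := exists_add_two (show 2 ≤ n by omega)
    obtain ⟨y, hy⟩ := brF_mul_mul_brF_mem p x
    obtain ⟨z, hz⟩ := ih (n := n) (by omega) y
    refine ⟨z, ?_⟩
    rw [cupPow_succ, hz, cupMap_mul, cupMap_mul, hy, cupMap_eBar p le_rfl k (by omega)]
    calc _ = (eBar p (n + 2) (k + 1) * brF p (n + 2)) * x *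
          (brF p (n + 2) * eBar p (n + 2) (k + 1)) := by simp only [mul_assoc]
      _ = _ := by rw [eBar_succ_mul_brF p (by omega), brF_mul_eBar_succ]

theorem eBar_mul_cupPow {k : ℕ} (h : m + 2 * k = n) (x : QBr p m) :
    eBar p n k * cupPow p k h x = cupPow p k h x := by
  rw [← cupPow_one_arg p h, ← cupPow_mul, one_mul]

theorem cupPow_mul_eBar {k : ℕ} (h : m + 2 * k = n) (x : QBr p m) :
    cupPow p k h x * eBar p n k = cupPow p k h x := by
  rw [← cupPow_one_arg p h, ← cupPow_mul, mul_one]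

end Corners

end


noncomputable section

/-! ### Adding a strand on the right -/

section Inclusion

variable {R : Type*} [CommRing R] (p : BrParam R) {m n : ℕ}

theorem brIncl_brG {i : ℕ} (h1 : 1 ≤ i) (h2 : i < n) :
    brIncl p n (brG p n i) = brG p (n + 1) i := by
  rw [brIncl, brG, RingQuot.liftAlgHom_mkAlgHom_apply, lift_freeG p n i h1 h2]

theorem brIncl_brE (h : 2 ≤ n) : brIncl p n (brE p n) = brE p (n + 1) := by
  rw [brIncl, brE, RingQuot.liftAlgHom_mkAlgHom_apply, lift_freeE p n h]

theorem brIncl_brF (h : 2 ≤ n) : brIncl p n (brF p n) = brF p (n + 1) := by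
  rw [brF, map_smul, brIncl_brE p h, brF]

theorem brIncl_brI {i : ℕ} (h1 : 1 ≤ i) (h2 : i < n) :
    brIncl p n (brI p n i) = brI p (n + 1) i := by
  rw [brI, lift_heckeInv, brIncl_brG p h1 h2, brI]

theorem brIncl_upProd_brG {a l : ℕ} (ha : 1 ≤ a) (hl : a + l ≤ n) :
    brIncl p n (upProd (brG p n) a l) = upProd (brG p (n + 1)) a l := by
  rw [map_upProd]
  exact upProd_congr fun i h1 h2 => brIncl_brG p (by omega) (by omega)

theorem brIncl_upProd_brI {a l : ℕ} (ha : 1 ≤ a) (hl : a + l ≤ n) :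
    brIncl p n (upProd (brI p n) a l) = upProd (brI p (n + 1)) a l := by
  rw [map_upProd]
  exact upProd_congr fun i h1 h2 => brIncl_brI p (by omega) (by omega)

theorem brIncl_brX (h : 4 ≤ n) : brIncl p n (brX p n) = brX p (n + 1) := by
  simp only [brX, brT, map_mul]
  rw [brIncl_brF p (by omega), brIncl_brG p (by omega) (by omega),
    brIncl_brG p (by omega) (by omega), brIncl_brI p (by omega) (by omega),
    brIncl_brI p (by omega) (by omega)]

theorem brIncl_eBar {k : ℕ} (hk : 2 * k ≤ n) : brIncl p n (eBar p n k) = eBar p (n + 1) k := by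
  induction k with
  | zero => rw [eBar_zero, eBar_zero, map_one]
  | succ k ih =>
    rcases k with _ | k
    · rw [eBar_one, eBar_one, brIncl_brF p (by omega)]
    · rw [eBar_succ_succ, map_mul, map_mul, map_mul, ih (by omega), brIncl_brF p (by omega),
        brIncl_upProd_brG p (by omega) (by omega), brIncl_upProd_brI p (by omega) (by omega),
        eBar_succ_succ]

theorem brIncl_cupMap (h : m + 2 ≤ n) (x : QBr p m) :
    brIncl p n (cupMap p h x) =
      cupMap p (show m + 1 + 2 ≤ n + 1 by omega) (brIncl p m x) := by
  induction x using QBr.induction with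
  | hc c =>
    rw [Algebra.algebraMap_eq_smul_one, map_smul, map_smul, map_smul, map_smul, cupMap_one,
      map_one, cupMap_one, brIncl_brF p (by omega)]
  | hg i h1 h2 =>
    rw [cupMap_brG p h h1 h2, map_mul, brIncl_brF p (by omega), brIncl_brG p (by omega) (by omega),
      brIncl_brG p h1 h2, cupMap_brG p _ h1 (by omega)]
  | he h2 =>
    rw [cupMap_brE p h h2, map_smul, brIncl_brX p (by omega), brIncl_brE p h2,
      cupMap_brE p _ (by omega)]
  | hadd x y hx hy => simp only [map_add, hx, hy]
  | hmul x y hx hy => rw [cupMap_mul, map_mul, map_mul, hx, hy, cupMap_mul]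

theorem brIncl_mem {a b : ℕ} (ha : 1 ≤ a) (hb : b ≤ n) {x : QBr p n}
    (hx : x ∈ heckeInt p n a b) : brIncl p n x ∈ heckeInt p (n + 1) a b := by
  induction hx using Algebra.adjoin_induction with
  | mem x hx =>
    obtain ⟨i, h1, h2, rfl⟩ := hx
    rw [brIncl_brG p (by omega) (by omega)]
    exact brG_mem p h1 h2
  | algebraMap c => rw [AlgHom.commutes]; exact Subalgebra.algebraMap_mem _ c
  | add x y _ _ hx hy => rw [map_add]; exact add_mem hx hy
  | mul x y _ _ hx hy => rw [map_mul]; exact mul_mem hx hy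

theorem exists_brIncl_eq {a b : ℕ} (ha : 1 ≤ a) (hb : b ≤ n) {x : QBr p (n + 1)}
    (hx : x ∈ heckeInt p (n + 1) a b) : ∃ y ∈ heckeInt p n a b, brIncl p n y = x := by
  induction hx using Algebra.adjoin_induction with
  | mem x hx =>
    obtain ⟨i, h1, h2, rfl⟩ := hx
    exact ⟨_, brG_mem p h1 h2, brIncl_brG p (by omega) (by omega)⟩
  | algebraMap c => exact ⟨_, Subalgebra.algebraMap_mem _ c, AlgHom.commutes _ c⟩
  | add x y _ _ hx hy =>
    obtain ⟨x, hx, rfl⟩ := hx; obtain ⟨y, hy, rfl⟩ := hy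
    exact ⟨x + y, add_mem hx hy, map_add _ _ _⟩
  | mul x y _ _ hx hy =>
    obtain ⟨x, hx, rfl⟩ := hx; obtain ⟨y, hy, rfl⟩ := hy
    exact ⟨x * y, mul_mem hx hy, map_mul _ _ _⟩

theorem QBr_eq_smul_one (hn : n ≤ 1) (x : QBr p n) : ∃ c : R, x = c • 1 := by
  induction x using QBr.induction with
  | hc c => exact ⟨c, Algebra.algebraMap_eq_smul_one c⟩
  | hg i h1 h2 => omega
  | he h => omega
  | hadd x y hx hy =>
    obtain ⟨c, rfl⟩ := hx; obtain ⟨d, rfl⟩ := hy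
    exact ⟨c + d, (add_smul c d 1).symm⟩
  | hmul x y hx hy =>
    obtain ⟨c, rfl⟩ := hx; obtain ⟨d, rfl⟩ := hy
    exact ⟨c * d, by rw [smul_mul_smul_comm, mul_one]⟩

end Inclusion

/-! ### Consequences of the Markov property -/

section Trace

variable {R : Type*} [CommRing R] (p : BrParam R) {M : Type*} [AddCommGroup M] [Module R M]

/-- Families of functionals, invariant under conjugation by the Hecke algebras, compatible with
inclusions, and with the Markov property. -/
structure MarkovFamily (T : ∀ n, QBr p n →ₗ[R] M) : Prop where
  incl : ∀ n x, T (n + 1) (brIncl p n x) = T n x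
  conj : ∀ n, ∀ h ∈ heckeSub p n, ∀ x, T n (h * x) = T n (x * h)
  markov : ∀ n, 1 ≤ n → ∀ x y, T (n + 1) (brIncl p n x * brG p (n + 1) n * brIncl p n y) =
    ((p.r * p.d⁻¹ : Rˣ) : R) • T n (x * y)
  cup : T 2 (brF p 2) = ((p.r * p.q⁻¹ * p.d⁻¹ * p.d⁻¹ : Rˣ) : R) • T 2 1

/-- The left side is ē_(k+2) with its only letter of top index, g_{2k+3}, deleted: this is what the
Markov property leaves behind. For one cup the mixed braid relation reduces it to f g₁⁻¹g₂⁻¹g₁ f;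
more cups follow by cup insertion. -/
theorem brF_chain_eBar {k n : ℕ} (hk : 2 * (k + 1) + 1 ≤ n) :
    brF p n * upProd (brG p n) 2 (2 * k + 1) * upProd (brI p n) 1 (2 * k + 2) *
      eBar p n (k + 1) = ((p.q⁻¹ * p.d⁻¹ : Rˣ) : R) • eBar p n (k + 1) := by
  induction k generalizing n with
  | zero =>
    rw [eBar_one, upProd_succ', upProd_zero, upProd_succ', upProd_succ', upProd_zero, mul_one,
      mul_one]
    calc _ = brF p n * (brG p n 2 * brI p n 1 * brI p n 2) * brF p n := by simp only [mul_assoc]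
      _ = brF p n * brI p n 1 * brI p n 2 * (brG p n 1 * brF p n) := by
        rw [← brI_brI_brG p le_rfl (by omega)]; simp only [mul_assoc]
      _ = _ := by
        rw [brG_one_mul_brF, brF_mul_brI_one, mul_smul_comm, smul_mul_assoc, smul_mul_assoc,
          smul_smul, Units.mul_inv, one_smul, brF_brI_two_brF p (by omega)]
  | succ k ih =>
    obtain ⟨m, rfl⟩ := exists_add_two (show 2 ≤ n by omega)
    have h : m + 2 ≤ m + 2 := le_rfl
    have cU : Commute (brF p (m + 2)) (upProd (brG p (m + 2)) 4 (2 * k + 1)) :=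
      Commute.upProd_right fun i h1 _ => brF_far p _ (by omega)
    have cI : Commute (brF p (m + 2)) (upProd (brI p (m + 2)) 3 (2 * k + 2)) :=
      Commute.upProd_right fun i h1 _ => brF_brI_far p _ (by omega)
    have c1 : Commute (brI p (m + 2) 1 * brI p (m + 2) 2)
        (upProd (brG p (m + 2)) 4 (2 * k + 1)) :=
      Commute.upProd_right fun i h1 _ =>
        (brI_brG_far p _ (by omega)).mul_left (brI_brG_far p _ (by omega))
    have e := congrArg (cupMap p h) (ih (n := m) (by omega))
    rw [map_smul, cupMap_mul, cupMap_mul, cupMap_mul, cupMap_eBar p h _ (by omega),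
      cupMap_brF p h (by omega), cupMap_upProd p h (f' := brG p (m + 2)),
      cupMap_upProd p h (f' := brI p (m + 2))] at e
    rotate_left
    · exact fun i h1 h2 => ⟨cupMap_brI p h (by omega) (by omega), brF_brI_far p _ (by omega)⟩
    · exact fun i h1 h2 => ⟨cupMap_brG p h (by omega) (by omega), brF_far p _ (by omega)⟩
    rw [← e]
    have eU : upProd (brG p (m + 2)) 2 (2 * (k + 1) + 1) = brG p (m + 2) 2 *
        (brG p (m + 2) 3 * upProd (brG p (m + 2)) 4 (2 * k + 1)) := by
      rw [show 2 * (k + 1) + 1 = 2 * k + 1 + 1 + 1 by omega, upProd_succ', upProd_succ']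
    have eI : upProd (brI p (m + 2)) 1 (2 * (k + 1) + 2) = brI p (m + 2) 1 *
        (brI p (m + 2) 2 * upProd (brI p (m + 2)) 3 (2 * k + 2)) := by
      rw [show 2 * (k + 1) + 2 = 2 * k + 2 + 1 + 1 by omega, upProd_succ', upProd_succ']
    rw [eU, eI]
    generalize upProd (brG p (m + 2)) 4 (2 * k + 1) = U at *
    generalize upProd (brI p (m + 2)) 3 (2 * k + 2) = I at *
    have cX : Commute (brF p (m + 2)) (U * I) := cU.mul_right cI
    symm
    calc _ = brX p (m + 2) * (brF p (m + 2) * U * (brF p (m + 2) * I)) *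
            eBar p (m + 2) (k + 1 + 1) := by simp only [mul_assoc]
      _ = brX p (m + 2) * brF p (m + 2) * (U * I) * eBar p (m + 2) (k + 1 + 1) := by
          rw [commute_idem_mul (brF_idem p _) cU]; simp only [mul_assoc]
      _ = brF p (m + 2) * brT p (m + 2) 0 * (brF p (m + 2) * (U * I)) *
            eBar p (m + 2) (k + 1 + 1) := by
          rw [brX_mul_brF, brX]; simp only [mul_assoc]
      _ = brF p (m + 2) * brT p (m + 2) 0 * (U * I) *
            (brF p (m + 2) * eBar p (m + 2) (k + 1 + 1)) := by
          rw [cX.eq]; simp only [mul_assoc]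
      _ = brF p (m + 2) * brG p (m + 2) 2 * brG p (m + 2) 3 *
            ((brI p (m + 2) 1 * brI p (m + 2) 2) * U) * I * eBar p (m + 2) (k + 1 + 1) := by
          rw [brF_mul_eBar_succ, brT]; simp only [mul_assoc, zero_add]
      _ = _ := by rw [c1.eq]; simp only [mul_assoc]

theorem hecke_eBar_cup {k : ℕ} {x : QBr p (2 * k + 2)} (hx : x ∈ heckeSub p (2 * k + 2)) :
    ∃ y ∈ heckeSub p (2 * k + 1), x * eBar p (2 * k + 2) (k + 1) =
      brIncl p (2 * k + 1) y * eBar p (2 * k + 2) (k + 1) := by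
  have hk : 2 * (k + 1) ≤ 2 * k + 2 := by omega
  obtain ⟨y, hy, e⟩ := eBar_mul_heckeInt_cup p hk (brRev_mem p hx)
  have e2 := congrArg (brRev p _) e
  rw [brRev_mul, brRev_mul, brRev_eBar p hk, brRev_brRev] at e2
  obtain ⟨z, hz, e3⟩ := exists_brIncl_eq p le_rfl le_rfl (brRev_mem p hy)
  exact ⟨z, hz, by rw [e2, e3]⟩

/-- Induction over the Hecke algebras along the steps `H_n ⊂ H_{n+1}` and
`H_{2k+1} → H_{2k+2} ē_(k+1)`. -/
theorem hecke_eBar_induction (Q : ∀ n, ℕ → Submodule R (QBr p n)) (h0 : 1 ∈ Q 0 0)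
    (hincl : ∀ n k, 2 * k ≤ n → ∀ h ∈ heckeSub p n, h ∈ Q n k → brIncl p n h ∈ Q (n + 1) k)
    (hmarkov : ∀ n k, 2 * k ≤ n → 1 ≤ n → ∀ u ∈ heckeSub p n, ∀ v ∈ heckeSub p n,
      u * v ∈ Q n k → brIncl p n u * brG p (n + 1) n * brIncl p n v ∈ Q (n + 1) k)
    (hcup : ∀ k, ∀ h ∈ heckeSub p (2 * k + 2), ∀ y ∈ heckeSub p (2 * k + 1),
      h * eBar p (2 * k + 2) (k + 1) = brIncl p (2 * k + 1) y * eBar p (2 * k + 2) (k + 1) →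
      y ∈ Q (2 * k + 1) k → h ∈ Q (2 * k + 2) (k + 1))
    {n k : ℕ} (hk : 2 * k ≤ n) {h : QBr p n} (hh : h ∈ heckeSub p n) : h ∈ Q n k := by
  induction n generalizing k with
  | zero =>
    obtain rfl : k = 0 := by omega
    obtain ⟨c, rfl⟩ := QBr_eq_smul_one p (by omega) h
    exact Submodule.smul_mem _ c h0
  | succ n ih =>
    rcases Nat.lt_or_ge n (2 * k) with h1 | h1
    · obtain ⟨k, rfl⟩ : ∃ k', k = k' + 1 := ⟨k - 1, by omega⟩
      obtain rfl : n = 2 * k + 1 := by omega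
      obtain ⟨y, hy, e⟩ := hecke_eBar_cup p hh
      exact hcup k h hh y hy e (ih (by omega) hy)
    · have hA : ∀ x ∈ heckeInt p (n + 1) 1 n, x ∈ Q (n + 1) k := by
        intro x hx
        obtain ⟨y, hy, rfl⟩ := exists_brIncl_eq p le_rfl le_rfl hx
        exact hincl n k h1 y hy (ih h1 hy)
      rcases Nat.eq_zero_or_pos n with rfl | hn
      · exact hA h (heckeInt_mono p le_rfl (by omega) (show h ∈ heckeInt p 1 1 0 from by
          obtain ⟨c, rfl⟩ := QBr_eq_smul_one p (by omega) h
          exact Subalgebra.smul_mem _ (one_mem _) c))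
      · refine heckeInt_succ_induction p le_rfl hn (by omega) hA (fun x hx y hy => ?_) hh
        obtain ⟨x, hx', rfl⟩ := exists_brIncl_eq p le_rfl le_rfl hx
        obtain ⟨y, hy', rfl⟩ := exists_brIncl_eq p le_rfl le_rfl hy
        exact hmarkov n k h1 hn x hx' y hy' (ih h1 (mul_mem hx' hy'))

namespace MarkovFamily

variable {p} {T : ∀ n, QBr p n →ₗ[R] M}

/-- The top generator g_{2k+1} occurs exactly once in ē_(k+1) if k ≥ 1. The Markov property removes
it with factor r d⁻¹, and `brF_chain_eBar` contributes q⁻¹d⁻¹. For k = 0 no such letter exists and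
the value is the normalisation `cup`. -/
theorem cup_step (hT : MarkovFamily p T) (k : ℕ) (x : QBr p (2 * k + 1)) :
    T (2 * k + 2) (brIncl p _ x * eBar p (2 * k + 2) (k + 1)) =
      ((p.r * p.q⁻¹ * p.d⁻¹ * p.d⁻¹ : Rˣ) : R) • T (2 * k + 1) (x * eBar p (2 * k + 1) k) := by
  rcases k with _ | k
  · obtain ⟨c, rfl⟩ := QBr_eq_smul_one p (by omega) x
    have e := hT.incl 1 1
    rw [map_one] at e
    simp only [zero_add, map_smul, map_one, smul_mul_assoc, one_mul, eBar_zero, eBar_one]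
    rw [← e, smul_comm, ← hT.cup]
  · have h1 : brIncl p (2 * (k + 1) + 1) x * eBar p (2 * (k + 1) + 2) (k + 1 + 1) =
        brIncl p (2 * (k + 1) + 1) (x * brF p _ * upProd (brG p _) 2 (2 * k + 1)) *
          brG p (2 * (k + 1) + 2) (2 * (k + 1) + 1) *
          brIncl p (2 * (k + 1) + 1) (upProd (brI p _) 1 (2 * k + 2) * eBar p _ (k + 1)) := by
      rw [eBar_succ_succ, map_mul, map_mul, map_mul, brIncl_brF p (by omega),
        brIncl_upProd_brG p (by omega) (by omega), brIncl_upProd_brI p (by omega) (by omega),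
        brIncl_eBar p (by omega), show 2 * k + 2 = 2 * k + 1 + 1 by omega,
        upProd_succ (brG p _), show 2 + (2 * k + 1) = 2 * (k + 1) + 1 by omega]
      simp only [mul_assoc]
    have h2 := brF_chain_eBar p (k := k) (n := 2 * (k + 1) + 1) (by omega)
    rw [h1]
    refine (hT.markov (2 * (k + 1) + 1) (by omega) _ _).trans ?_
    rw [show x * brF p _ * upProd (brG p (2 * (k + 1) + 1)) 2 (2 * k + 1) *
      (upProd (brI p (2 * (k + 1) + 1)) 1 (2 * k + 2) * eBar p _ (k + 1)) = x *
      (brF p _ * upProd (brG p _) 2 (2 * k + 1) * upProd (brI p _) 1 (2 * k + 2) *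
      eBar p _ (k + 1)) by simp only [mul_assoc], h2, mul_smul_comm, map_smul, smul_smul]
    congr 1
    push_cast
    ring

theorem one_eq (hT : MarkovFamily p T) (n : ℕ) : T n 1 = T 0 1 := by
  induction n with
  | zero => rfl
  | succ n ih => rw [← map_one (brIncl p n), hT.incl, ih]

/-- Values are multiples of the value at `1`. -/
theorem mem_span (hT : MarkovFamily p T) {n k : ℕ} (hk : 2 * k ≤ n) {h : QBr p n} (hh : h ∈ heckeSub p n) :
    T n (h * eBar p n k) ∈ Submodule.span R {T 0 1} := by
  suffices h : h ∈ (Submodule.span R {T 0 1}).comap ((T n).comp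
    (LinearMap.mulRight R (eBar p n k))) from h
  refine hecke_eBar_induction p (fun n k => (Submodule.span R {T 0 1}).comap ((T n).comp
    (LinearMap.mulRight R (eBar p n k)))) ?_ ?_ ?_ ?_ hk hh
  · change T 0 (1 * eBar p 0 0) ∈ Submodule.span R {T 0 1}
    rw [eBar_zero, mul_one]
    exact Submodule.mem_span_singleton_self _
  · intro n k hk h _ hQ
    change T (n + 1) (brIncl p n h * eBar p (n + 1) k) ∈ Submodule.span R {T 0 1}
    rw [← brIncl_eBar p hk, ← map_mul, hT.incl]
    exact hQ
  · intro n k hk hn u _ v _ hQ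
    change T (n + 1) (brIncl p n u * brG p (n + 1) n * brIncl p n v * eBar p (n + 1) k) ∈ Submodule.span R {T 0 1}
    rw [← brIncl_eBar p hk, mul_assoc _ (brIncl p n v), ← map_mul, hT.markov n hn, ← mul_assoc]
    exact Submodule.smul_mem _ _ hQ
  · intro k h _ y _ e hQ
    change T _ (h * eBar p (2 * k + 2) (k + 1)) ∈ Submodule.span R {T 0 1}
    rw [e, hT.cup_step]
    exact Submodule.smul_mem _ _ hQ

theorem apply_mem_span (hT : MarkovFamily p T) {n : ℕ} (x : QBr p n) : T n x ∈ Submodule.span R {T 0 1} := by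
  have h := mem_span_hecke_eBar_hecke p x
  induction h using Submodule.span_induction with
  | zero => simp
  | add y z _ _ hy hz => rw [map_add]; exact add_mem hy hz
  | smul c y _ hy => rw [map_smul]; exact Submodule.smul_mem _ c hy
  | mem z hz =>
    obtain ⟨k, a, b, hk, ha, hb, rfl⟩ := hz
    rw [← hT.conj n b hb, ← mul_assoc]
    exact hT.mem_span hk (mul_mem hb ha)

/-- Invariance is assumed only under Hecke elements, so moving ē_(k) around is not automatic. When
strands lie to the right of the cups, inclusion and the Markov property carry the statement from n
to n+1; when the cups use all points, it drops to 2k+1 strands. -/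
theorem eBar_conj (hT : MarkovFamily p T) {n k : ℕ} (hk : 2 * k ≤ n) {h : QBr p n} (hh : h ∈ heckeSub p n) :
    T n (h * eBar p n k) = T n (eBar p n k * h * eBar p n k) := by
  let Q : ∀ n, ℕ → Submodule R (QBr p n) := fun n k => LinearMap.eqLocus
    ((T n).comp (LinearMap.mulRight R (eBar p n k)))
    ((T n).comp ((LinearMap.mulRight R (eBar p n k)).comp (LinearMap.mulLeft R (eBar p n k))))
  refine hecke_eBar_induction p Q ?_ ?_ ?_ ?_ hk hh
  · change T 0 (1 * eBar p 0 0) = T 0 (eBar p 0 0 * 1 * eBar p 0 0)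
    rw [eBar_zero]
    simp only [mul_one]
  · intro n k hk h _ hQ
    change T (n + 1) (brIncl p n h * eBar p (n + 1) k) =
      T (n + 1) (eBar p (n + 1) k * brIncl p n h * eBar p (n + 1) k)
    rw [← brIncl_eBar p hk, ← map_mul, ← map_mul, ← map_mul, hT.incl, hT.incl]
    exact hQ
  · intro n k hk hn u _ v _ hQ
    change T (n + 1) (brIncl p n u * brG p (n + 1) n * brIncl p n v * eBar p (n + 1) k) =
      T (n + 1) (eBar p (n + 1) k * (brIncl p n u * brG p (n + 1) n * brIncl p n v) *
        eBar p (n + 1) k)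
    have e1 : brIncl p n (eBar p n k) * (brIncl p n u * brG p (n + 1) n * brIncl p n v) *
        brIncl p n (eBar p n k) =
        brIncl p n (eBar p n k * u) * brG p (n + 1) n * brIncl p n (v * eBar p n k) := by
      simp only [map_mul, mul_assoc]
    have e2 : eBar p n k * u * (v * eBar p n k) = eBar p n k * (u * v) * eBar p n k := by
      simp only [mul_assoc]
    rw [← brIncl_eBar p hk, e1, mul_assoc _ (brIncl p n v), ← map_mul, hT.markov n hn,
      ← mul_assoc, hT.markov n hn, e2]
    exact congrArg _ hQ
  · intro k h _ y hy e hQ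
    change T _ (h * eBar p (2 * k + 2) (k + 1)) =
      T _ (eBar p (2 * k + 2) (k + 1) * h * eBar p (2 * k + 2) (k + 1))
    change T _ (y * eBar p (2 * k + 1) k) = T _ (eBar p (2 * k + 1) k * y * eBar p (2 * k + 1) k) at hQ
    -- On 2k+1 strands the corner of ē_(k) comes from a single strand and hence consists of scalar
    -- multiples of ē_(k).
    obtain ⟨z, hz⟩ := eBar_mul_mul_eBar_mem p (m := 1) (k := k) (n := 2 * k + 1) (by omega) y
    obtain ⟨c, rfl⟩ := QBr_eq_smul_one p le_rfl z
    rw [map_smul, cupPow_one_arg] at hz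
    have e1 : brIncl p _ (eBar p (2 * k + 1) k) = eBar p (2 * k + 2) k := brIncl_eBar p (by omega)
    have e2 : eBar p (2 * k + 2) (k + 1) * brIncl p _ y * eBar p (2 * k + 2) (k + 1) =
        c • eBar p (2 * k + 2) (k + 1) := by
      rw [← eBar_mul_eBar p (show k ≤ k + 1 by omega) (by omega)]
      conv_lhs => enter [2]; rw [eBar_mul_eBar p (show k ≤ k + 1 by omega) (by omega),
        ← eBar_mul_eBar' p (show k ≤ k + 1 by omega) (by omega)]
      have e3 := congrArg (brIncl p _) hz
      rw [map_smul, map_mul, map_mul, e1] at e3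
      calc _ = eBar p (2 * k + 2) (k + 1) * (eBar p (2 * k + 2) k * brIncl p _ y *
            eBar p (2 * k + 2) k) * eBar p (2 * k + 2) (k + 1) := by simp only [mul_assoc]
        _ = _ := by
          rw [← e3, mul_smul_comm, smul_mul_assoc, eBar_mul_eBar p (by omega) (by omega),
            (eBar_idem p (by omega)).eq]
    rw [mul_assoc, e, ← mul_assoc, e2, hT.cup_step, hQ, ← hz, map_smul, map_smul, smul_comm]
    congr 1
    have := hT.cup_step k 1
    rw [map_one, one_mul, one_mul] at this
    exact this.symm

/-- Cup insertion on the left commutes with adding a strand on the right and turns g_n into f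
g_{n+2}. Each reduction step on n strands is thus matched by the same step on n+2 strands, and the
factor comes from the empty diagram. -/
theorem cupMap_apply_hecke (hT : MarkovFamily p T) {n k : ℕ} (hk : 2 * k ≤ n) {h : QBr p n} (hh : h ∈ heckeSub p n) :
    T (n + 2) (cupMap p le_rfl (h * eBar p n k)) =
      ((p.r * p.q⁻¹ * p.d⁻¹ * p.d⁻¹ : Rˣ) : R) • T n (h * eBar p n k) := by
  let Q : ∀ n, ℕ → Submodule R (QBr p n) := fun n k => LinearMap.eqLocus
    ((T (n + 2)).comp ((cupMap p le_rfl).comp (LinearMap.mulRight R (eBar p n k))))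
    (((p.r * p.q⁻¹ * p.d⁻¹ * p.d⁻¹ : Rˣ) : R) •
      (T n).comp (LinearMap.mulRight R (eBar p n k)))
  refine hecke_eBar_induction p Q ?_ ?_ ?_ ?_ hk hh
  · change T 2 (cupMap p le_rfl (1 * eBar p 0 0)) =
      ((p.r * p.q⁻¹ * p.d⁻¹ * p.d⁻¹ : Rˣ) : R) • T 0 (1 * eBar p 0 0)
    rw [eBar_zero, one_mul, cupMap_one, hT.cup, hT.one_eq]
  · intro n k hk h _ hQ
    change T (n + 1 + 2) (cupMap p le_rfl (brIncl p n h * eBar p (n + 1) k)) =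
      ((p.r * p.q⁻¹ * p.d⁻¹ * p.d⁻¹ : Rˣ) : R) • T (n + 1) (brIncl p n h * eBar p (n + 1) k)
    rw [← brIncl_eBar p hk, ← map_mul, hT.incl]
    exact ((congrArg (T _) (brIncl_cupMap p (le_refl (n + 2)) _).symm).trans
      (hT.incl (n + 2) _)).trans hQ
  · intro n k hk hn u hu v _ hQ
    change T (n + 1 + 2) (cupMap p le_rfl
        (brIncl p n u * brG p (n + 1) n * brIncl p n v * eBar p (n + 1) k)) =
      ((p.r * p.q⁻¹ * p.d⁻¹ * p.d⁻¹ : Rˣ) : R) • T (n + 1) (brIncl p n u * brG p (n + 1) n * brIncl p n v * eBar p (n + 1) k)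
    rw [← brIncl_eBar p hk, mul_assoc _ (brIncl p n v), ← map_mul, hT.markov n hn, ← mul_assoc,
      smul_comm]
    have e0 : ∀ x, cupMap p (le_refl (n + 1 + 2)) (brIncl p n x) =
      brIncl p (n + 2) (cupMap p le_rfl x) := fun x => (brIncl_cupMap p le_rfl x).symm
    have e1 : cupMap p (le_refl (n + 1 + 2))
        (brIncl p n u * brG p (n + 1) n * brIncl p n (v * eBar p n k)) =
        brIncl p (n + 2) (cupMap p le_rfl u) * brG p (n + 2 + 1) (n + 2) *
          brIncl p (n + 2) (cupMap p le_rfl (v * eBar p n k)) := by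
      rw [cupMap_mul, cupMap_mul, cupMap_brG p _ hn (by omega), ← mul_assoc, cupMap_mul_brF, e0,
        e0]
    rw [e1]
    refine (hT.markov (n + 2) (by omega) _ _).trans (congrArg _ ?_)
    rw [← cupMap_mul, ← mul_assoc]
    exact hQ
  · intro k h _ y hy e hQ
    change T _ (cupMap p le_rfl (h * eBar p (2 * k + 2) (k + 1))) =
      ((p.r * p.q⁻¹ * p.d⁻¹ * p.d⁻¹ : Rˣ) : R) • T _ (h * eBar p (2 * k + 2) (k + 1))
    change T _ (cupMap p le_rfl (y * eBar p (2 * k + 1) k)) =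
      ((p.r * p.q⁻¹ * p.d⁻¹ * p.d⁻¹ : Rˣ) : R) • T _ (y * eBar p (2 * k + 1) k) at hQ
    rw [e, hT.cup_step, ← hQ, cupMap_mul, cupMap_mul, cupMap_eBar p le_rfl _ (by omega),
      cupMap_eBar p le_rfl _ (by omega)]
    exact (congrArg (fun z => T _ (z * _)) (brIncl_cupMap p le_rfl y).symm).trans
      (hT.cup_step (k + 1) _)

theorem cupMap_apply (hT : MarkovFamily p T) {n : ℕ} (x : QBr p n) : T (n + 2) (cupMap p le_rfl x) =
    ((p.r * p.q⁻¹ * p.d⁻¹ * p.d⁻¹ : Rˣ) : R) • T n x := by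
  have h := mem_span_hecke_eBar_hecke p x
  induction h using Submodule.span_induction with
  | zero => simp
  | add y z _ _ hy hz => simp only [map_add, smul_add, hy, hz]
  | smul c y _ hy => rw [map_smul, map_smul, map_smul, hy, smul_comm]
  | mem z hz =>
    obtain ⟨k, a, b, hk, ha, hb, rfl⟩ := hz
    rw [← hT.conj n b hb, ← mul_assoc, ← hT.cupMap_apply_hecke hk (mul_mem hb ha)]
    obtain ⟨b', hb', e⟩ := cupMap_heckeInt p (le_refl (n + 2)) le_rfl le_rfl hb
    have c := brF_commute_heckeInt p (by omega) hb'
    -- Cup insertion turns b into f b' with b' in the larger Hecke algebra and commuting with f, so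
    -- Hecke invariance there moves b' to the other side.
    rw [mul_assoc b, cupMap_mul p _ b, e, c.eq, mul_assoc b', brF_mul_cupMap,
      hT.conj _ _ (mem_heckeSub_of_heckeInt p (by omega) le_rfl hb'), cupMap_mul p _ _ b, e,
      ← mul_assoc, cupMap_mul_brF]

theorem cupPow_apply (hT : MarkovFamily p T) {m n k : ℕ} (h : m + 2 * k = n) (x : QBr p m) : T n (cupPow p k h x) =
    (((p.r * p.q⁻¹ * p.d⁻¹ * p.d⁻¹) ^ k : Rˣ) : R) • T m x := by
  induction k generalizing n with
  | zero =>
    obtain rfl : m = n := h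
    rw [cupPow_zero, pow_zero, Units.val_one, one_smul]
  | succ k ih =>
    obtain ⟨n, rfl⟩ := exists_add_two (show 2 ≤ n by omega)
    rw [cupPow_succ, hT.cupMap_apply, ih, smul_smul, ← Units.val_mul, pow_succ']

end MarkovFamily

end Trace

end


noncomputable section

/-! ### Extended traces: characterisation and uniqueness -/

section Uniqueness

variable {R : Type*} [CommRing R] (p : BrParam R)

/-- The iterated inclusion, as a map to the corner of `ē_(k)`. -/
def cupCorner {n k : ℕ} (hk : 2 * k ≤ n) : QBr p (n - 2 * k) →ₙₐ[R] corner p n k where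
  toFun z := ⟨cupPow p k (by omega) z, cupPow p k (by omega) z, by
    rw [eBar_mul_cupPow, cupPow_mul_eBar]⟩
  map_smul' c x := Subtype.ext (map_smul _ _ _)
  map_zero' := Subtype.ext (map_zero _)
  map_add' x y := Subtype.ext (map_add _ _ _)
  map_mul' x y := Subtype.ext (cupPow_mul p _ _ _)

theorem cupCorner_val {n k : ℕ} (hk : 2 * k ≤ n) (z : QBr p (n - 2 * k)) :
    (cupCorner p hk z : QBr p n) = cupPow p k (by omega) z := rfl

theorem cupCorner_surjective {n k : ℕ} (hk : 2 * k ≤ n) :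
    Function.Surjective (cupCorner p hk) := by
  rintro ⟨_, h, rfl⟩
  obtain ⟨z, hz⟩ := eBar_mul_mul_eBar_mem p (show n - 2 * k + 2 * k = n by omega) h
  exact ⟨z, Subtype.ext hz⟩

/-- The inverse of a bijective multiplicative linear map. -/
def nonUnitalInverse {A B : Type*} [NonUnitalNonAssocSemiring A] [NonUnitalNonAssocSemiring B]
    [Module R A] [Module R B] (f : A →ₙₐ[R] B) (hf : Function.Bijective f) : B →ₙₐ[R] A where
  toFun := (Equiv.ofBijective f hf).symm
  map_smul' c x := hf.1 (by simp [Equiv.ofBijective_apply_symm_apply])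
  map_zero' := hf.1 (by simp [Equiv.ofBijective_apply_symm_apply])
  map_add' x y := hf.1 (by simp [Equiv.ofBijective_apply_symm_apply])
  map_mul' x y := hf.1 (by simp [Equiv.ofBijective_apply_symm_apply])

theorem nonUnitalInverse_apply {A B : Type*} [NonUnitalNonAssocSemiring A]
    [NonUnitalNonAssocSemiring B] [Module R A] [Module R B] (f : A →ₙₐ[R] B)
    (hf : Function.Bijective f) (x : A) : nonUnitalInverse f hf (f x) = x :=
  Equiv.ofBijective_symm_apply_apply f hf x

theorem isPsi_nonUnitalInverse {n k : ℕ} (hk : 2 * k ≤ n)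
    (hf : Function.Bijective (cupCorner p hk)) :
    IsPsi p n k (nonUnitalInverse (cupCorner p hk) hf) where
  bijective := (Equiv.ofBijective _ hf).symm.bijective
  map_g i h1 h2 := ⟨cupCorner p hk (brG p (n - 2 * k) (i - 2 * k)), by
    rw [cupCorner_val, cupPow_brG p _ (by omega) (by omega), Nat.sub_add_cancel h1.le],
    nonUnitalInverse_apply _ hf _⟩
  map_e h := ⟨cupCorner p hk (eBar p (n - 2 * k) 1), by
    rw [cupCorner_val, cupPow_eBar p _ (by omega), add_comm], nonUnitalInverse_apply _ hf _⟩

theorem IsPsi.apply_cupCorner {n k : ℕ} (hk : 2 * k ≤ n) {Ψ : corner p n k →ₙₐ[R] QBr p (n - 2 * k)}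
    (hΨ : IsPsi p n k Ψ) (z : QBr p (n - 2 * k)) : Ψ (cupCorner p hk z) = z := by
  -- Ψ is not assumed unital. Surjectivity provides an x with Ψ x = 1, and the unit of the corner
  -- fixes x, so its image is 1.
  have h1 : Ψ (cupCorner p hk 1) = 1 := by
    obtain ⟨x, hx⟩ := hΨ.bijective.2 1
    have e : cupCorner p hk 1 * x = x := by
      obtain ⟨z, rfl⟩ := cupCorner_surjective p hk x
      rw [← map_mul, one_mul]
    have := congrArg Ψ e
    rwa [map_mul, hx, mul_one] at this
  induction z using QBr.induction with
  | hc c => rw [Algebra.algebraMap_eq_smul_one, map_smul, map_smul, h1]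
  | hg i h2 h3 =>
    obtain ⟨x, hx, hx'⟩ := hΨ.map_g (i + 2 * k) (by omega) (by omega)
    rw [Nat.add_sub_cancel] at hx'
    refine Eq.trans (congrArg Ψ (Subtype.ext ?_)) hx'
    rw [hx, cupCorner_val, cupPow_brG p _ h2 h3]
  | he h2 =>
    obtain ⟨x, hx, hx'⟩ := hΨ.map_e (by omega)
    rw [eBar_one] at hx'
    rw [brE_eq_smul_brF, map_smul, map_smul]
    refine congrArg _ (Eq.trans (congrArg Ψ (Subtype.ext ?_)) hx')
    rw [hx, cupCorner_val, ← eBar_one, cupPow_eBar p _ (by omega), add_comm]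
  | hadd x y hx hy => rw [map_add, map_add, hx, hy]
  | hmul x y hx hy => rw [map_mul, map_mul, hx, hy]

/-- Injectivity is needed only to define Ψ_k, as the inverse of iterated cup insertion. The two
trace identities are then `eBar_conj` and `cupPow_apply`. -/
theorem MarkovFamily.isExtendedTrace {T : ∀ n, QBr p n →ₗ[R] R} (hT : MarkovFamily p T)
    (h1 : T 0 1 = 1) (hinj : ∀ m, Function.Injective (cupMap p (le_refl (m + 2)))) :
    IsExtendedTrace p T where
  map_one n := by rw [hT.one_eq, h1]
  hecke_trace n a ha b _ := hT.conj n a ha b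
  hecke_markov n hn h _ := by
    have := hT.markov n hn 1 h
    rwa [map_one, one_mul, one_mul, smul_eq_mul] at this
  extend n k _ hk := by
    have hpow : ∀ (k : ℕ) {m n : ℕ} (h : m + 2 * k = n),
        Function.Injective (cupPow p k h) := by
      intro k
      induction k with
      | zero => intro m n h; obtain rfl : m = n := h; exact fun x y h => h
      | succ k ih =>
        intro m n h
        obtain ⟨n, rfl⟩ := exists_add_two (show 2 ≤ n by omega)
        exact (hinj n).comp (ih (show m + 2 * k = n by omega))
    have hbij : Function.Bijective (cupCorner p hk) :=
      ⟨fun x y h => hpow k (show n - 2 * k + 2 * k = n by omega) (congrArg Subtype.val h),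
        cupCorner_surjective p hk⟩
    refine ⟨_, isPsi_nonUnitalInverse p hk hbij, fun a ha b hb => ⟨?_, ?_⟩⟩
    · rw [← hT.conj n b hb, ← mul_assoc, hT.eBar_conj hk (mul_mem hb ha)]
    · obtain ⟨z, hz⟩ := cupCorner_surjective p hk (toCorner p n k (b * a))
      rw [← hz, nonUnitalInverse_apply]
      exact (congrArg (fun y => T n y.1) hz.symm).trans
        (hT.cupPow_apply (show n - 2 * k + 2 * k = n by omega) z)

namespace IsExtendedTrace

variable {p} {tr tr' : ∀ n, QBr p n →ₗ[R] R}

/-- Compatibility with inclusions is not an axiom, and the Markov axiom concerns only the last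
generator. An element y with letters below i commutes with g_{i+1}, and g_{i+1}g_ig_{i+1}⁻¹ =
g_i⁻¹g_{i+1}g_i, so g_i y has the same trace as g_{i+1} g_i y g_i⁻¹. Repeating this reaches the last
generator, with C and C' collecting the conjugations. -/
theorem markov_conj (h : IsExtendedTrace p tr) {N i j : ℕ} (hj : 1 ≤ j) (hji : j ≤ i) (hi : i ≤ N)
    {x : QBr p N} (hx : x ∈ heckeInt p N 1 j) {C C' : QBr p N} (hC : C ∈ heckeInt p N 1 i)
    (hC' : C' ∈ heckeInt p N 1 i) (hCC : C' * C = 1) :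
    tr (N + 1) (brG p (N + 1) i * brIncl p N (C * x * C')) =
      ((p.r * p.d⁻¹ : Rˣ) : R) * tr N x := by
  obtain ⟨l, hl⟩ : ∃ l, i + l = N := ⟨N - i, by omega⟩
  induction l generalizing i C C' with
  | zero =>
    obtain rfl : i = N := hl
    have hx' := heckeInt_mono p le_rfl hji hx
    rw [h.hecke_markov i (by omega) _ (mul_mem (mul_mem hC hx') hC'), mul_assoc,
      h.hecke_trace i C hC _ (mul_mem hx' hC'), mul_assoc, hCC, mul_one]
  | succ l ih =>
    have hm : heckeInt p N 1 i ≤ heckeInt p N 1 (i + 1) := heckeInt_mono p le_rfl (by omega)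
    have hy : brIncl p N (C * x * C') ∈ heckeInt p (N + 1) 1 i := brIncl_mem p le_rfl hi
      (mul_mem (mul_mem hC (heckeInt_mono p le_rfl hji hx)) hC')
    have hyN := heckeInt_mono p le_rfl (show i ≤ N + 1 by omega) hy
    have hg : ∀ i, 1 ≤ i → i ≤ N → brG p (N + 1) i ∈ heckeSub p (N + 1) :=
      fun i h1 h2 => brG_mem p h1 (by omega)
    have hI : ∀ i, 1 ≤ i → i ≤ N → brI p (N + 1) i ∈ heckeSub p (N + 1) :=
      fun i h1 h2 => brI_mem p h1 (by omega)
    have c := brI_commute_heckeInt p (i := i + 1) (Or.inl (by omega)) hy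
    have hb : brG p (N + 1) (i + 1) * brG p (N + 1) i * brI p (N + 1) (i + 1) =
        brI p (N + 1) i * (brG p (N + 1) (i + 1) * brG p (N + 1) i) := by
      calc _ = brI p (N + 1) i * (brG p (N + 1) i * brG p (N + 1) (i + 1) * brG p (N + 1) i) *
            brI p (N + 1) (i + 1) := by
            simp only [← mul_assoc]
            rw [brI_mul_brG p (by omega) (by omega), one_mul]
        _ = _ := by
            rw [brG_braid]
            simp only [mul_assoc]
            rw [brG_mul_brI p (by omega) (by omega), mul_one]
    have e := ih (i := i + 1) (by omega) (by omega) (C := brG p N i * C) (C' := C' * brI p N i)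
      (mul_mem (brG_mem p (by omega) (by omega)) (hm hC))
      (mul_mem (hm hC') (brI_mem p (by omega) (by omega))) (by
        rw [mul_assoc, ← mul_assoc (brI p N i), brI_mul_brG p (by omega) (by omega), one_mul, hCC])
      (by omega)
    rw [← e]
    have e2 : brIncl p N (brG p N i * C * x * (C' * brI p N i)) =
        brG p (N + 1) i * brIncl p N (C * x * C') * brI p (N + 1) i := by
      simp only [map_mul]
      rw [brIncl_brG p (by omega) (by omega), brIncl_brI p (by omega) (by omega)]
      simp only [mul_assoc]
    rw [e2]
    generalize brIncl p N (C * x * C') = y at *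
    calc tr (N + 1) (brG p (N + 1) i * y) = tr (N + 1) (brI p (N + 1) (i + 1) *
          (brG p (N + 1) (i + 1) * (brG p (N + 1) i * y))) := by
          rw [← mul_assoc, brI_mul_brG p (by omega) (by omega), one_mul]
      _ = tr (N + 1) ((brG p (N + 1) (i + 1) * brG p (N + 1) i * brI p (N + 1) (i + 1)) * y) := by
          rw [h.hecke_trace _ _ (hI _ (by omega) (by omega)) _ (mul_mem (hg _ (by omega) (by omega))
            (mul_mem (hg _ (by omega) (by omega)) hyN))]
          simp only [mul_assoc]
          rw [c.eq]
      _ = tr (N + 1) (brI p (N + 1) i * (brG p (N + 1) (i + 1) * (brG p (N + 1) i * y))) := by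
          rw [hb]; simp only [mul_assoc]
      _ = _ := by
          rw [h.hecke_trace _ _ (hI _ (by omega) (by omega)) _ (mul_mem (hg _ (by omega) (by omega))
            (mul_mem (hg _ (by omega) (by omega)) hyN))]
          simp only [mul_assoc]

/-- The induction is on the parabolic bound j, with the number of strands free: removing one
generator lowers both. -/
theorem eq_on_heckeInt (h : IsExtendedTrace p tr) (h' : IsExtendedTrace p tr') {n j : ℕ}
    (hj : j ≤ n) {x : QBr p n} (hx : x ∈ heckeInt p n 1 j) : tr n x = tr' n x := by
  have h1 : ∀ n (x : QBr p n), (∃ c : R, x = c • 1) → tr n x = tr' n x := by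
    rintro n _ ⟨c, rfl⟩
    rw [map_smul, map_smul, h.map_one, h'.map_one]
  induction j generalizing n with
  | zero => exact h1 n x (heckeInt_self p (by omega) hx)
  | succ j ih =>
    rcases Nat.eq_zero_or_pos j with rfl | hj0
    · exact h1 n x (heckeInt_self p (by omega) hx)
    change x ∈ LinearMap.eqLocus (tr n) (tr' n)
    refine heckeInt_succ_induction p le_rfl hj0 (by omega) (fun x hx => ih (by omega) hx)
      (fun u hu v hv => ?_) hx
    obtain ⟨N, rfl⟩ : ∃ N, n = N + 1 := ⟨n - 1, by omega⟩
    have hu' := heckeInt_mono p le_rfl (show j ≤ N + 1 by omega) hu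
    have hg : brG p (N + 1) j * v ∈ heckeSub p (N + 1) :=
      mul_mem (brG_mem p (by omega) (by omega)) (heckeInt_mono p le_rfl (by omega) hv)
    obtain ⟨y, hy, e⟩ := exists_brIncl_eq p le_rfl (by omega) (mul_mem hv hu)
    have e1 := h.markov_conj hj0 le_rfl (by omega) hy (one_mem _) (one_mem _) (one_mul 1)
    have e2 := h'.markov_conj hj0 le_rfl (by omega) hy (one_mem _) (one_mem _) (one_mul 1)
    rw [one_mul, mul_one, e] at e1 e2
    change tr (N + 1) _ = tr' (N + 1) _
    rw [mul_assoc, h.hecke_trace _ _ hu' _ hg, h'.hecke_trace _ _ hu' _ hg, mul_assoc, e1, e2,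
      ih (by omega) hy]

/-- The two traces may come with different isomorphisms Ψ, but both invert cup insertion, so both
formulas reduce to the same element on n - 2k strands. -/
theorem unique (h : IsExtendedTrace p tr) (h' : IsExtendedTrace p tr') : tr = tr' := by
  funext n
  induction n using Nat.strong_induction_on with
  | _ n ih =>
    ext1 x
    have hx := mem_span_hecke_eBar_hecke p x
    induction hx using Submodule.span_induction with
    | zero => simp
    | add y z _ _ hy hz => simp only [map_add, hy, hz]
    | smul c y _ hy => simp only [map_smul, hy]
    | mem z hz =>
      obtain ⟨k, a, b, hk, ha, hb, rfl⟩ := hz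
      rcases Nat.eq_zero_or_pos k with rfl | hk0
      · rw [eBar_zero, mul_one]
        exact eq_on_heckeInt h h' le_rfl (mul_mem ha hb)
      · obtain ⟨Ψ, hΨ, e⟩ := h.extend n k hk0 hk
        obtain ⟨Ψ', hΨ', e'⟩ := h'.extend n k hk0 hk
        obtain ⟨z, hz⟩ := cupCorner_surjective p hk (toCorner p n k (b * a))
        rw [(e a ha b hb).1, (e a ha b hb).2, (e' a ha b hb).1, (e' a ha b hb).2, ← hz,
          hΨ.apply_cupCorner, hΨ'.apply_cupCorner, ih _ (by omega)]

end IsExtendedTrace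

theorem MarkovFamily.existsUnique {T : ∀ n, QBr p n →ₗ[R] R} (hT : MarkovFamily p T)
    (h1 : T 0 1 = 1) (hinj : ∀ m, Function.Injective (cupMap p (le_refl (m + 2)))) :
    (∃! tr : ∀ n : ℕ, QBr p n →ₗ[R] R, IsExtendedTrace p tr) ∧
    ∀ tr : ∀ n : ℕ, QBr p n →ₗ[R] R, IsExtendedTrace p tr →
      ∀ n : ℕ, 1 ≤ n → ∀ c : QBr p n,
        tr (n + 1) (brIncl p n c) = tr n c ∧
        tr (n + 1) (brIncl p n c * brG p (n + 1) n) = tr n c * tr (n + 1) (brG p (n + 1) n) := by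
  have hE := hT.isExtendedTrace p h1 hinj
  refine ⟨⟨T, hE, fun tr h => h.unique hE⟩, fun tr h n hn c => ?_⟩
  obtain rfl := h.unique hE
  refine ⟨hT.incl n c, ?_⟩
  have e1 := hT.markov n hn c 1
  have e2 := hT.markov n hn 1 1
  rw [map_one, mul_one, mul_one] at e1
  rw [map_one, mul_one, one_mul, mul_one, hT.one_eq, h1, smul_eq_mul, mul_one] at e2
  rw [e1, e2, smul_eq_mul, mul_comm]

end Uniqueness

end


noncomputable section

/-! ### Infinite words -/

section Words

variable {L : Type*}

/-- The word with first letter `a`, followed by `w`. -/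
def wcons (a : L) (w : ℕ → L) : ℕ → L
  | 0 => a
  | i + 1 => w i

theorem exists_wcons (w : ℕ → L) : ∃ a w', w = wcons a w' :=
  ⟨w 0, fun i => w (i + 1), by funext i; cases i <;> rfl⟩

theorem wcons_comp_swap (a : L) (w : ℕ → L) (i : ℕ) :
    wcons a w ∘ Equiv.swap (i + 1) (i + 2) = wcons a (w ∘ Equiv.swap i (i + 1)) := by
  funext j
  cases j with
  | zero =>
    rw [Function.comp_apply, Equiv.swap_apply_of_ne_of_ne (by omega) (by omega)]
    rfl
  | succ j =>
    simp only [Function.comp_apply, wcons, Equiv.swap_apply_def]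
    split_ifs <;> first | rfl | omega

theorem wcons_wcons_comp_swap (a b : L) (w : ℕ → L) :
    wcons a (wcons b w) ∘ Equiv.swap 0 1 = wcons b (wcons a w) := by
  funext j
  rcases j with _ | _ | j
  · simp [wcons]
  · simp [wcons]
  · rw [Function.comp_apply, Equiv.swap_apply_of_ne_of_ne (by omega) (by omega)]
    rfl

end Words

/-! ### R-matrix coefficients and their weighted sums -/

section Coefficients

variable {B : Type*} [CommRing B] (s : B) {N : ℕ}

/-- Diagonal coefficients of the action of the Hecke algebra on words. -/
def twA (a b : Fin (N + 1)) : B := if a = b then s ^ 2 else if b < a then s ^ 2 - 1 else 0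

/-- Off-diagonal coefficients of the action of the Hecke algebra on words. -/
def twB (a b : Fin (N + 1)) : B := if a = b then 0 else s

theorem twA_self (a : Fin (N + 1)) : twA s a a = s ^ 2 := if_pos rfl

theorem twB_self (a : Fin (N + 1)) : twB s a a = 0 := if_pos rfl

theorem twA_of_lt {a b : Fin (N + 1)} (h : a < b) : twA s a b = 0 := by
  rw [twA, if_neg h.ne, if_neg h.le.not_gt]

theorem twA_of_gt {a b : Fin (N + 1)} (h : b < a) : twA s a b = s ^ 2 - 1 := by
  rw [twA, if_neg h.ne', if_pos h]

theorem twB_of_ne {a b : Fin (N + 1)} (h : a ≠ b) : twB s a b = s := if_neg h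

theorem twB_comm (a b : Fin (N + 1)) : twB s a b = twB s b a := by
  simp only [twB, eq_comm]

theorem twA_sq (a b : Fin (N + 1)) :
    twA s a b * twA s a b + twB s a b * twB s b a = (s ^ 2 - 1) * twA s a b + s ^ 2 := by
  rcases lt_trichotomy a b with h | rfl | h
  · rw [twA_of_lt s h, twB_of_ne s h.ne, twB_of_ne s h.ne']; ring
  · rw [twA_self, twB_self]; ring
  · rw [twA_of_gt s h, twB_of_ne s h.ne, twB_of_ne s h.ne']; ring

theorem twB_mul_twA_add (a b : Fin (N + 1)) :
    twB s a b * twA s b a + twA s a b * twB s a b = (s ^ 2 - 1) * twB s a b := by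
  rcases lt_trichotomy a b with h | rfl | h
  · rw [twA_of_lt s h, twA_of_gt s h]; ring
  · rw [twB_self]; ring
  · rw [twA_of_lt s h, twA_of_gt s h]; ring

/-- In the braid relation on the word abc this compares the coefficients of abc; the next two lemmas
compare those of bac and acb. The other three rearrangements have equal coefficients by
commutativity. -/
theorem tw_braid (a b c : Fin (N + 1)) :
    twA s a b * twA s b c * twA s a b + twB s a b * twA s a c * twB s b a =
      twA s b c * twA s a b * twA s b c + twB s b c * twA s a c * twB s c b := by
  have h2 := lt_trichotomy b c
  rcases lt_trichotomy a b with h | rfl | h <;> rcases h2 with h' | rfl | h'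
  · rw [twA_of_lt s h, twA_of_lt s h', twA_of_lt s (h.trans h')]; ring
  · rw [twA_of_lt s h, twA_self, twB_self]; ring
  · rw [twA_of_lt s h, twA_of_gt s h', twB_of_ne s h.ne, twB_of_ne s h.ne', twB_of_ne s h'.ne,
      twB_of_ne s h'.ne']; ring
  · rw [twA_of_lt s h', twA_self, twB_self]; ring
  · rw [twA_self, twB_self]
  · rw [twA_of_gt s h', twA_self, twB_self, twB_of_ne s h'.ne, twB_of_ne s h'.ne']; ring
  · rw [twA_of_gt s h, twA_of_lt s h', twB_of_ne s h.ne, twB_of_ne s h.ne', twB_of_ne s h'.ne,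
      twB_of_ne s h'.ne']; ring
  · rw [twA_of_gt s h, twA_self, twB_self, twB_of_ne s h.ne, twB_of_ne s h.ne']; ring
  · rw [twA_of_gt s h, twA_of_gt s h', twB_of_ne s h.ne, twB_of_ne s h.ne', twB_of_ne s h'.ne,
      twB_of_ne s h'.ne']

theorem tw_braid_left (a b c : Fin (N + 1)) :
    twB s a b * (twA s a b * twA s b c + twA s a c * twA s b a) =
      twB s a b * (twA s b c * twA s a c) := by
  rcases lt_trichotomy a b with h | rfl | h
  · congr 1
    rw [twA_of_lt s h, twA_of_gt s h]
    rcases lt_trichotomy a c with h' | rfl | h'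
    · rw [twA_of_lt s h']; ring
    · rw [twA_of_gt s h]; ring
    · rw [twA_of_gt s (h'.trans h)]; ring
  · rw [twB_self]; ring
  · congr 1
    rw [twA_of_lt s h, twA_of_gt s h]
    rcases lt_trichotomy b c with h' | rfl | h'
    · rw [twA_of_lt s h']; ring
    · rw [twA_of_gt s h]; ring
    · rw [twA_of_gt s (h'.trans h)]; ring

theorem tw_braid_right (a b c : Fin (N + 1)) :
    twB s b c * (twA s a b * twA s a c) =
      twB s b c * (twA s b c * twA s a b + twA s a c * twA s c b) := by
  rcases lt_trichotomy b c with h | rfl | h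
  · congr 1
    rw [twA_of_lt s h, twA_of_gt s h]
    rcases lt_trichotomy a c with h' | rfl | h'
    · rw [twA_of_lt s h']; ring
    · rw [twA_of_gt s h]; ring
    · rw [twA_of_gt s (h.trans h')]; ring
  · rw [twB_self]; ring
  · congr 1
    rw [twA_of_lt s h, twA_of_gt s h]
    rcases lt_trichotomy a b with h' | rfl | h'
    · rw [twA_of_lt s h']; ring
    · rw [twA_of_gt s h]; ring
    · rw [twA_of_gt s (h.trans h')]; ring

theorem sub_one_mul_sum_gt (q : B) {b n : ℕ} (h : b + 1 ≤ n) :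
    (q - 1) * ∑ c ∈ Finset.range n, (if b < c then q ^ c else 0) = q ^ n - q ^ (b + 1) := by
  induction n, h using Nat.le_induction with
  | base =>
    rw [Finset.sum_eq_zero, mul_zero, sub_self]
    intro c hc
    rw [if_neg (by have := Finset.mem_range.1 hc; omega)]
  | succ n h ih =>
    rw [Finset.sum_range_succ, mul_add, ih, if_pos (by omega)]
    ring

/-- The diagonal term gives q^{b+1} and the letters above b telescope to q^{N+1} - q^{b+1}. The
independence of b is what makes e g₂ e a scalar multiple of e, with scalar r = q^{N+1}. -/
theorem sum_twA (b : Fin (N + 1)) :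
    ∑ c : Fin (N + 1), twA s c b * (s ^ 2) ^ (c : ℕ) = (s ^ 2) ^ (N + 1) := by
  have e : ∀ c : Fin (N + 1), twA s c b * (s ^ 2) ^ (c : ℕ) =
      (if c = b then (s ^ 2) ^ ((b : ℕ) + 1) else 0) +
        (s ^ 2 - 1) * (if (b : ℕ) < c then (s ^ 2) ^ (c : ℕ) else 0) := by
    intro c
    rcases lt_trichotomy c b with h | rfl | h
    · rw [twA_of_lt s h, if_neg h.ne, if_neg (by omega)]; ring
    · rw [twA_self, if_pos rfl, if_neg (lt_irrefl _)]; ring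
    · rw [twA_of_gt s h, if_neg h.ne', if_pos (by omega)]; ring
  rw [Finset.sum_congr rfl fun c _ => e c, Finset.sum_add_distrib, Finset.sum_ite_eq',
    if_pos (Finset.mem_univ b), ← Finset.mul_sum,
    Fin.sum_univ_eq_sum_range (fun c => if (b : ℕ) < c then (s ^ 2) ^ c else 0),
    sub_one_mul_sum_gt _ (by omega)]
  ring

theorem sum_twA_sq (b : Fin (N + 1)) :
    ∑ c : Fin (N + 1), twA s c b * twA s c b * (s ^ 2) ^ (c : ℕ) =
      (s ^ 2 - 1) * (s ^ 2) ^ (N + 1) + (s ^ 2) ^ ((b : ℕ) + 1) := by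
  have e : ∀ c : Fin (N + 1), twA s c b * twA s c b * (s ^ 2) ^ (c : ℕ) =
      (s ^ 2 - 1) * (twA s c b * (s ^ 2) ^ (c : ℕ)) +
        (if c = b then (s ^ 2) ^ ((b : ℕ) + 1) else 0) := by
    intro c
    rcases lt_trichotomy c b with h | rfl | h
    · rw [twA_of_lt s h, if_neg h.ne]; ring
    · rw [twA_self, if_pos rfl]; ring
    · rw [twA_of_gt s h, if_neg h.ne']; ring
  rw [Finset.sum_congr rfl fun c _ => e c, Finset.sum_add_distrib, Finset.sum_ite_eq',
    if_pos (Finset.mem_univ b), ← Finset.mul_sum, sum_twA]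

/-- By symmetry a < b. A nonzero factor for b forces c ≥ b > a, where the factor for a is the
constant q - 1, so the sum reduces to `sum_twA`. -/
theorem sum_twA_mul_twA {a b : Fin (N + 1)} (hab : a ≠ b) :
    ∑ c : Fin (N + 1), twA s c a * twA s c b * (s ^ 2) ^ (c : ℕ) =
      (s ^ 2 - 1) * (s ^ 2) ^ (N + 1) := by
  have key : ∀ a b : Fin (N + 1), a < b →
      ∑ c : Fin (N + 1), twA s c a * twA s c b * (s ^ 2) ^ (c : ℕ) =
        (s ^ 2 - 1) * (s ^ 2) ^ (N + 1) := by
    intro a b hab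
    rw [← sum_twA s b, Finset.mul_sum]
    refine Finset.sum_congr rfl fun c _ => ?_
    rcases lt_or_ge c b with h | h
    · rw [twA_of_lt s h]; ring
    · rw [twA_of_gt s (hab.trans_le h)]; ring
  rcases lt_or_gt_of_ne hab with h | h
  · exact key a b h
  · rw [← key b a h]
    exact Finset.sum_congr rfl fun c _ => by ring

end Coefficients

/-! ### Hecke, cap and cup operators on functions of words -/

section Operators

variable {B : Type*} [CommRing B] (s : B) (N : ℕ)

/-- Functions on infinite words in `N + 1` letters. -/
abbrev WFun (B : Type*) (N : ℕ) : Type _ := (ℕ → Fin (N + 1)) → B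

/-- The action of a Hecke generator on the letters with positions `i` and `i + 1`. -/
def tG (i : ℕ) : Module.End B (WFun B N) where
  toFun v w := twA s (w i) (w (i + 1)) * v w +
    twB s (w i) (w (i + 1)) * v (w ∘ Equiv.swap i (i + 1))
  map_add' u v := by funext w; simp only [Pi.add_apply]; ring
  map_smul' c v := by funext w; simp only [Pi.smul_apply, smul_eq_mul, RingHom.id_apply]; ring

/-- The cap operator, which sums over pairs of equal letters in front. -/
def tCap : Module.End B (WFun B N) where
  toFun v w := ∑ c : Fin (N + 1), v (wcons c (wcons c w))
  map_add' u v := by funext w; simp only [Pi.add_apply, Finset.sum_add_distrib]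
  map_smul' c v := by
    funext w; simp only [Pi.smul_apply, smul_eq_mul, RingHom.id_apply, Finset.mul_sum]

/-- The cup operator. -/
def tCup : Module.End B (WFun B N) where
  toFun h w := if w 0 = w 1 then (s ^ 2) ^ (w 0 : ℕ) * h (fun i => w (i + 2)) else 0
  map_add' u v := by
    funext w; simp only [Pi.add_apply]; split_ifs
    · ring
    · ring
  map_smul' c v := by
    funext w; simp only [Pi.smul_apply, smul_eq_mul, RingHom.id_apply]; split_ifs <;> ring

variable {N}

theorem tG_apply (i : ℕ) (v : WFun B N) (w : ℕ → Fin (N + 1)) : tG s N i v w =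
    twA s (w i) (w (i + 1)) * v w +
      twB s (w i) (w (i + 1)) * v (w ∘ Equiv.swap i (i + 1)) := rfl

theorem tG_zero_wcons (v : WFun B N) (a b : Fin (N + 1)) (w : ℕ → Fin (N + 1)) :
    tG s N 0 v (wcons a (wcons b w)) =
      twA s a b * v (wcons a (wcons b w)) + twB s a b * v (wcons b (wcons a w)) := by
  rw [tG_apply, zero_add, wcons_wcons_comp_swap]
  rfl

theorem tG_succ_wcons (i : ℕ) (v : WFun B N) (a : Fin (N + 1)) (w : ℕ → Fin (N + 1)) :
    tG s N (i + 1) v (wcons a w) = tG s N i (fun w => v (wcons a w)) w := by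
  rw [tG_apply, wcons_comp_swap, tG_apply]
  rfl

theorem tG_one_wcons (v : WFun B N) (a b c : Fin (N + 1)) (w : ℕ → Fin (N + 1)) :
    tG s N 1 v (wcons a (wcons b (wcons c w))) =
      twA s b c * v (wcons a (wcons b (wcons c w))) +
        twB s b c * v (wcons a (wcons c (wcons b w))) := by
  rw [tG_succ_wcons, tG_zero_wcons]

theorem tG_two_wcons (v : WFun B N) (a b c d : Fin (N + 1)) (w : ℕ → Fin (N + 1)) :
    tG s N 2 v (wcons a (wcons b (wcons c (wcons d w)))) =
      twA s c d * v (wcons a (wcons b (wcons c (wcons d w)))) +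
        twB s c d * v (wcons a (wcons b (wcons d (wcons c w)))) := by
  rw [tG_succ_wcons, tG_one_wcons]

theorem tCap_apply (v : WFun B N) (w : ℕ → Fin (N + 1)) :
    tCap N v w = ∑ c : Fin (N + 1), v (wcons c (wcons c w)) := rfl

theorem tCup_wcons (h : WFun B N) (a b : Fin (N + 1)) (w : ℕ → Fin (N + 1)) :
    tCup s N h (wcons a (wcons b w)) = if a = b then (s ^ 2) ^ (a : ℕ) * h w else 0 := rfl

theorem tCup_wcons_self (h : WFun B N) (a : Fin (N + 1)) (w : ℕ → Fin (N + 1)) :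
    tCup s N h (wcons a (wcons a w)) = (s ^ 2) ^ (a : ℕ) * h w := if_pos rfl

theorem tCup_wcons_of_ne (h : WFun B N) {a b : Fin (N + 1)} (hab : a ≠ b)
    (w : ℕ → Fin (N + 1)) : tCup s N h (wcons a (wcons b w)) = 0 := if_neg hab

/-- The operator at position i+1 ignores the first letter and acts as the one at position i on the
rest, so only the case of the first two letters needs a computation. The braid and commutation
relations use the same reduction. -/
theorem tG_quad (i : ℕ) : tG s N i * tG s N i = (s ^ 2 - 1) • tG s N i + (s ^ 2) • 1 := by
  refine LinearMap.ext fun v => ?_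
  induction i generalizing v with
  | zero =>
    funext w
    obtain ⟨a, w, rfl⟩ := exists_wcons w
    obtain ⟨b, w, rfl⟩ := exists_wcons w
    simp only [Module.End.mul_apply, LinearMap.add_apply, LinearMap.smul_apply, Pi.add_apply,
      Pi.smul_apply, smul_eq_mul, Module.End.one_apply, tG_zero_wcons]
    linear_combination v (wcons a (wcons b w)) * twA_sq s a b +
      v (wcons b (wcons a w)) * twB_mul_twA_add s a b
  | succ i ih =>
    funext w
    obtain ⟨a, w, rfl⟩ := exists_wcons w
    have := congrFun (ih fun w => v (wcons a w)) w
    simpa only [Module.End.mul_apply, LinearMap.add_apply, LinearMap.smul_apply, Pi.add_apply,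
      Pi.smul_apply, smul_eq_mul, Module.End.one_apply, tG_succ_wcons] using this

theorem tG_braid (i : ℕ) : tG s N i * tG s N (i + 1) * tG s N i =
    tG s N (i + 1) * tG s N i * tG s N (i + 1) := by
  refine LinearMap.ext fun v => ?_
  induction i generalizing v with
  | zero =>
    funext w
    obtain ⟨a, w, rfl⟩ := exists_wcons w
    obtain ⟨b, w, rfl⟩ := exists_wcons w
    obtain ⟨c, w, rfl⟩ := exists_wcons w
    simp only [Module.End.mul_apply, zero_add, tG_zero_wcons, tG_one_wcons]
    linear_combination v (wcons a (wcons b (wcons c w))) * tw_braid s a b c +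
      v (wcons b (wcons a (wcons c w))) * tw_braid_left s a b c +
      v (wcons a (wcons c (wcons b w))) * tw_braid_right s a b c
  | succ i ih =>
    funext w
    obtain ⟨a, w, rfl⟩ := exists_wcons w
    have := congrFun (ih fun w => v (wcons a w)) w
    simpa only [Module.End.mul_apply, tG_succ_wcons] using this

theorem tG_far {i j : ℕ} (h : i + 2 ≤ j) : tG s N i * tG s N j = tG s N j * tG s N i := by
  refine LinearMap.ext fun v => ?_
  induction i generalizing v j with
  | zero =>
    obtain ⟨j, rfl⟩ := exists_add_two h
    funext w
    obtain ⟨a, w, rfl⟩ := exists_wcons w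
    obtain ⟨b, w, rfl⟩ := exists_wcons w
    simp only [Module.End.mul_apply, tG_zero_wcons, tG_succ_wcons]
    exact (congrFun ((tG s N j).map_add (twA s a b • fun w => v (wcons a (wcons b w)))
      (twB s a b • fun w => v (wcons b (wcons a w)))) w).trans (by
        rw [map_smul, map_smul]; rfl) |>.symm
  | succ i ih =>
    obtain ⟨j, rfl⟩ : ∃ j', j = j' + 1 := ⟨j - 1, by omega⟩
    funext w
    obtain ⟨a, w, rfl⟩ := exists_wcons w
    have := congrFun (ih (j := j) (by omega) fun w => v (wcons a w)) w
    simpa only [Module.End.mul_apply, tG_succ_wcons] using this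

theorem tCap_mul_tCup : tCap N * tCup s N = (∑ c : Fin (N + 1), (s ^ 2) ^ (c : ℕ)) • 1 := by
  refine LinearMap.ext fun v => funext fun w => ?_
  simp only [Module.End.mul_apply, tCap_apply, tCup_wcons_self, ← Finset.sum_mul]
  rfl

theorem tCap_mul_tG_zero : tCap N * tG s N 0 = (s ^ 2) • tCap N := by
  refine LinearMap.ext fun v => funext fun w => ?_
  simp only [Module.End.mul_apply, tCap_apply, tG_zero_wcons, twA_self, twB_self, zero_mul,
    add_zero, LinearMap.smul_apply, Pi.smul_apply, smul_eq_mul, Finset.mul_sum]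

theorem tG_zero_mul_tCup : tG s N 0 * tCup s N = (s ^ 2) • tCup s N := by
  refine LinearMap.ext fun v => funext fun w => ?_
  obtain ⟨a, w, rfl⟩ := exists_wcons w
  obtain ⟨b, w, rfl⟩ := exists_wcons w
  simp only [Module.End.mul_apply, tG_zero_wcons, LinearMap.smul_apply, Pi.smul_apply, smul_eq_mul]
  rcases eq_or_ne a b with rfl | h
  · rw [twA_self, twB_self]; ring
  · rw [tCup_wcons_of_ne s _ h, tCup_wcons_of_ne s _ h.symm]; ring

theorem tCap_mul_tG_add_two (i : ℕ) : tCap N * tG s N (i + 2) = tG s N i * tCap N := by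
  refine LinearMap.ext fun v => funext fun w => ?_
  simp only [Module.End.mul_apply, tCap_apply, tG_succ_wcons]
  simp only [tG_apply, tCap_apply, Finset.sum_add_distrib, Finset.mul_sum]

theorem tG_add_two_mul_tCup (i : ℕ) : tG s N (i + 2) * tCup s N = tCup s N * tG s N i := by
  refine LinearMap.ext fun v => funext fun w => ?_
  obtain ⟨a, w, rfl⟩ := exists_wcons w
  obtain ⟨b, w, rfl⟩ := exists_wcons w
  simp only [Module.End.mul_apply, tG_succ_wcons]
  rcases eq_or_ne a b with rfl | h
  · simp only [tCup_wcons_self]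
    exact congrFun ((tG s N i).map_smul ((s ^ 2) ^ (a : ℕ)) v) w
  · simp only [tCup_wcons_of_ne s _ h]
    exact congrFun (map_zero (tG s N i)) w

theorem tCap_tG_one_tCup : tCap N * tG s N 1 * tCup s N = ((s ^ 2) ^ (N + 1)) • 1 := by
  refine LinearMap.ext fun v => funext fun w => ?_
  obtain ⟨b, w, rfl⟩ := exists_wcons w
  simp only [Module.End.mul_apply, tCap_apply, tG_one_wcons, tCup_wcons_self]
  rw [← sum_twA s b, Finset.sum_smul]
  rw [LinearMap.sum_apply, Finset.sum_apply]
  refine Finset.sum_congr rfl fun c _ => ?_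
  -- An exchanged word survives the cup only if its first two letters agree, and then the exchange
  -- coefficient vanishes.
  have e : twB s c b * tCup s N v (wcons c (wcons b (wcons c w))) = 0 := by
    rcases eq_or_ne c b with rfl | h
    · rw [twB_self, zero_mul]
    · rw [tCup_wcons_of_ne s _ h, mul_zero]
  rw [e, add_zero]
  simp only [LinearMap.smul_apply, Pi.smul_apply, smul_eq_mul, Module.End.one_apply]
  ring

-- This exchange over two cups is what makes the twist act trivially on them. The two cups vanish
-- off words of the form aabb, so the check runs through the coincidences among four letters; the
-- word abba is the case where genuine coefficients meet.
set_option linter.unusedSimpArgs false in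
theorem tG_tG_tCup_tCup : tG s N 0 * tG s N 1 * (tCup s N * tCup s N) =
    tG s N 2 * tG s N 1 * (tCup s N * tCup s N) := by
  refine LinearMap.ext fun v => funext fun w => ?_
  obtain ⟨a, w, rfl⟩ := exists_wcons w
  obtain ⟨b, w, rfl⟩ := exists_wcons w
  obtain ⟨c, w, rfl⟩ := exists_wcons w
  obtain ⟨d, w, rfl⟩ := exists_wcons w
  simp only [Module.End.mul_apply, tG_zero_wcons, tG_one_wcons, tG_two_wcons, tCup_wcons]
  by_cases h1 : a = b
  · subst h1
    by_cases h2 : c = d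
    · subst h2
      simp [twA_self, twB_self]
    · by_cases h3 : a = c
      · subst h3; simp [h2, Ne.symm h2, twB_self]
      · by_cases h4 : a = d
        · subst h4; simp [h2, h3, twB_self]
        · simp [h2, h3, h4, Ne.symm h2]
  · by_cases h2 : c = d
    · subst h2
      by_cases h3 : a = c
      · subst h3; simp [h1, Ne.symm h1, twB_self]
      · simp [h1, h3, Ne.symm h1]
    · by_cases h3 : a = c
      · subst h3
        by_cases h4 : b = d
        · subst h4; simp [h1, Ne.symm h1]
        · simp [h1, h2, h4, Ne.symm h1, Ne.symm h2]
      · by_cases h4 : a = d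
        · subst h4
          by_cases h5 : b = c
          · subst h5
            simp only [h1, Ne.symm h1, if_false, if_true, mul_zero, zero_add, add_zero,
              twB_of_ne s h1, twB_of_ne s (Ne.symm h1)]
            ring
          · simp [h1, h2, h3, h5, Ne.symm h1, Ne.symm h2]
        · simp [h1, h2, h3, h4, Ne.symm h1, Ne.symm h2]

theorem tCap_tCap_tG_tG : tCap N * tCap N * (tG s N 1 * tG s N 0) =
    tCap N * tCap N * (tG s N 1 * tG s N 2) := by
  refine LinearMap.ext fun v => funext fun w => ?_
  simp only [Module.End.mul_apply, tCap_apply, tG_one_wcons, tG_zero_wcons, tG_two_wcons, twA_self,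
    twB_self, mul_add, zero_mul, add_zero, Finset.sum_add_distrib]
  congr 2
  -- Only the exchanged terms differ between the two sides. They match after interchanging the names
  -- of the two summed letters, since the exchange coefficient is symmetric.
  rw [Finset.sum_comm]
  refine Finset.sum_congr rfl fun c _ => Finset.sum_congr rfl fun k _ => ?_
  rw [twB_comm s c k]

-- The contribution of the capped letter c, arranged so that each piece depends on c only through
-- the sums evaluated in `sum_twA_sq` and `sum_twA_mul_twA`, or through the condition c = a.
set_option linter.unusedSimpArgs false in
theorem tw_summand (h : WFun B N) (a b c : Fin (N + 1)) (w : ℕ → Fin (N + 1)) :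
    tG s N 1 (tG s N 2 (tG s N 0 (tG s N 1 (tCup s N h))))
      (wcons c (wcons c (wcons a (wcons b w)))) =
    (if a = b then (s ^ 2) ^ 2 * (s ^ 2) ^ (a : ℕ) * h (wcons c (wcons c w)) else 0) -
    (if a = b then (if c = a then (s ^ 2) ^ 2 * (s ^ 2) ^ (a : ℕ) * h (wcons a (wcons a w))
      else 0) else 0) +
    (s ^ 2 * twA s a b * (twA s c a * twA s c a * (s ^ 2) ^ (c : ℕ)) +
      s ^ 2 * (twA s c a * twA s c b * (s ^ 2) ^ (c : ℕ)) -
      (if c = a then (s ^ 2) ^ 2 * twA s a b * (s ^ 2) ^ (a : ℕ) else 0)) *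
        h (wcons a (wcons b w)) +
    s ^ 2 * twB s a b * (twA s c a * twA s c b * (s ^ 2) ^ (c : ℕ)) * h (wcons b (wcons a w)) := by
  simp only [tG_zero_wcons, tG_one_wcons, tG_two_wcons, tCup_wcons, twA_self, twB_self]
  by_cases h1 : c = a
  · subst h1
    by_cases h2 : c = b
    · subst h2; simp [twA_self, twB_self]; ring
    · simp [h2, twA_self, twB_self]; ring
  · by_cases h2 : a = b
    · subst h2
      simp [h1, Ne.symm h1, twA_self, twB_self, twB_of_ne s h1, twB_of_ne s (Ne.symm h1)]; ring
    · by_cases h3 : c = b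
      · subst h3
        simp [h1, h2, Ne.symm h1, twA_self, twB_self, twB_of_ne s h1, twB_of_ne s h2]; ring
      · simp [h1, h2, h3, Ne.symm h1, Ne.symm h2, Ne.symm h3, twB_of_ne s h1, twB_of_ne s h2,
          twB_of_ne s h3, twB_of_ne s (Ne.symm h1)]; ring

theorem tCap_tG_tCup : tCap N * (tG s N 1 * tG s N 2 * tG s N 0 * tG s N 1) * tCup s N =
    ((s ^ 2) ^ 2) • (tCup s N * tCap N) +
      ((s ^ 2) * (s ^ 2 - 1) * (s ^ 2) ^ (N + 1)) • (1 + tG s N 0) := by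
  refine LinearMap.ext fun v => funext fun w => ?_
  obtain ⟨a, w, rfl⟩ := exists_wcons w
  obtain ⟨b, w, rfl⟩ := exists_wcons w
  simp only [Module.End.mul_apply, LinearMap.add_apply, LinearMap.smul_apply, Pi.add_apply,
    Pi.smul_apply, smul_eq_mul, Module.End.one_apply, tG_zero_wcons]
  rw [tCap_apply]
  simp only [tw_summand, Finset.sum_add_distrib, Finset.sum_sub_distrib, ← Finset.sum_mul,
    ← Finset.mul_sum, Finset.sum_ite_eq', Finset.mem_univ, if_true, sum_twA_sq]
  rcases eq_or_ne a b with rfl | hab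
  · simp only [if_true, tCup_wcons_self, tCap_apply, twA_self, twB_self, sum_twA_sq,
      Finset.sum_ite_eq', Finset.mem_univ, ← Finset.mul_sum]
    ring
  · simp only [if_neg hab, tCup_wcons_of_ne s _ hab, sum_twA_mul_twA s hab, Finset.sum_const_zero]
    ring

end Operators

end


noncomputable section

/-! ### The word representation -/

section WordRep

variable {A B : Type*} [CommRing A] [CommRing B] [Algebra A B]

/-- The parameters are `q = s²`, `r = q ^ (N + 1)` and `d = 1 + q + ⋯ + q ^ N`. -/
structure WordParam (p : BrParam A) (s : B) (N : ℕ) : Prop where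
  map_q : algebraMap A B p.q = s ^ 2
  map_r : algebraMap A B p.r = (s ^ 2) ^ (N + 1)
  map_d : algebraMap A B p.d = ∑ c : Fin (N + 1), (s ^ 2) ^ (c : ℕ)

theorem mul_heckeInv_of_quad {E : Type*} [Ring E] [Algebra A E] (p : BrParam A) {x : E}
    (h : x * x = ((p.q : A) - 1) • x + (p.q : A) • 1) :
    x * heckeInv p x = 1 ∧ heckeInv p x * x = 1 := by
  have hq : ((p.q⁻¹ : Aˣ) : A) * (p.q : A) = 1 := Units.inv_mul p.q
  have key : ((p.q⁻¹ : Aˣ) : A) • (((p.q : A) - 1) • x + (p.q : A) • (1 : E)) +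
      (((p.q⁻¹ : Aˣ) : A) - 1) • x = 1 := by
    match_scalars <;> linear_combination hq
  constructor
  · rw [heckeInv, mul_add, mul_smul_comm, mul_smul_comm, h, mul_one, key]
  · rw [heckeInv, add_mul, smul_mul_assoc, smul_mul_assoc, h, one_mul, key]

variable {p : BrParam A} {s : B} {N : ℕ} (H : WordParam p s N)

namespace WordParam

theorem q_smul (H : WordParam p s N) (f : Module.End B (WFun B N)) :
    (p.q : A) • f = (s ^ 2) • f := by
  rw [← algebraMap_smul B, H.map_q]

theorem d_smul (H : WordParam p s N) (f : Module.End B (WFun B N)) :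
    (p.d : A) • f = (∑ c : Fin (N + 1), (s ^ 2) ^ (c : ℕ)) • f := by
  rw [← algebraMap_smul B, H.map_d]

theorem r_smul (H : WordParam p s N) (f : Module.End B (WFun B N)) :
    (p.r : A) • f = ((s ^ 2) ^ (N + 1)) • f := by
  rw [← algebraMap_smul B, H.map_r]

theorem quad (H : WordParam p s N) (i : ℕ) :
    tG s N i * tG s N i = ((p.q : A) - 1) • tG s N i + (p.q : A) • 1 := by
  rw [tG_quad, H.q_smul, ← algebraMap_smul B ((p.q : A) - 1), map_sub, map_one, H.map_q]

theorem cap_cup (H : WordParam p s N) : tCap N * tCup s N = (p.d : A) • 1 := by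
  rw [tCap_mul_tCup, H.d_smul]

theorem cap_inv_cup (H : WordParam p s N) :
    tCap N * heckeInv p (tG s N 1) * tCup s N = ((p.q⁻¹ : Aˣ) : A) • 1 := by
  have hq : ((p.q⁻¹ : Aˣ) : A) * (p.q : A) = 1 := Units.inv_mul p.q
  have e := tCap_tG_one_tCup s (N := N)
  rw [← H.r_smul] at e
  rw [heckeInv, mul_add, add_mul, mul_smul_comm, mul_smul_comm, mul_one, smul_mul_assoc,
    smul_mul_assoc, e, H.cap_cup]
  match_scalars
  linear_combination (-(p.q⁻¹ : Aˣ) : A) * p.rel + (p.d : A) * hq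

theorem inv_cup (H : WordParam p s N) :
    heckeInv p (tG s N 0) * tCup s N = ((p.q⁻¹ : Aˣ) : A) • tCup s N := by
  have hq : ((p.q⁻¹ : Aˣ) : A) * (p.q : A) = 1 := Units.inv_mul p.q
  rw [heckeInv, add_mul, smul_mul_assoc, smul_mul_assoc, one_mul, tG_zero_mul_tCup, ← H.q_smul]
  match_scalars
  linear_combination hq

/-- Expanding the two inverse letters leaves three positive words between cap and cup. The longest,
evaluated in `tCap_tG_tCup`, yields the cup-cap operator plus multiples of 1 and G₀, and these
cancel against the shorter words. This makes e T e act as two cups after two caps. -/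
theorem cap_twist_cup (H : WordParam p s N) :
    tCap N * (tG s N 1 * tG s N 2 * heckeInv p (tG s N 0) * heckeInv p (tG s N 1)) * tCup s N =
      tCup s N * tCap N := by
  have hq : ((p.q⁻¹ : Aˣ) : A) * (p.q : A) = 1 := Units.inv_mul p.q
  have e0 := tCap_tG_one_tCup s (N := N)
  rw [← H.r_smul] at e0
  have e1 : tCap N * tG s N 1 * tG s N 2 * tCup s N = (p.r : A) • tG s N 0 := by
    rw [mul_assoc _ (tG s N 2), tG_add_two_mul_tCup s 0, ← mul_assoc, e0, smul_mul_assoc, one_mul]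
  have e2 : tCap N * tG s N 1 * tG s N 2 * tG s N 1 * tCup s N =
      (p.r : A) • (((p.q : A) - 1) • tG s N 0 + (p.q : A) • 1) := by
    calc _ = tCap N * (tG s N 1 * tG s N 2 * tG s N 1) * tCup s N := by simp only [mul_assoc]
      _ = tCap N * tG s N 2 * tG s N 1 * (tG s N 2 * tCup s N) := by
        rw [tG_braid s 1]; simp only [mul_assoc]
      _ = tG s N 0 * (tCap N * tG s N 1 * tCup s N) * tG s N 0 := by
        rw [tCap_mul_tG_add_two s 0, tG_add_two_mul_tCup s 0]; simp only [mul_assoc]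
      _ = _ := by
        rw [e0, mul_smul_comm, mul_one, smul_mul_assoc, H.quad]
  have e3 : tCap N * tG s N 1 * tG s N 2 * tG s N 0 * tG s N 1 * tCup s N =
      ((p.q : A) ^ 2) • (tCup s N * tCap N) +
        ((p.q : A) * ((p.q : A) - 1) * (p.r : A)) • (1 + tG s N 0) := by
    have := tCap_tG_tCup s (N := N)
    have c1 : (s ^ 2) ^ 2 = algebraMap A B ((p.q : A) ^ 2) := by rw [map_pow, H.map_q]
    have c2 : s ^ 2 * (s ^ 2 - 1) * (s ^ 2) ^ (N + 1) =
        algebraMap A B ((p.q : A) * ((p.q : A) - 1) * (p.r : A)) := by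
      rw [map_mul, map_mul, map_sub, map_one, H.map_q, H.map_r]
    rw [c1, c2, algebraMap_smul, algebraMap_smul] at this
    rw [← this]
    simp only [mul_assoc]
  calc _ = tCap N * tG s N 1 * tG s N 2 * heckeInv p (tG s N 0) *
        (heckeInv p (tG s N 1) * tCup s N) := by simp only [mul_assoc]
    _ = ((p.q⁻¹ : Aˣ) : A) • (tCap N * tG s N 1 * tG s N 2 * heckeInv p (tG s N 0) * tG s N 1 *
          tCup s N) + (((p.q⁻¹ : Aˣ) : A) - 1) • (tCap N * tG s N 1 * tG s N 2 *
          (heckeInv p (tG s N 0) * tCup s N)) := by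
      conv_lhs => rw [heckeInv.eq_1 p (tG s N 1)]
      simp only [mul_add, add_mul, mul_smul_comm, smul_mul_assoc, one_mul, mul_assoc]
    _ = ((p.q⁻¹ : Aˣ) : A) • (((p.q⁻¹ : Aˣ) : A) • (tCap N * tG s N 1 * tG s N 2 * tG s N 0 *
          tG s N 1 * tCup s N) + (((p.q⁻¹ : Aˣ) : A) - 1) • (tCap N * tG s N 1 * tG s N 2 *
          tG s N 1 * tCup s N)) + (((p.q⁻¹ : Aˣ) : A) - 1) • ((p.q⁻¹ : Aˣ) : A) •
          (tCap N * tG s N 1 * tG s N 2 * tCup s N) := by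
      rw [H.inv_cup, mul_smul_comm, heckeInv]
      simp only [mul_add, add_mul, mul_smul_comm, smul_mul_assoc, mul_one]
    _ = _ := by
      rw [e1, e2, e3]
      generalize tCup s N * tCap N = Z
      match_scalars
      · linear_combination (((p.q⁻¹ : Aˣ) : A) * p.q + 1) * hq
      · linear_combination (((p.q⁻¹ : Aˣ) : A) * p.r * p.q) * hq
      · linear_combination (((p.q⁻¹ : Aˣ) : A) * p.r * p.q) * hq

theorem twist_cup_cup (H : WordParam p s N) :
    tG s N 1 * tG s N 2 * heckeInv p (tG s N 0) * heckeInv p (tG s N 1) *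
      (tCup s N * tCup s N) = tCup s N * tCup s N := by
  have e1 : heckeInv p (tG s N 0) * (tCup s N * tCup s N) =
      heckeInv p (tG s N 2) * (tCup s N * tCup s N) := by
    simp only [heckeInv, add_mul, smul_mul_assoc, one_mul]
    rw [← mul_assoc, tG_zero_mul_tCup, ← mul_assoc (tG s N 2), tG_add_two_mul_tCup s 0,
      mul_assoc (tCup s N), tG_zero_mul_tCup, mul_smul_comm, smul_mul_assoc]
  have e2 : heckeInv p (tG s N 0) * (tG s N 1 * (tCup s N * tCup s N)) =
      heckeInv p (tG s N 2) * (tG s N 1 * (tCup s N * tCup s N)) := by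
    have := tG_tG_tCup_tCup s (N := N)
    rw [mul_assoc, mul_assoc (tG s N 2)] at this
    simp only [heckeInv, add_mul, smul_mul_assoc, one_mul, this]
  have e3 : heckeInv p (tG s N 0) * (heckeInv p (tG s N 1) * (tCup s N * tCup s N)) =
      heckeInv p (tG s N 2) * (heckeInv p (tG s N 1) * (tCup s N * tCup s N)) := by
    conv_lhs => rw [heckeInv.eq_1 p (tG s N 1)]
    conv_rhs => rw [heckeInv.eq_1 p (tG s N 1)]
    simp only [add_mul, mul_add, smul_mul_assoc, mul_smul_comm, one_mul, e1, e2]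
  simp only [mul_assoc] at e3 ⊢
  rw [e3, ← mul_assoc (tG s N 2), (mul_heckeInv_of_quad p (H.quad 2)).1, one_mul,
    ← mul_assoc (tG s N 1), (mul_heckeInv_of_quad p (H.quad 1)).1, one_mul]

theorem cap_cap_twist (H : WordParam p s N) : tCap N * tCap N *
    (tG s N 1 * tG s N 2 * heckeInv p (tG s N 0) * heckeInv p (tG s N 1)) =
      tCap N * tCap N := by
  have e := tCap_tCap_tG_tG s (N := N)
  rw [← mul_assoc, ← mul_assoc, ← e, mul_assoc _ _ (heckeInv p (tG s N 0)), mul_assoc (tG s N 1),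
    (mul_heckeInv_of_quad p (H.quad 0)).1, mul_one, mul_assoc,
    (mul_heckeInv_of_quad p (H.quad 1)).1, mul_one]

theorem relations (H : WordParam p s N) (n : ℕ) :
    BrRelations p n (fun i => tG s N (i - 1)) (tCup s N * tCap N) where
  quad i _ _ := H.quad (i - 1)
  braid i h1 _ := by
    obtain ⟨i, rfl⟩ : ∃ j, i = j + 1 := ⟨i - 1, by omega⟩
    exact tG_braid s i
  far i j h1 h2 _ := tG_far s (by omega)
  e_sq _ := by
    rw [mul_assoc, ← mul_assoc (tCap N), H.cap_cup, smul_mul_assoc, one_mul, mul_smul_comm]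
  e_far i h1 _ := by
    obtain ⟨i, rfl⟩ : ∃ j, i = j + 2 + 1 := ⟨i - 3, by omega⟩
    change _ * tG s N (i + 2) = tG s N (i + 2) * _
    rw [mul_assoc, tCap_mul_tG_add_two, ← mul_assoc, ← tG_add_two_mul_tCup, mul_assoc]
  e_g1 _ := by
    change _ * tG s N 0 = _
    rw [mul_assoc, tCap_mul_tG_zero, mul_smul_comm, H.q_smul]
  g1_e _ := by
    change tG s N 0 * _ = _
    rw [← mul_assoc, tG_zero_mul_tCup, smul_mul_assoc, H.q_smul]
  e_g2_e _ := by
    change _ * tG s N 1 * _ = _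
    have e := tCap_tG_one_tCup s (N := N)
    rw [mul_assoc (tCup s N), mul_assoc (tCup s N), ← mul_assoc _ (tCup s N), e, smul_mul_assoc,
      one_mul, mul_smul_comm, H.r_smul]
  e_g2inv_e _ := by
    change _ * heckeInv p (tG s N 1) * _ = _
    rw [mul_assoc (tCup s N), mul_assoc (tCup s N), ← mul_assoc _ (tCup s N), H.cap_inv_cup,
      smul_mul_assoc, one_mul, mul_smul_comm]
  twist_left _ := by
    have e1 := H.cap_twist_cup
    have e2 := H.twist_cup_cup
    change (tG s N 1 * tG s N 2 * heckeInv p (tG s N 0) * heckeInv p (tG s N 1)) *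
      (_ * (tG s N 1 * tG s N 2 * heckeInv p (tG s N 0) * heckeInv p (tG s N 1)) * _) =
      _ * (tG s N 1 * tG s N 2 * heckeInv p (tG s N 0) * heckeInv p (tG s N 1)) * _
    generalize tG s N 1 * tG s N 2 * heckeInv p (tG s N 0) * heckeInv p (tG s N 1) = E at *
    have e3 : tCup s N * tCap N * E * (tCup s N * tCap N) =
        tCup s N * tCup s N * (tCap N * tCap N) := by
      rw [mul_assoc (tCup s N), mul_assoc (tCup s N), ← mul_assoc _ (tCup s N), e1]
      simp only [mul_assoc]
    rw [e3, ← mul_assoc, e2]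
  twist_right _ := by
    have e1 := H.cap_twist_cup
    have e2 := H.cap_cap_twist
    change _ * (tG s N 1 * tG s N 2 * heckeInv p (tG s N 0) * heckeInv p (tG s N 1)) * _ *
      (tG s N 1 * tG s N 2 * heckeInv p (tG s N 0) * heckeInv p (tG s N 1)) =
      _ * (tG s N 1 * tG s N 2 * heckeInv p (tG s N 0) * heckeInv p (tG s N 1)) * _
    generalize tG s N 1 * tG s N 2 * heckeInv p (tG s N 0) * heckeInv p (tG s N 1) = E at *
    have e3 : tCup s N * tCap N * E * (tCup s N * tCap N) =
        tCup s N * tCup s N * (tCap N * tCap N) := by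
      rw [mul_assoc (tCup s N), mul_assoc (tCup s N), ← mul_assoc _ (tCup s N), e1]
      simp only [mul_assoc]
    rw [e3, mul_assoc, e2]

/-- The representation of the `q`-Brauer algebra on functions on words. -/
def rep (H : WordParam p s N) (n : ℕ) : QBr p n →ₐ[A] Module.End B (WFun B N) :=
  (H.relations n).lift

theorem rep_brG (H : WordParam p s N) {n i : ℕ} (h : i + 1 < n) :
    H.rep n (brG p n (i + 1)) = tG s N i :=
  (H.relations n).lift_brG (by omega) h

theorem rep_brE (H : WordParam p s N) {n : ℕ} (h : 2 ≤ n) :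
    H.rep n (brE p n) = tCup s N * tCap N := (H.relations n).lift_brE h

theorem d_smul_rep_brF (H : WordParam p s N) {n : ℕ} (h : 2 ≤ n) :
    (p.d : A) • H.rep n (brF p n) = tCup s N * tCap N := by
  rw [← map_smul, ← brE_eq_smul_brF, H.rep_brE h]

theorem rep_brI (H : WordParam p s N) {n i : ℕ} (h : i + 1 < n) :
    H.rep n (brI p n (i + 1)) = heckeInv p (tG s N i) := by
  rw [brI, lift_heckeInv, H.rep_brG h]

theorem rep_brIncl (H : WordParam p s N) (n : ℕ) (x : QBr p n) :
    H.rep (n + 1) (brIncl p n x) = H.rep n x := by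
  have : (H.rep (n + 1)).comp (brIncl p n) = H.rep n := by
    refine QBr.algHom_ext (fun i h1 h2 => ?_) fun h => ?_
    · obtain ⟨i, rfl⟩ : ∃ j, i = j + 1 := ⟨i - 1, by omega⟩
      rw [AlgHom.comp_apply, brIncl_brG p h1 h2, H.rep_brG (by omega), H.rep_brG h2]
    · rw [AlgHom.comp_apply, brIncl_brE p h, H.rep_brE (by omega), H.rep_brE h]
  exact DFunLike.congr_fun this x

/-- This is where cup insertion becomes literal: an operator is sandwiched between cup and cap.
Multiplicativity holds because cap after cup is the scalar d. -/
theorem rep_cupMap (H : WordParam p s N) {m n : ℕ} (h : m + 2 ≤ n) (y : QBr p m) :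
    (p.d : A) • H.rep n (cupMap p h y) = tCup s N * H.rep m y * tCap N := by
  have hd : ∀ {x y : Module.End B (WFun B N)}, (p.d : A) • x = (p.d : A) • y → x = y :=
    fun {x y} h => by
      have := congrArg (((p.d⁻¹ : Aˣ) : A) • ·) h
      simpa only [smul_smul, Units.inv_mul, one_smul] using this
  induction y using QBr.induction with
  | hc c =>
    rw [Algebra.algebraMap_eq_smul_one, map_smul, map_smul, map_smul, cupMap_one, smul_comm,
      H.d_smul_rep_brF (by omega), map_one, mul_smul_comm, smul_mul_assoc, mul_one]
  | hg i h1 h2 =>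
    obtain ⟨i, rfl⟩ : ∃ j, i = j + 1 := ⟨i - 1, by omega⟩
    rw [cupMap_brG p h h1 h2, map_mul, ← smul_mul_assoc, H.d_smul_rep_brF (by omega),
      H.rep_brG (i := i + 2) (by omega), H.rep_brG h2, mul_assoc, tCap_mul_tG_add_two, mul_assoc]
  | he h2 =>
    have e : H.rep n (brT p n 0) =
        tG s N 1 * tG s N 2 * heckeInv p (tG s N 0) * heckeInv p (tG s N 1) := by
      simp only [brT, map_mul, zero_add]
      rw [H.rep_brG (i := 1) (by omega), H.rep_brG (i := 2) (by omega),
        H.rep_brI (i := 0) (by omega), H.rep_brI (i := 1) (by omega)]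
    have e1 := H.cap_twist_cup
    rw [cupMap_brE p h h2, brX, map_smul, map_mul, map_mul, e, ← mul_smul_comm,
      H.d_smul_rep_brF (by omega), ← smul_mul_assoc, ← smul_mul_assoc,
      H.d_smul_rep_brF (by omega), H.rep_brE h2]
    generalize tG s N 1 * tG s N 2 * heckeInv p (tG s N 0) * heckeInv p (tG s N 1) = E at *
    calc _ = tCup s N * (tCap N * E * tCup s N) * tCap N := by simp only [mul_assoc]
      _ = _ := by rw [e1]
  | hadd x y hx hy => simp only [map_add, smul_add, hx, hy, mul_add, add_mul]
  | hmul x y hx hy =>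
    refine hd ?_
    rw [cupMap_mul, map_mul, ← smul_mul_assoc, ← mul_smul_comm, hx, hy, map_mul]
    calc _ = tCup s N * H.rep m x * (tCap N * tCup s N) * H.rep m y * tCap N := by
          simp only [mul_assoc]
      _ = _ := by
          rw [H.cap_cup]
          simp only [mul_smul_comm, smul_mul_assoc, mul_one, mul_assoc]

/-- Capping and cupping once more turns the sandwich back into d² times the original operator, and d
is a unit. -/
theorem rep_eq_zero_of_cupMap (H : WordParam p s N) {m n : ℕ} (h : m + 2 ≤ n) {y : QBr p m}
    (hy : H.rep n (cupMap p h y) = 0) : H.rep m y = 0 := by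
  have e := H.rep_cupMap h y
  rw [hy, smul_zero] at e
  have e2 : tCap N * (tCup s N * H.rep m y * tCap N) * tCup s N =
      (p.d : A) • (p.d : A) • H.rep m y := by
    calc _ = (tCap N * tCup s N) * H.rep m y * (tCap N * tCup s N) := by simp only [mul_assoc]
      _ = _ := by
        rw [H.cap_cup]
        simp only [mul_smul_comm, smul_mul_assoc, mul_one, one_mul]
  rw [← e, mul_zero, zero_mul] at e2
  have := congrArg (fun z => ((p.d⁻¹ : Aˣ) : A) • ((p.d⁻¹ : Aˣ) : A) • z) e2
  simp only [smul_zero] at this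
  rw [smul_comm ((p.d⁻¹ : Aˣ) : A) (p.d : A) _, smul_smul, smul_smul, smul_smul] at this
  simpa using this.symm

end WordParam

end WordRep

/-! ### Quantum traces on words -/

section PartialTrace

variable {B : Type*} [CommRing B] (s : B) {N : ℕ}

/-- Substitution of the letter `a` at position `n`. -/
def tSub (B : Type*) [CommRing B] {N : ℕ} (n : ℕ) (a : Fin (N + 1)) : Module.End B (WFun B N) where
  toFun v w := v (Function.update w n a)
  map_add' _ _ := rfl
  map_smul' _ _ := rfl

/-- The functions supported on words with the letter `a` at position `n`. -/
def tIns (B : Type*) [CommRing B] {N : ℕ} (n : ℕ) (a : Fin (N + 1)) : Module.End B (WFun B N) where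
  toFun v w := if w n = a then v (Function.update w n 0) else 0
  map_add' u v := by funext w; simp only [Pi.add_apply]; split_ifs <;> simp
  map_smul' c v := by funext w; simp only [Pi.smul_apply, RingHom.id_apply]; split_ifs <;> simp

theorem tSub_apply (n : ℕ) (a : Fin (N + 1)) (v : WFun B N) (w : ℕ → Fin (N + 1)) :
    tSub B n a v w = v (Function.update w n a) := rfl

theorem tIns_apply (n : ℕ) (a : Fin (N + 1)) (v : WFun B N) (w : ℕ → Fin (N + 1)) :
    tIns B n a v w = if w n = a then v (Function.update w n 0) else 0 := rfl

theorem update_comp_swap {L : Type*} (w : ℕ → L) {i n : ℕ} (h : i + 1 < n) (a : L) :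
    Function.update w n a ∘ Equiv.swap i (i + 1) =
      Function.update (w ∘ Equiv.swap i (i + 1)) n a := by
  funext j
  simp only [Function.comp_apply, Function.update_apply, Equiv.swap_apply_def]
  split_ifs <;> first | rfl | omega

theorem tSub_mul_tG {i n : ℕ} (h : i + 1 < n) (a : Fin (N + 1)) :
    tSub B n a * tG s N i = tG s N i * tSub B n a := by
  refine LinearMap.ext fun v => funext fun w => ?_
  simp only [Module.End.mul_apply, tSub_apply, tG_apply, update_comp_swap w h]
  rw [Function.update_of_ne (by omega), Function.update_of_ne (by omega)]

theorem tIns_mul_tG {i n : ℕ} (h : i + 1 < n) (a : Fin (N + 1)) :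
    tIns B n a * tG s N i = tG s N i * tIns B n a := by
  refine LinearMap.ext fun v => funext fun w => ?_
  have e : (w ∘ Equiv.swap i (i + 1)) n = w n := by
    rw [Function.comp_apply, Equiv.swap_apply_of_ne_of_ne (by omega) (by omega)]
  simp only [Module.End.mul_apply, tIns_apply, tG_apply, update_comp_swap w h, e]
  rw [Function.update_of_ne (by omega), Function.update_of_ne (by omega)]
  split_ifs <;> ring

theorem update_wcons {L : Type*} (w : ℕ → L) (n : ℕ) (a c : L) :
    Function.update (wcons c w) (n + 1) a = wcons c (Function.update w n a) := by
  funext j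
  cases j with
  | zero => rfl
  | succ j => simp only [wcons, Function.update_apply, Nat.add_right_cancel_iff]

theorem tSub_mul_tCup_tCap {n : ℕ} (h : 2 ≤ n) (a : Fin (N + 1)) :
    tSub B n a * (tCup s N * tCap N) = tCup s N * tCap N * tSub B n a := by
  obtain ⟨n, rfl⟩ := exists_add_two h
  refine LinearMap.ext fun v => funext fun w => ?_
  obtain ⟨b, w, rfl⟩ := exists_wcons w
  obtain ⟨c, w, rfl⟩ := exists_wcons w
  simp only [Module.End.mul_apply, tSub_apply, update_wcons, tCup_wcons, tCap_apply]

theorem tIns_mul_tCup_tCap {n : ℕ} (h : 2 ≤ n) (a : Fin (N + 1)) :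
    tIns B n a * (tCup s N * tCap N) = tCup s N * tCap N * tIns B n a := by
  obtain ⟨n, rfl⟩ := exists_add_two h
  refine LinearMap.ext fun v => funext fun w => ?_
  obtain ⟨b, w, rfl⟩ := exists_wcons w
  obtain ⟨c, w, rfl⟩ := exists_wcons w
  simp only [Module.End.mul_apply, tIns_apply, update_wcons, tCup_wcons, tCap_apply, wcons]
  by_cases h1 : w n = a <;> simp [h1]

/-- Sandwiching an operator between `tSub` and `tIns` extracts its diagonal entry at the letter a in
position n. The letter 0 serves as filler: diagonal entries of operators not touching position n
differ from the operators only by substitution of the filler, which `tTr_tSub` removes. -/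
theorem tSub_mul_tIns (n : ℕ) (a : Fin (N + 1)) :
    tSub B n a * tIns B n a = tSub B n 0 := by
  refine LinearMap.ext fun v => funext fun w => ?_
  simp only [Module.End.mul_apply, tSub_apply, tIns_apply, Function.update_self,
    Function.update_idem, if_true]

theorem tSub_comm {m n : ℕ} (h : m ≠ n) (a b : Fin (N + 1)) :
    tSub B m a * tSub B n b = tSub B n b * tSub B m a := by
  refine LinearMap.ext fun v => funext fun w => ?_
  simp only [Module.End.mul_apply, tSub_apply]
  rw [Function.update_comm h]

theorem tSub_tG_tIns (m : ℕ) (a : Fin (N + 1)) (v : WFun B N) (w : ℕ → Fin (N + 1)) :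
    (tSub B (m + 1) a * tG s N m * tIns B (m + 1) a) v w =
      twA s (w m) a * tSub B (m + 1) 0 v w := by
  have e1 : Function.update w (m + 1) a m = w m := Function.update_of_ne (by omega) _ _
  simp only [Module.End.mul_apply, tSub_apply, tG_apply, tIns_apply, Function.update_self, e1,
    if_true, Function.update_idem, Function.comp_apply, Equiv.swap_apply_right]
  split_ifs with h
  · rw [h, twB_self, zero_mul, add_zero]
  · rw [mul_zero, add_zero]

/-- The weights of the quantum trace. -/
def tW (s : B) (a : Fin (N + 1)) : B := (s ^ 2) ^ (N - (a : ℕ))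

theorem tW_mul (a : Fin (N + 1)) : tW s a * (s ^ 2) ^ (a : ℕ) = (s ^ 2) ^ N := by
  rw [tW, ← pow_add, Nat.sub_add_cancel (by omega)]

theorem sum_tW : ∑ a : Fin (N + 1), tW s a = ∑ a : Fin (N + 1), (s ^ 2) ^ (a : ℕ) := by
  rw [← Equiv.sum_comp Fin.revPerm]
  refine Finset.sum_congr rfl fun a _ => ?_
  rw [tW, Fin.revPerm_apply, Fin.val_rev]
  congr 1
  omega

theorem twA_rev (a b : Fin (N + 1)) : twA s b.rev a.rev = twA s a b := by
  rcases lt_trichotomy a b with h | rfl | h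
  · rw [twA_of_lt s h, twA_of_lt s (Fin.rev_lt_rev.2 h)]
  · rw [twA_self, twA_self]
  · rw [twA_of_gt s h, twA_of_gt s (Fin.rev_lt_rev.2 h)]

/-- Reversing the order of the letters turns the trace weights q^{N-a} into the cup weights, and the
claim into `sum_twA`. -/
theorem sum_tW_twA (b : Fin (N + 1)) :
    ∑ a : Fin (N + 1), tW s a * twA s b a = (s ^ 2) ^ (N + 1) := by
  rw [← sum_twA s b.rev, ← Equiv.sum_comp Fin.revPerm]
  refine Finset.sum_congr rfl fun a _ => ?_
  rw [Fin.revPerm_apply, ← twA_rev, Fin.rev_rev, tW, Fin.val_rev, mul_comm]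
  congr 2
  omega

theorem tSub_tSub_tG (m : ℕ) (a b : Fin (N + 1)) :
    tSub B m b * tSub B (m + 1) a * tG s N m =
      twA s b a • (tSub B m b * tSub B (m + 1) a) + twB s b a • (tSub B m a * tSub B (m + 1) b) := by
  refine LinearMap.ext fun v => funext fun w => ?_
  have e : Function.update (Function.update w m b) (m + 1) a ∘ Equiv.swap m (m + 1) =
      Function.update (Function.update w m a) (m + 1) b := by
    funext j
    simp only [Function.comp_apply, Function.update_apply, Equiv.swap_apply_def]
    split_ifs <;> first | rfl | omega
  simp only [Module.End.mul_apply, tSub_apply, tG_apply, LinearMap.add_apply, LinearMap.smul_apply,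
    Pi.add_apply, Pi.smul_apply, smul_eq_mul, e]
  rw [Function.update_self, Function.update_of_ne (by omega), Function.update_self]

theorem tG_tIns_tIns (m : ℕ) (a b : Fin (N + 1)) :
    tG s N m * (tIns B (m + 1) a * tIns B m b) =
      twA s b a • (tIns B (m + 1) a * tIns B m b) +
        twB s b a • (tIns B (m + 1) b * tIns B m a) := by
  refine LinearMap.ext fun v => funext fun w => ?_
  have e : Function.update (Function.update (w ∘ Equiv.swap m (m + 1)) (m + 1) 0) m 0 =
      Function.update (Function.update w (m + 1) 0) m 0 := by
    funext j
    simp only [Function.comp_apply, Function.update_apply, Equiv.swap_apply_def]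
    split_ifs <;> rfl
  have e1 : ∀ (w : ℕ → Fin (N + 1)) c, Function.update w (m + 1) c m = w m :=
    fun w c => Function.update_of_ne (by omega) _ _
  simp only [Module.End.mul_apply, tIns_apply, tG_apply, LinearMap.add_apply, LinearMap.smul_apply,
    Pi.add_apply, Pi.smul_apply, smul_eq_mul, e1, e, Function.comp_apply, Equiv.swap_apply_left,
    Equiv.swap_apply_right]
  congr 1
  · by_cases h1 : w (m + 1) = a
    · by_cases h2 : w m = b
      · rw [h1, h2]
      · simp only [if_neg h2, ite_self, mul_zero]
    · simp only [if_neg h1, mul_zero]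
  · by_cases h1 : w (m + 1) = b
    · by_cases h2 : w m = a
      · rw [h1, h2, twB_comm]
        simp
      · simp only [if_neg h2, ite_self, mul_zero]
    · simp only [if_neg h1, ite_self, mul_zero]

open Classical in
/-- The quantum trace over the first `n` letters. -/
def tTr (s : B) (N : ℕ) : ℕ → Module.End B (WFun B N) →ₗ[B] B
  | 0 => (LinearMap.proj (fun _ => 0)).comp
      (LinearMap.applyₗ (Pi.single (fun _ => 0) 1 : WFun B N))
  | n + 1 => ∑ a : Fin (N + 1), tW s a • (tTr s N n).comp
      ((LinearMap.mulLeft B (tSub B n a)).comp (LinearMap.mulRight B (tIns B n a)))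

theorem tTr_succ (n : ℕ) (Z : Module.End B (WFun B N)) : tTr s N (n + 1) Z =
    ∑ a : Fin (N + 1), tW s a * tTr s N n (tSub B n a * (Z * tIns B n a)) := by
  simp [tTr, LinearMap.sum_apply]

theorem tTr_zero_tSub (m : ℕ) (Z : Module.End B (WFun B N)) :
    tTr s N 0 (tSub B m 0 * Z) = tTr s N 0 Z := by
  simp only [tTr, LinearMap.comp_apply, LinearMap.applyₗ_apply_apply, LinearMap.proj_apply,
    Module.End.mul_apply, tSub_apply]
  exact congrArg _ (Function.update_eq_self m (fun _ => (0 : Fin (N + 1))))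

theorem tTr_tSub {m n : ℕ} (h : n ≤ m) (Z : Module.End B (WFun B N)) :
    tTr s N n (tSub B m 0 * Z) = tTr s N n Z := by
  induction n generalizing Z with
  | zero => exact tTr_zero_tSub s m Z
  | succ n ih =>
    rw [tTr_succ, tTr_succ]
    refine Finset.sum_congr rfl fun a _ => ?_
    rw [mul_assoc, ← mul_assoc (tSub B n a), tSub_comm (by omega), mul_assoc, ih (by omega)]

theorem tTr_comm_tG {i n : ℕ} (h : i + 1 < n) (Z : Module.End B (WFun B N)) :
    tTr s N n (tG s N i * Z) = tTr s N n (Z * tG s N i) := by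
  induction n generalizing Z with
  | zero => omega
  | succ n ih =>
    rcases Nat.lt_or_ge (i + 1) n with h1 | h1
    · rw [tTr_succ, tTr_succ]
      refine Finset.sum_congr rfl fun a _ => ?_
      rw [mul_assoc (tG s N i), ← mul_assoc (tSub B n a), tSub_mul_tG s h1, mul_assoc, ih h1,
        mul_assoc Z, ← tIns_mul_tG s h1]
      simp only [mul_assoc]
    · obtain rfl : n = i + 1 := by omega
      simp only [tTr_succ, Finset.mul_sum]
      have e1 : ∀ a b : Fin (N + 1), tSub B i b * (tSub B (i + 1) a * (tG s N i * Z *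
          tIns B (i + 1) a) * tIns B i b) = twA s b a • (tSub B i b * tSub B (i + 1) a * Z *
            (tIns B (i + 1) a * tIns B i b)) + twB s b a • (tSub B i a * tSub B (i + 1) b * Z *
            (tIns B (i + 1) a * tIns B i b)) := by
        intro a b
        calc _ = (tSub B i b * tSub B (i + 1) a * tG s N i) * (Z *
                (tIns B (i + 1) a * tIns B i b)) := by simp only [mul_assoc]
          _ = _ := by
            rw [tSub_tSub_tG]
            simp only [add_mul, smul_mul_assoc, mul_assoc]
      have e2 : ∀ a b : Fin (N + 1), tSub B i b * (tSub B (i + 1) a * (Z * tG s N i *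
          tIns B (i + 1) a) * tIns B i b) = twA s b a • (tSub B i b * tSub B (i + 1) a * Z *
            (tIns B (i + 1) a * tIns B i b)) + twB s b a • (tSub B i b * tSub B (i + 1) a * Z *
            (tIns B (i + 1) b * tIns B i a)) := by
        intro a b
        calc _ = tSub B i b * tSub B (i + 1) a * Z *
                (tG s N i * (tIns B (i + 1) a * tIns B i b)) := by simp only [mul_assoc]
          _ = _ := by
            rw [tG_tIns_tIns]
            simp only [mul_add, mul_smul_comm, mul_assoc]
      simp only [e1, e2, map_add, mul_add, map_smul, Finset.sum_add_distrib]
      congr 1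
      -- The exchanged terms on the two sides correspond under swapping a and b. They agree because
      -- the product of the two trace weights is symmetric.
      rw [Finset.sum_comm]
      refine Finset.sum_congr rfl fun a _ => Finset.sum_congr rfl fun b _ => ?_
      rw [twB_comm]
      ring

/-- Tracing the R-matrix over its second letter leaves the scalar q^{N+1}, by `sum_tW_twA`. The
commutation hypotheses say that x and y do not touch that letter, so they can be pulled out of the
partial trace. -/
theorem tTr_markov (n : ℕ) {x y : Module.End B (WFun B N)}
    (hx : ∀ a, Commute (tSub B (n + 1) a) x) (hy : ∀ a, Commute (tIns B (n + 1) a) y) :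
    tTr s N (n + 2) (x * tG s N n * y) = (s ^ 2) ^ (N + 1) * tTr s N (n + 1) (x * y) := by
  have hsum : ∑ a : Fin (N + 1), tW s a • (tSub B (n + 1) a * tG s N n * tIns B (n + 1) a) =
      ((s ^ 2) ^ (N + 1)) • tSub B (n + 1) (0 : Fin (N + 1)) := by
    refine LinearMap.ext fun v => funext fun w => ?_
    rw [LinearMap.sum_apply, Finset.sum_apply]
    simp only [LinearMap.smul_apply, Pi.smul_apply, tSub_tG_tIns, smul_eq_mul, ← mul_assoc]
    rw [← Finset.sum_mul, sum_tW_twA]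
  rw [tTr_succ]
  have e : ∀ a : Fin (N + 1), tSub B (n + 1) a * (x * tG s N n * y * tIns B (n + 1) a) =
      x * (tSub B (n + 1) a * tG s N n * tIns B (n + 1) a) * y := by
    intro a
    calc _ = (tSub B (n + 1) a * x) * tG s N n * (y * tIns B (n + 1) a) := by
          simp only [mul_assoc]
      _ = _ := by rw [(hx a).eq, ← (hy a).eq]; simp only [mul_assoc]
  have e' : ∀ a : Fin (N + 1), tW s a * tTr s N (n + 1) (tSub B (n + 1) a *
      (x * tG s N n * y * tIns B (n + 1) a)) = tTr s N (n + 1)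
        (x * (tW s a • (tSub B (n + 1) a * tG s N n * tIns B (n + 1) a)) * y) := by
    intro a
    rw [e a, mul_smul_comm, smul_mul_assoc, map_smul, smul_eq_mul]
  rw [Finset.sum_congr rfl fun a _ => e' a, ← map_sum, ← Finset.sum_mul, ← Finset.mul_sum, hsum,
    mul_smul_comm, smul_mul_assoc, map_smul, ← (hx 0).eq, mul_assoc, tTr_tSub s le_rfl,
    smul_eq_mul]

theorem tTr_incl (n : ℕ) {x : Module.End B (WFun B N)} (hx : ∀ a, Commute (tSub B n a) x) :
    tTr s N (n + 1) x = (∑ a : Fin (N + 1), (s ^ 2) ^ (a : ℕ)) * tTr s N n x := by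
  rw [tTr_succ, ← sum_tW, Finset.sum_mul]
  refine Finset.sum_congr rfl fun a _ => ?_
  rw [← mul_assoc, (hx a).eq, mul_assoc, tSub_mul_tIns, ← (hx 0).eq, tTr_tSub s le_rfl]

theorem tTr_zero_one : tTr s N 0 1 = 1 := by
  simp [tTr]

theorem tTr_two_cup : tTr s N 2 (tCup s N * tCap N) =
    (s ^ 2) ^ N * ∑ a : Fin (N + 1), (s ^ 2) ^ (a : ℕ) := by
  have e : ∀ a b : Fin (N + 1), tTr s N 0 (tSub B 0 b * (tSub B 1 a * (tCup s N * tCap N *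
      tIns B 1 a) * tIns B 0 b)) = if b = a then (s ^ 2) ^ (b : ℕ) else 0 := by
    intro a b
    have e0 : ∀ a b : Fin (N + 1), Function.update (Function.update
        (fun _ => (0 : Fin (N + 1)) : ℕ → Fin (N + 1)) 0 b) 1 a =
        wcons b (wcons a fun _ => 0) := by
      intro a b
      funext j
      rcases j with _ | _ | j <;> simp [wcons]
    have e1 : ∀ c : Fin (N + 1), Function.update (Function.update
        (wcons c (wcons c fun _ => (0 : Fin (N + 1)))) 1 0) 0 0 = fun _ => 0 := by
      intro c
      funext j
      rcases j with _ | _ | j <;> simp [wcons]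
    simp only [tTr, LinearMap.comp_apply, LinearMap.applyₗ_apply_apply, LinearMap.proj_apply,
      Module.End.mul_apply, tSub_apply, tIns_apply, e0, tCup_wcons, tCap_apply]
    by_cases hab : b = a
    · subst hab
      rw [if_pos rfl, if_pos rfl, Finset.sum_eq_single b]
      · simp [wcons, e1]
      · intro c _ hc
        simp [wcons, hc]
      · simp
    · rw [if_neg hab, if_neg hab]
  simp only [tTr_succ, e]
  rw [← sum_tW, Finset.mul_sum]
  refine Finset.sum_congr rfl fun a _ => ?_
  rw [Finset.sum_eq_single a, if_pos rfl, tW_mul, mul_comm]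
  · intro b _ hb
    rw [if_neg hb, mul_zero]
  · simp

end PartialTrace

/-! ### The normalised quantum trace is a Markov family -/

section WordTrace

variable {A B : Type*} [CommRing A] [CommRing B] [Algebra A B] {p : BrParam A} {s : B} {N : ℕ}

namespace WordParam

theorem commute_tSub (H : WordParam p s N) (n : ℕ) (a : Fin (N + 1)) (x : QBr p n) :
    Commute (tSub B n a) (H.rep n x) := by
  induction x using QBr.induction with
  | hc c => rw [AlgHom.commutes]; exact Algebra.commute_algebraMap_right c _
  | hg i h1 h2 =>
    obtain ⟨i, rfl⟩ : ∃ j, i = j + 1 := ⟨i - 1, by omega⟩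
    rw [H.rep_brG h2]
    exact tSub_mul_tG s h2 a
  | he h => rw [H.rep_brE h]; exact tSub_mul_tCup_tCap s h a
  | hadd x y hx hy => rw [map_add]; exact hx.add_right hy
  | hmul x y hx hy => rw [map_mul]; exact hx.mul_right hy

theorem commute_tIns (H : WordParam p s N) (n : ℕ) (a : Fin (N + 1)) (x : QBr p n) :
    Commute (tIns B n a) (H.rep n x) := by
  induction x using QBr.induction with
  | hc c => rw [AlgHom.commutes]; exact Algebra.commute_algebraMap_right c _
  | hg i h1 h2 =>
    obtain ⟨i, rfl⟩ : ∃ j, i = j + 1 := ⟨i - 1, by omega⟩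
    rw [H.rep_brG h2]
    exact tIns_mul_tG s h2 a
  | he h => rw [H.rep_brE h]; exact tIns_mul_tCup_tCap s h a
  | hadd x y hx hy => rw [map_add]; exact hx.add_right hy
  | hmul x y hx hy => rw [map_mul]; exact hx.mul_right hy

/-- The normalized quantum trace. -/
def trace (H : WordParam p s N) (n : ℕ) : QBr p n →ₗ[A] B :=
  (((p.d⁻¹) ^ n : Aˣ) : A) • ((tTr s N n).restrictScalars A).comp (H.rep n).toLinearMap

theorem trace_apply (H : WordParam p s N) (n : ℕ) (x : QBr p n) :
    H.trace n x = (((p.d⁻¹) ^ n : Aˣ) : A) • tTr s N n (H.rep n x) := rfl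

theorem trace_zero_one (H : WordParam p s N) : H.trace 0 1 = 1 := by
  rw [trace_apply, pow_zero, Units.val_one, one_smul, map_one, tTr_zero_one]

theorem markovFamily (H : WordParam p s N) : MarkovFamily p H.trace where
  incl n x := by
    rw [trace_apply, H.rep_brIncl, tTr_incl s n fun a => H.commute_tSub n a x, ← H.map_d,
      ← smul_eq_mul, algebraMap_smul, smul_smul, trace_apply]
    congr 1
    rw [← Units.val_mul, pow_succ, inv_mul_cancel_right]
  conj n h hh := by
    induction hh using Algebra.adjoin_induction with
    | mem h hh =>
      obtain ⟨i, h1, h2, rfl⟩ := hh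
      obtain ⟨i, rfl⟩ : ∃ j, i = j + 1 := ⟨i - 1, by omega⟩
      intro x
      rw [trace_apply, trace_apply, map_mul (H.rep n), map_mul (H.rep n), H.rep_brG h2,
        tTr_comm_tG s h2]
    | algebraMap c => intro x; rw [Algebra.commutes]
    | add x y _ _ hx hy => intro z; rw [add_mul, mul_add, map_add, map_add, hx, hy]
    | mul x y _ _ hx hy => intro z; rw [mul_assoc, hx, mul_assoc, hy, mul_assoc]
  markov n hn x y := by
    obtain ⟨n, rfl⟩ : ∃ j, n = j + 1 := ⟨n - 1, by omega⟩
    rw [trace_apply, map_mul (H.rep _), map_mul (H.rep _), H.rep_brIncl, H.rep_brIncl,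
      H.rep_brG (by omega),
      tTr_markov s n (fun a => H.commute_tSub _ a x) (fun a => H.commute_tIns _ a y), ← H.map_r,
      ← smul_eq_mul, algebraMap_smul, smul_smul, trace_apply, smul_smul,
      ← map_mul (H.rep _)]
    congr 1
    push_cast
    ring
  cup := by
    have h1 : tTr s N 2 1 = (∑ a : Fin (N + 1), (s ^ 2) ^ (a : ℕ)) ^ 2 := by
      rw [tTr_incl s 1 fun a => Commute.one_right _, tTr_incl s 0 fun a => Commute.one_right _,
        tTr_zero_one]
      ring
    have hr : algebraMap A B ((p.r * p.q⁻¹ : Aˣ) : A) = (s ^ 2) ^ N := by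
      have hu : IsUnit (s ^ 2) := by
        rw [← H.map_q]; exact p.q.isUnit.map _
      refine hu.mul_right_cancel ?_
      rw [← pow_succ, ← H.map_r, ← H.map_q, ← map_mul, ← Units.val_mul, inv_mul_cancel_right]
    rw [trace_apply, trace_apply, map_one, h1, brF, map_smul, H.rep_brE le_rfl]
    rw [← algebraMap_smul B ((p.d⁻¹ : Aˣ) : A), map_smul, tTr_two_cup, algebraMap_smul, ← H.map_d,
      ← hr, ← map_pow, ← map_mul]
    simp only [Algebra.smul_def, ← map_mul]
    congr 1
    have hd : ((p.d⁻¹ : Aˣ) : A) * (p.d : A) = 1 := Units.inv_mul p.d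
    push_cast
    linear_combination ((p.d⁻¹ : Aˣ) : A) ^ 2 * p.r * ((p.q⁻¹ : Aˣ) : A) *
      (1 - (((p.d⁻¹ : Aˣ) : A) * p.d + 1)) * hd
end WordParam

end WordTrace

end


noncomputable section

/-! ### Combinatorics of Brauer diagrams -/

section BrauerIndex

/-- Indices for the standard words in the generators of the symmetric group. -/
inductive HIdx : ℕ → Type
  | nil : HIdx 0
  | snoc {m : ℕ} (v : HIdx m) (i : Fin (m + 1)) : HIdx (m + 1)

/-- The word with the given index, for an arbitrary choice of the `g_i`. -/
def hVal {M : Type*} [Monoid M] (g : ℕ → M) : {m : ℕ} → HIdx m → M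
  | _, .nil => 1
  | m + 1, .snoc v i => hVal g v * downProd g (i + 1) (m - i)

/-- The adjacent transpositions. -/
def adjSwap (i : ℕ) : Equiv.Perm ℕ := Equiv.swap (i - 1) i

theorem adjSwap_succ (i : ℕ) : adjSwap (i + 1) = Equiv.swap i (i + 1) := rfl

theorem adjSwap_inv (i : ℕ) : (adjSwap i)⁻¹ = adjSwap i := Equiv.swap_inv _ _

theorem upProd_adjSwap_inv (a l x : ℕ) : (upProd adjSwap (a + 1) l)⁻¹ x =
    if x = a then a + l else if a < x ∧ x ≤ a + l then x - 1 else x := by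
  induction l with
  | zero =>
    rw [upProd_zero, inv_one, Equiv.Perm.one_apply]
    split_ifs <;> omega
  | succ l ih =>
    rw [upProd_succ, mul_inv_rev, Equiv.Perm.mul_apply, ih, adjSwap_inv,
      show a + 1 + l = a + l + 1 by omega, adjSwap_succ, Equiv.swap_apply_def]
    split_ifs <;> omega

theorem downProd_adjSwap_inv (a l x : ℕ) : (downProd adjSwap (a + 1) l)⁻¹ x =
    if x = a + l then a else if a ≤ x ∧ x < a + l then x + 1 else x := by
  induction l generalizing x with
  | zero =>
    rw [downProd_zero, inv_one, Equiv.Perm.one_apply]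
    split_ifs <;> omega
  | succ l ih =>
    rw [downProd_succ, mul_inv_rev, Equiv.Perm.mul_apply, ih, adjSwap_inv,
      show a + 1 + l = a + l + 1 by omega, adjSwap_succ, Equiv.swap_apply_def]
    split_ifs <;> omega

theorem apply_lt_of_fix {π : Equiv.Perm ℕ} {n : ℕ} (h : ∀ x, n ≤ x → π x = x) {x : ℕ}
    (hx : x < n) : π x < n := by
  by_contra hc
  have := π.injective (h _ (not_lt.1 hc))
  omega

/-- The permutation of a standard word. -/
def hPerm {m : ℕ} (v : HIdx m) : Equiv.Perm ℕ := hVal adjSwap v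

theorem hPerm_snoc {m : ℕ} (v : HIdx m) (i : Fin (m + 1)) :
    hPerm (.snoc v i) = hPerm v * downProd adjSwap (i + 1) (m - i) := rfl

theorem hPerm_of_le {m : ℕ} (v : HIdx m) {x : ℕ} (hx : m ≤ x) : hPerm v x = x := by
  induction v with
  | nil => rfl
  | @snoc m v i ih =>
    have e : downProd adjSwap ((i : ℕ) + 1) (m - i) x = x := by
      rw [← Equiv.Perm.eq_inv_iff_eq, downProd_adjSwap_inv]
      split_ifs <;> omega
    rw [hPerm_snoc, Equiv.Perm.mul_apply, e, ih (by omega)]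

/-- The last recorded coset index is the preimage of the top point, so it can be read off and
cancelled. -/
theorem hPerm_injective {m : ℕ} : Function.Injective (hPerm (m := m)) := by
  intro v v' h
  induction v with
  | nil => cases v'; rfl
  | @snoc m v i ih =>
    cases v' with
    | snoc v' i' =>
      rw [hPerm_snoc, hPerm_snoc] at h
      have key : ∀ (v : HIdx m) (i : Fin (m + 1)),
          (hPerm v * downProd adjSwap ((i : ℕ) + 1) (m - i))⁻¹ m = i := by
        intro v i
        rw [mul_inv_rev, Equiv.Perm.mul_apply, Equiv.Perm.inv_eq_iff_eq.2 (hPerm_of_le v le_rfl).symm,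
          downProd_adjSwap_inv, if_pos (by omega)]
      obtain rfl : i = i' := Fin.ext (by rw [← key v i, h, key])
      rw [ih (mul_right_cancel h)]

theorem RIdx.two_mul_le {k n : ℕ} (y : RIdx k n) : 2 * k ≤ n := by
  induction y <;> omega

/-- The inverse of the permutation of a standard word. -/
def rPerm {k n : ℕ} (y : RIdx k n) : Equiv.Perm ℕ := (rVal adjSwap adjSwap y)⁻¹

theorem rPerm_cup {k n : ℕ} (y : RIdx k n) (j : Fin (n + 1)) (x : ℕ) : rPerm (.cup y j) x =
    (downProd adjSwap ((j : ℕ) + 1) (n - j))⁻¹ (rPerm y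
      ((upProd adjSwap (2 * k + 1) (n - 2 * k))⁻¹
        ((upProd adjSwap (2 * k + 1 + 1) (n - 2 * k))⁻¹ x))) := by
  simp only [rPerm, rVal, mul_inv_rev, Equiv.Perm.mul_apply]

theorem rPerm_of_le {k n : ℕ} (y : RIdx k n) {x : ℕ} (hx : n ≤ x) : rPerm y x = x := by
  induction y generalizing x with
  | nil n => rfl
  | keep y ih => exact ih (by omega)
  | @cup k n y j ih =>
    have hk := y.two_mul_le
    have e1 : (upProd adjSwap (2 * k + 1 + 1) (n - 2 * k))⁻¹ x = x := by
      rw [upProd_adjSwap_inv]; split_ifs <;> omega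
    have e2 : (upProd adjSwap (2 * k + 1) (n - 2 * k))⁻¹ x = x := by
      rw [upProd_adjSwap_inv]; split_ifs <;> omega
    rw [rPerm_cup, e1, e2, ih (by omega), downProd_adjSwap_inv]
    split_ifs <;> omega

theorem rPerm_lt {k n : ℕ} (y : RIdx k n) {x : ℕ} (hx : x < n) : rPerm y x < n :=
  apply_lt_of_fix (fun _ => rPerm_of_le y) hx

/-- The increasing map which omits the value `j`. -/
def skip (j x : ℕ) : ℕ := if x < j then x else x + 1

theorem skip_injective (j : ℕ) : Function.Injective (skip j) := by
  intro x y h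
  simp only [skip] at h
  split_ifs at h <;> omega

theorem rPerm_cup_lt {k n : ℕ} (y : RIdx k n) (j : Fin (n + 1)) {x : ℕ} (hx : x < 2 * k) :
    rPerm (.cup y j) x = skip j (rPerm y x) := by
  have hk := y.two_mul_le
  have h1 := rPerm_lt y (show x < n by omega)
  rw [rPerm_cup, upProd_adjSwap_inv (2 * k + 1), if_neg (by omega), if_neg (by omega), upProd_adjSwap_inv,
    if_neg (by omega), if_neg (by omega), downProd_adjSwap_inv, skip]
  split_ifs <;> omega

theorem rPerm_cup_left {k n : ℕ} (y : RIdx k n) (j : Fin (n + 1)) :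
    rPerm (.cup y j) (2 * k) = j := by
  have hk := y.two_mul_le
  rw [rPerm_cup, upProd_adjSwap_inv (2 * k + 1), if_neg (by omega), if_neg (by omega), upProd_adjSwap_inv,
    if_pos rfl, rPerm_of_le y (by omega), downProd_adjSwap_inv, if_pos (by omega)]

theorem rPerm_cup_right {k n : ℕ} (y : RIdx k n) (j : Fin (n + 1)) :
    rPerm (.cup y j) (2 * k + 1) = n + 1 := by
  have hk := y.two_mul_le
  rw [rPerm_cup, upProd_adjSwap_inv (2 * k + 1), if_pos rfl, upProd_adjSwap_inv, if_neg (by omega),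
    if_neg (by omega), rPerm_of_le y (by omega), downProd_adjSwap_inv]
  split_ifs <;> omega

/-- The horizontal edges of the diagram with the given index. -/
def edges {k n : ℕ} (y : RIdx k n) : Finset (ℕ × ℕ) :=
  (Finset.range k).image fun i => (rPerm y (2 * i), rPerm y (2 * i + 1))

theorem mem_edges {k n : ℕ} {y : RIdx k n} {e : ℕ × ℕ} :
    e ∈ edges y ↔ ∃ i < k, (rPerm y (2 * i), rPerm y (2 * i + 1)) = e := by
  simp [edges]

theorem card_edges {k n : ℕ} (y : RIdx k n) : (edges y).card = k := by
  rw [edges, Finset.card_image_of_injective, Finset.card_range]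
  intro i j h
  have := (rPerm y).injective (Prod.ext_iff.1 h).1
  omega

/-- The new cup joins j to the new last point, and the old points are relabelled in increasing order
around j. -/
theorem edges_cup {k n : ℕ} (y : RIdx k n) (j : Fin (n + 1)) : edges (.cup y j) =
    insert ((j : ℕ), n + 1) ((edges y).image (Prod.map (skip j) (skip j))) := by
  rw [edges, Finset.range_add_one, Finset.image_insert, rPerm_cup_left, rPerm_cup_right, edges,
    Finset.image_image]
  congr 1
  refine Finset.image_congr fun i hi => ?_
  have hi : i < k := by simpa using hi
  simp only [Function.comp_apply, Prod.map_apply]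
  rw [rPerm_cup_lt y j (by omega), rPerm_cup_lt y j (by omega)]

theorem mem_edges_cup {k n : ℕ} (y : RIdx k n) (j : Fin (n + 1)) :
    ((j : ℕ), n + 1) ∈ edges (.cup y j) := by
  rw [edges_cup]
  exact Finset.mem_insert_self _ _

theorem snd_lt_of_mem_edges {k n : ℕ} {y : RIdx k n} {e : ℕ × ℕ} (h : e ∈ edges y) : e.2 < n := by
  obtain ⟨i, hi, rfl⟩ := mem_edges.1 h
  have := y.two_mul_le
  exact rPerm_lt y (by omega)

theorem fst_lt_snd_of_mem_edges {k n : ℕ} {y : RIdx k n} {e : ℕ × ℕ} (h : e ∈ edges y) :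
    e.1 < e.2 := by
  induction y generalizing e with
  | nil n => simp [edges] at h
  | keep y ih => exact ih h
  | cup y j ih =>
    rw [edges_cup, Finset.mem_insert, Finset.mem_image] at h
    rcases h with rfl | ⟨e, he, rfl⟩
    · exact j.isLt
    · have := ih he
      simp only [Prod.map_fst, Prod.map_snd, skip]
      split_ifs <;> omega

theorem skip_image_snd_lt {k n : ℕ} {y : RIdx k n} {j : ℕ} {e : ℕ × ℕ}
    (h : e ∈ (edges y).image (Prod.map (skip j) (skip j))) : e.2 < n + 1 := by
  obtain ⟨e, he, rfl⟩ := Finset.mem_image.1 h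
  have := snd_lt_of_mem_edges he
  simp only [Prod.map_snd, skip]
  split_ifs <;> omega

/-- Whether the last point lies on an edge distinguishes `keep` from `cup`, and its partner is j.
Erasing that edge and undoing the relabelling gives the edges of the smaller diagram. -/
theorem edges_injective {k n : ℕ} : Function.Injective (edges (k := k) (n := n)) := by
  intro y y' h
  induction y with
  | nil n => cases y'; rfl
  | @keep k n y ih =>
    cases y' with
    | keep y' => rw [ih (y' := y') h]
    | cup y' j =>
      have h1 := mem_edges_cup y' j
      rw [← h] at h1
      have := snd_lt_of_mem_edges (y := y) h1
      simp at this
  | @cup k n y j ih =>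
    cases y' with
    | keep y' =>
      have h1 := mem_edges_cup y j
      rw [h] at h1
      have := snd_lt_of_mem_edges (y := y') h1
      simp at this
    | cup y' j' =>
      rw [edges_cup, edges_cup] at h
      have hj : ((j : ℕ), n + 1) ∈ insert ((j' : ℕ), n + 1)
          ((edges y').image (Prod.map (skip j') (skip j'))) := by
        rw [← h]; exact Finset.mem_insert_self _ _
      have hjj : j = j' := by
        rcases Finset.mem_insert.1 hj with e | e
        · exact Fin.ext (Prod.ext_iff.1 e).1
        · exact absurd (skip_image_snd_lt e) (by simp)
      subst hjj
      have hn : ∀ z : RIdx k n, ((j : ℕ), n + 1) ∉ (edges z).image (Prod.map (skip j) (skip j)) :=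
        fun z hz => absurd (skip_image_snd_lt hz) (by simp)
      have h2 := congrArg (fun s => s.erase ((j : ℕ), n + 1)) h
      simp only [Finset.erase_insert (hn _)] at h2
      rw [ih (Finset.image_injective ((skip_injective j).prodMap (skip_injective j)) h2)]

/-- A colouring of the first `n` points in which the points `2i` and `2i+1` have the same colour
for `i < k`, and points have different colours otherwise. -/
structure IsPairing {L : Type*} (n k : ℕ) (t : ℕ → L) : Prop where
  pair : ∀ i < k, t (2 * i) = t (2 * i + 1)
  eq_or : ∀ i < n, ∀ j < n, t i = t j → i = j ∨ (i < 2 * k ∧ j < 2 * k ∧ i / 2 = j / 2)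

/-- The colouring separates all points except the ends of a common edge of y, so every edge of the
other diagram with equally coloured ends is an edge of y. The orientation agrees since edges are
listed with the smaller end first. -/
theorem edges_subset {L : Type*} {n k k' : ℕ} {t : ℕ → L} {y : RIdx k n} (ht : IsPairing n k t)
    {y' : RIdx k' n}
    (h : ∀ i < k', t ((rPerm y)⁻¹ (rPerm y' (2 * i))) = t ((rPerm y)⁻¹ (rPerm y' (2 * i + 1)))) :
    edges y' ⊆ edges y := by
  intro e he
  have he' := he
  obtain ⟨i, hi, rfl⟩ := mem_edges.1 he
  have hk := y'.two_mul_le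
  have hk' := y.two_mul_le
  have h1 := h i hi
  have hf : ∀ x, n ≤ x → (rPerm y)⁻¹ x = x := fun x hx =>
    Equiv.Perm.inv_eq_iff_eq.2 (rPerm_of_le y hx).symm
  have ha := apply_lt_of_fix hf (rPerm_lt y' (show 2 * i < n by omega))
  have hb := apply_lt_of_fix hf (rPerm_lt y' (show 2 * i + 1 < n by omega))
  have hne : (rPerm y)⁻¹ (rPerm y' (2 * i)) ≠ (rPerm y)⁻¹ (rPerm y' (2 * i + 1)) := fun hh => by
    have := (rPerm y').injective ((rPerm y)⁻¹.injective hh)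
    omega
  have e1 : rPerm y' (2 * i) = rPerm y ((rPerm y)⁻¹ (rPerm y' (2 * i))) := by simp
  have e2 : rPerm y' (2 * i + 1) = rPerm y ((rPerm y)⁻¹ (rPerm y' (2 * i + 1))) := by simp
  have hlt := fst_lt_snd_of_mem_edges he'
  rw [e1, e2] at hlt ⊢
  generalize (rPerm y)⁻¹ (rPerm y' (2 * i)) = a at *
  generalize (rPerm y)⁻¹ (rPerm y' (2 * i + 1)) = b at *
  rcases ht.eq_or a ha b hb h1 with h2 | ⟨h2, h3, h4⟩
  · exact absurd h2 hne
  rcases Nat.lt_or_ge a b with h5 | h5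
  · refine mem_edges.2 ⟨a / 2, by omega, ?_⟩
    rw [show 2 * (a / 2) = a by omega, show a + 1 = b by omega]
  · have h6 : (rPerm y b, rPerm y a) ∈ edges y := mem_edges.2 ⟨b / 2, by omega, by
      rw [show 2 * (b / 2) = b by omega, show b + 1 = a by omega]⟩
    have := fst_lt_snd_of_mem_edges h6
    dsimp only at this
    omega

theorem exists_isPairing {n k N : ℕ} (hN : n ≤ N + 1) :
    ∃ t : ℕ → Fin (N + 1), IsPairing n k t := by
  refine ⟨fun i => if i < 2 * k then Fin.ofNat (N + 1) (2 * (i / 2)) else Fin.ofNat (N + 1) i,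
    fun i hi => ?_, fun i hi j hj h => ?_⟩
  · rw [if_pos (by omega), if_pos (by omega)]
    congr 2
    omega
  · have hv : ∀ x, x < N + 1 → ((Fin.ofNat (N + 1) x : Fin (N + 1)) : ℕ) = x := fun x hx =>
      Nat.mod_eq_of_lt hx
    have h' := congrArg (fun z : Fin (N + 1) => (z : ℕ)) h
    split_ifs at h' with h1 h2 h2
    all_goals rw [hv _ (by omega), hv _ (by omega)] at h'; omega

theorem IsPairing.comp {L : Type*} {n m k : ℕ} (h : m + 2 * k = n) {t : ℕ → L}
    (ht : IsPairing n k t) {π : Equiv.Perm ℕ} (hπ : ∀ x, m ≤ x → π x = x) :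
    IsPairing n k fun x => if x < 2 * k then t x else t (π (x - 2 * k) + 2 * k) where
  pair i hi := by rw [if_pos (by omega), if_pos (by omega)]; exact ht.pair i hi
  eq_or i hi j hj e := by
    have hb : ∀ x, 2 * k ≤ x → x < n → π (x - 2 * k) + 2 * k < n := fun x h1 h2 => by
      have := apply_lt_of_fix hπ (show x - 2 * k < m by omega)
      omega
    split_ifs at e with h1 h2 h2
    · exact ht.eq_or i hi j hj e
    · have := ht.eq_or i hi _ (hb j (by omega) hj) e
      omega
    · have := ht.eq_or _ (hb i (by omega) hi) j hj e
      omega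
    · rcases ht.eq_or _ (hb i (by omega) hi) _ (hb j (by omega) hj) e with h3 | h3
      · have := π.injective (show π (i - 2 * k) = π (j - 2 * k) by omega)
        omega
      · omega

/-- Indices for the spanning set of the `q`-Brauer algebra on `n` strands. -/
structure BrIdx (n : ℕ) where
  k : ℕ
  m : ℕ
  h : m + 2 * k = n
  left : RIdx k n
  mid : HIdx m
  right : RIdx k n

end BrauerIndex

end


noncomputable section

/-! ### The spanning set indexed by Brauer diagrams -/

section Standard

variable {R : Type*} [CommRing R] (p : BrParam R) {n : ℕ}

/-- The element of the `q`-Brauer algebra with the given index. -/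
def brVal (i : BrIdx n) : QBr p n :=
  brRev p n (rVal (brG p n) (brI p n) i.left) * cupPow p i.k i.h (hVal (brG p i.m) i.mid) *
    rVal (brG p n) (brI p n) i.right

theorem heckeSub_le_span_hVal {m : ℕ} (hm : m ≤ n) {x : QBr p n} (hx : x ∈ heckeInt p n 1 m) :
    x ∈ Submodule.span R (Set.range fun v : HIdx m => hVal (brG p n) v) := by
  induction m generalizing x with
  | zero =>
    obtain ⟨c, rfl⟩ := heckeInt_self p (by omega) hx
    exact Submodule.smul_mem _ _ (Submodule.subset_span ⟨.nil, rfl⟩)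
  | succ m ih =>
    refine Submodule.span_le.2 ?_ (heckeInt_succ_le_span p le_rfl (by omega) (by omega) hx)
    rintro _ ⟨y, hy, j, l, hj, hjl, rfl⟩
    have hy' := ih (by omega) hy
    clear hy
    induction hy' using Submodule.span_induction with
    | zero => simp
    | add y z _ _ hy hz => simp only [add_mul]; exact Submodule.add_mem _ hy hz
    | smul c y _ hy => simp only [smul_mul_assoc]; exact Submodule.smul_mem _ c hy
    | mem z hz =>
      obtain ⟨v, rfl⟩ := hz
      refine Submodule.subset_span ⟨.snoc v ⟨j - 1, by omega⟩, ?_⟩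
      obtain ⟨j, rfl⟩ : ∃ i, j = i + 1 := ⟨j - 1, by omega⟩
      simp only [hVal, Nat.add_sub_cancel]
      rw [show m - j = l by omega]

theorem exists_cupPow_eq {m k : ℕ} (h : m + 2 * k = n) {x : QBr p n}
    (hx : x ∈ heckeInt p n (2 * k + 1) n) :
    ∃ y ∈ heckeSub p m, cupPow p k h y = eBar p n k * x := by
  induction hx using Algebra.adjoin_induction with
  | mem x hx =>
    obtain ⟨i, h1, h2, rfl⟩ := hx
    refine ⟨brG p m (i - 2 * k), Algebra.subset_adjoin ⟨_, by omega, by omega, rfl⟩, ?_⟩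
    rw [cupPow_brG p h (by omega) (by omega), Nat.sub_add_cancel (by omega)]
  | algebraMap c =>
    refine ⟨c • 1, Subalgebra.smul_mem _ (one_mem _) c, ?_⟩
    rw [map_smul, cupPow_one_arg, Algebra.algebraMap_eq_smul_one, mul_smul_comm, mul_one]
  | add x y _ _ hx hy =>
    obtain ⟨x', hx', ex⟩ := hx
    obtain ⟨y', hy', ey⟩ := hy
    exact ⟨x' + y', add_mem hx' hy', by rw [map_add, ex, ey, mul_add]⟩
  | mul x y _ _ hx hy =>
    obtain ⟨x', hx', ex⟩ := hx
    obtain ⟨y', hy', ey⟩ := hy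
    refine ⟨x' * y', mul_mem hx' hy', ?_⟩
    rw [cupPow_mul, ex, ← eBar_mul_cupPow p h y', ey, ← mul_assoc, ← ex, ← mul_assoc,
      cupPow_mul_eBar, cupPow_mul_eBar, ex, mul_assoc]

/-- The normal form for ē_(k)H_n is applied on the right of aē_(k)b and, after reversal, on the
left. The leftover Hecke factors involve only the through strands and give the middle permutation
word. -/
theorem mem_span_brVal (x : QBr p n) : x ∈ Submodule.span R (Set.range (brVal p (n := n))) := by
  refine Submodule.span_le.2 ?_ (mem_span_hecke_eBar_hecke p x)
  rintro _ ⟨k, a, b, hk, ha, hb, rfl⟩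
  have hb' : eBar p n k * b ∈ _ := eBar_mul_heckeInt p hk le_rfl hb
  suffices H : ∀ z ∈ Submodule.span R {z | ∃ h ∈ heckeInt p n (2 * k + 1) n, ∃ y : RIdx k n,
      z = h * (eBar p n k * rVal (brG p n) (brI p n) y)}, ∀ a ∈ heckeSub p n,
      a * z ∈ Submodule.span R (Set.range (brVal p (n := n))) by
    have := H _ hb' a ha
    rwa [← mul_assoc] at this
  intro z hz
  induction hz using Submodule.span_induction with
  | zero => simp
  | add y z _ _ hy hz => intro a ha; rw [mul_add]; exact Submodule.add_mem _ (hy a ha) (hz a ha)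
  | smul c y _ hy => intro a ha; rw [mul_smul_comm]; exact Submodule.smul_mem _ c (hy a ha)
  | mem z hz =>
    obtain ⟨h, hh, y, rfl⟩ := hz
    intro a ha
    have hah : a * h ∈ heckeSub p n := mul_mem ha (mem_heckeSub_of_heckeInt p (by omega) le_rfl hh)
    have hrev := eBar_mul_heckeInt p hk le_rfl (brRev_mem p hah)
    have key : ∀ w ∈ Submodule.span R {z | ∃ h ∈ heckeInt p n (2 * k + 1) n, ∃ y : RIdx k n,
        z = h * (eBar p n k * rVal (brG p n) (brI p n) y)},
        brRev p n w * rVal (brG p n) (brI p n) y ∈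
          Submodule.span R (Set.range (brVal p (n := n))) := by
      intro w hw
      induction hw using Submodule.span_induction with
      | zero => simp
      | add y z _ _ hy hz => rw [map_add, add_mul]; exact Submodule.add_mem _ hy hz
      | smul c y _ hy => rw [map_smul, smul_mul_assoc]; exact Submodule.smul_mem _ c hy
      | mem w hw =>
        obtain ⟨g, hg, y', rfl⟩ := hw
        have hm : n - 2 * k + 2 * k = n := by omega
        obtain ⟨x', hx', ex⟩ := exists_cupPow_eq p hm (brRev_mem p hg)
        rw [brRev_mul, brRev_mul, brRev_eBar p hk, mul_assoc (brRev p n _), ← ex]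
        have hx'' := heckeSub_le_span_hVal p le_rfl hx'
        clear ex hx'
        induction hx'' using Submodule.span_induction with
        | zero => simp
        | add y z _ _ hy hz =>
          rw [map_add, mul_add, add_mul]; exact Submodule.add_mem _ hy hz
        | smul c y _ hy =>
          rw [map_smul, mul_smul_comm, smul_mul_assoc]; exact Submodule.smul_mem _ c hy
        | mem w hw =>
          obtain ⟨v, rfl⟩ := hw
          exact Submodule.subset_span ⟨⟨k, n - 2 * k, hm, y', v, y⟩, rfl⟩
    have := key _ hrev
    rw [brRev_mul, brRev_brRev, brRev_eBar p hk] at this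
    simpa only [mul_assoc] using this

end Standard

/-! ### The specialisation q = 1 -/

section Classical

variable {B : Type*} [CommRing B] {N : ℕ}

/-- The action of a permutation on words. -/
def pOp (B : Type*) [CommRing B] (N : ℕ) (π : Equiv.Perm ℕ) : Module.End B (WFun B N) :=
  LinearMap.funLeft B B fun w => w ∘ π

theorem pOp_apply (π : Equiv.Perm ℕ) (v : WFun B N) (w : ℕ → Fin (N + 1)) :
    pOp B N π v w = v (w ∘ π) := rfl

theorem pOp_mul (π ρ : Equiv.Perm ℕ) : pOp B N (π * ρ) = pOp B N π * pOp B N ρ := rfl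

theorem pOp_one : pOp B N 1 = 1 := rfl

theorem tG_classical (i : ℕ) : tG (1 : B) N i = pOp B N (Equiv.swap i (i + 1)) := by
  refine LinearMap.ext fun v => funext fun w => ?_
  rw [tG_apply, pOp_apply]
  by_cases h : w i = w (i + 1)
  · rw [h, twA_self, twB_self, one_pow, one_mul, zero_mul, add_zero]
    congr 1
    funext j
    rw [Function.comp_apply, Equiv.swap_apply_def]
    split_ifs with h1 h2
    · rw [h1, h]
    · rw [h2, h]
    · rfl
  · rw [twB_of_ne _ h, one_mul]
    rcases lt_or_gt_of_ne h with h1 | h1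
    · rw [twA_of_lt _ h1, zero_mul, zero_add]
    · rw [twA_of_gt _ h1, one_pow, sub_self, zero_mul, zero_add]

theorem tCup_pow_apply (k : ℕ) (v : WFun B N) (w : ℕ → Fin (N + 1)) : (tCup (1 : B) N ^ k) v w =
    open Classical in
    if ∀ i < k, w (2 * i) = w (2 * i + 1) then v fun j => w (j + 2 * k) else 0 := by
  classical
  induction k generalizing w with
  | zero => simp
  | succ k ih =>
    rw [pow_succ', Module.End.mul_apply]
    change (if w 0 = w 1 then _ * (tCup (1 : B) N ^ k) v (fun i => w (i + 2)) else 0) = _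
    rw [one_pow, one_pow, one_mul, ih]
    by_cases h : w 0 = w 1
    · rw [if_pos h]
      refine ite_congr (propext ⟨fun h1 i hi => ?_, fun h1 i hi => h1 (i + 1) (by omega)⟩)
        (fun _ => rfl) fun _ => rfl
      rcases i with _ | i
      · exact h
      · exact h1 i (by omega)
    · rw [if_neg h, if_neg fun h1 => h (h1 0 (by omega))]

theorem tCap_single (u : ℕ → Fin (N + 1)) : open Classical in tCap N (Pi.single u (1 : B)) =
    if u 0 = u 1 then Pi.single (fun j => u (j + 2)) 1 else 0 := by
  classical
  obtain ⟨a, u, rfl⟩ := exists_wcons u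
  obtain ⟨b, u, rfl⟩ := exists_wcons u
  have hw : ∀ {c d : Fin (N + 1)} {w w' : ℕ → Fin (N + 1)}, wcons c w = wcons d w' ↔
      c = d ∧ w = w' := fun {c d w w'} =>
    ⟨fun h => ⟨congrFun h 0, funext fun j => congrFun h (j + 1)⟩, fun h => by rw [h.1, h.2]⟩
  funext w
  rw [tCap_apply]
  change _ = (if a = b then Pi.single u (1 : B) else 0 : WFun B N) w
  simp only [Pi.single_apply, hw]
  by_cases h : a = b
  · subst h
    rw [if_pos rfl, Pi.single_apply, Finset.sum_eq_single a]
    · simp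
    · intro c _ hc
      simp [hc]
    · simp
  · rw [if_neg h]
    refine Finset.sum_eq_zero fun c _ => if_neg fun hc => h (hc.1.symm.trans hc.2.1)

theorem tCap_pow_single (k : ℕ) (u : ℕ → Fin (N + 1)) : open Classical in
    (tCap N ^ k) (Pi.single u (1 : B)) =
      if ∀ i < k, u (2 * i) = u (2 * i + 1) then Pi.single (fun j => u (j + 2 * k)) 1 else 0 := by
  classical
  induction k generalizing u with
  | zero => simp
  | succ k ih =>
    rw [pow_succ, Module.End.mul_apply, tCap_single]
    by_cases h : u 0 = u 1
    · rw [if_pos h, ih]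
      refine ite_congr (propext ⟨fun h1 i hi => ?_, fun h1 i hi => h1 (i + 1) (by omega)⟩)
        (fun _ => rfl) fun _ => rfl
      rcases i with _ | i
      · exact h
      · exact h1 i (by omega)
    · rw [if_neg h, if_neg fun h1 => h (h1 0 (by omega)), map_zero]

variable {A : Type*} [CommRing A] [Algebra A B] {p : BrParam A}

namespace WordParam

theorem rep_cupPow {s : B} (H : WordParam p s N) {m n k : ℕ} (h : m + 2 * k = n) (x : QBr p m) :
    (p.d : A) ^ k • H.rep n (cupPow p k h x) = tCup s N ^ k * H.rep m x * tCap N ^ k := by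
  induction k generalizing n with
  | zero =>
    obtain rfl : m = n := h
    simp [cupPow_zero]
  | succ k ih =>
    obtain ⟨n, rfl⟩ : ∃ n', n = n' + 2 := ⟨n - 2, by omega⟩
    rw [cupPow_succ, pow_succ, mul_smul, H.rep_cupMap, ← smul_mul_assoc, ← mul_smul_comm,
      ih (by omega), pow_succ', pow_succ]
    simp only [mul_assoc]

/-- The element `x` and its reverse act by the permutation `π` and its inverse. -/
def Acts (H : WordParam p (1 : B) N) {n : ℕ} (x : QBr p n) (π : Equiv.Perm ℕ) : Prop :=
  H.rep n x = pOp B N π ∧ H.rep n (brRev p n x) = pOp B N π⁻¹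

variable {n : ℕ}

theorem Acts.one (H : WordParam p (1 : B) N) : H.Acts (1 : QBr p n) 1 :=
  ⟨by rw [map_one, pOp_one], by rw [brRev_one, map_one, inv_one, pOp_one]⟩

theorem Acts.mul {H : WordParam p (1 : B) N} {x y : QBr p n} {π ρ : Equiv.Perm ℕ}
    (hx : H.Acts x π) (hy : H.Acts y ρ) : H.Acts (x * y) (π * ρ) :=
  ⟨by rw [map_mul, hx.1, hy.1, pOp_mul], by
    rw [brRev_mul, map_mul, hx.2, hy.2, mul_inv_rev, pOp_mul]⟩

theorem Acts.upProd {H : WordParam p (1 : B) N} {f : ℕ → QBr p n} {π : ℕ → Equiv.Perm ℕ} {a l : ℕ}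
    (h : ∀ i, a ≤ i → i < a + l → H.Acts (f i) (π i)) : H.Acts (upProd f a l) (upProd π a l) := by
  induction l with
  | zero => exact Acts.one H
  | succ l ih => exact (ih fun i h1 h2 => h i h1 (by omega)).mul (h _ (by omega) (by omega))

theorem Acts.downProd {H : WordParam p (1 : B) N} {f : ℕ → QBr p n} {π : ℕ → Equiv.Perm ℕ}
    {a l : ℕ} (h : ∀ i, a ≤ i → i < a + l → H.Acts (f i) (π i)) :
    H.Acts (downProd f a l) (downProd π a l) := by
  induction l with
  | zero => exact Acts.one H
  | succ l ih => exact (h _ (by omega) (by omega)).mul (ih fun i h1 h2 => h i h1 (by omega))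

theorem acts_brG (H : WordParam p (1 : B) N) {i : ℕ} (h1 : 1 ≤ i) (h2 : i < n) :
    H.Acts (brG p n i) (adjSwap i) := by
  obtain ⟨i, rfl⟩ : ∃ j, i = j + 1 := ⟨i - 1, by omega⟩
  have e : H.rep n (brG p n (i + 1)) = pOp B N (adjSwap (i + 1)) := by
    rw [H.rep_brG h2, tG_classical, adjSwap_succ]
  exact ⟨e, by rw [brRev_brG, adjSwap_inv, e]⟩

theorem acts_brI (H : WordParam p (1 : B) N) {i : ℕ} (h1 : 1 ≤ i) (h2 : i < n) :
    H.Acts (brI p n i) (adjSwap i) := by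
  have hq : algebraMap A B ((p.q⁻¹ : Aˣ) : A) = 1 := by
    have h := congrArg (algebraMap A B) (Units.inv_mul p.q)
    rwa [map_mul, H.map_q, one_pow, mul_one, map_one] at h
  have e : H.rep n (brI p n i) = pOp B N (adjSwap i) := by
    rw [brI, lift_heckeInv, heckeInv, (H.acts_brG h1 h2).1, ← algebraMap_smul B,
      ← algebraMap_smul B (((p.q⁻¹ : Aˣ) : A) - 1), map_sub, hq, map_one, sub_self, one_smul,
      zero_smul, add_zero]
  exact ⟨e, by rw [brRev_brI, adjSwap_inv, e]⟩

theorem acts_hVal (H : WordParam p (1 : B) N) {m : ℕ} (hm : m ≤ n) (v : HIdx m) :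
    H.Acts (hVal (brG p n) v) (hPerm v) := by
  induction v with
  | nil => exact Acts.one H
  | snoc v i ih =>
    exact (ih (by omega)).mul (Acts.downProd fun j h1 h2 => H.acts_brG (by omega) (by omega))

theorem acts_rVal (H : WordParam p (1 : B) N) {k b : ℕ} (hb : b ≤ n) (y : RIdx k b) :
    H.Acts (rVal (brG p n) (brI p n) y) (rPerm y)⁻¹ := by
  rw [rPerm, inv_inv]
  induction y with
  | nil _ => exact Acts.one H
  | keep y ih => exact ih (by omega)
  | @cup k b y j ih =>
    have := y.two_mul_le
    exact (((Acts.upProd fun j h1 h2 => H.acts_brI (by omega) (by omega)).mul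
      (Acts.upProd fun j h1 h2 => H.acts_brI (by omega) (by omega))).mul (ih (by omega))).mul
        (Acts.downProd fun j h1 h2 => H.acts_brG (by omega) (by omega))

/-- The condition for a matrix entry of `brVal p i` to be nonzero. -/
def _root_.BrIdx.Compatible (i : BrIdx n) (z z' : ℕ → Fin (N + 1)) : Prop :=
  (∀ l < i.k, z' (rPerm i.left (2 * l)) = z' (rPerm i.left (2 * l + 1))) ∧
    (∀ l < i.k, z (rPerm i.right (2 * l)) = z (rPerm i.right (2 * l + 1))) ∧
    ∀ j, z' (rPerm i.left (hPerm i.mid j + 2 * i.k)) = z (rPerm i.right (j + 2 * i.k))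

/-- At q = 1 the R-matrix is a plain transposition and the cup weights are 1. The element therefore
acts, up to d^k, as a Brauer diagram: a matrix entry is 1 exactly when the two colourings agree
along all edges. -/
theorem rep_brVal (H : WordParam p (1 : B) N) (i : BrIdx n) (z z' : ℕ → Fin (N + 1)) :
    open Classical in (p.d : A) ^ i.k • H.rep n (brVal p i) (Pi.single z 1) z' =
      if i.Compatible z z' then 1 else 0 := by
  classical
  obtain ⟨k, m, h, y, v, y'⟩ := i
  have e : (p.d : A) ^ k • H.rep n (brVal p ⟨k, m, h, y, v, y'⟩) =
      pOp B N (rPerm y) * (tCup 1 N ^ k * pOp B N (hPerm v) * tCap N ^ k) *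
        pOp B N (rPerm y')⁻¹ := by
    have e1 := (H.acts_rVal le_rfl y).2
    rw [inv_inv] at e1
    rw [brVal, map_mul, map_mul, e1, (H.acts_rVal le_rfl y').1,
      ← smul_mul_assoc, ← mul_smul_comm, H.rep_cupPow, (H.acts_hVal le_rfl v).1]
  have e2 : pOp B N (rPerm y')⁻¹ (Pi.single z 1) = Pi.single (z ∘ rPerm y') 1 := by
    funext w
    rw [pOp_apply, Pi.single_apply, Pi.single_apply]
    refine ite_congr (propext ⟨fun hw => ?_, fun hw => ?_⟩) (fun _ => rfl) fun _ => rfl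
    · rw [← hw]; funext j; simp
    · rw [hw]; funext j; simp
  have e3 := congrFun (LinearMap.congr_fun e (Pi.single z 1)) z'
  refine Eq.trans e3 ?_
  simp only [Module.End.mul_apply, e2, pOp_apply, tCup_pow_apply, tCap_pow_single]
  by_cases h1 : ∀ l < k, (z' ∘ rPerm y) (2 * l) = (z' ∘ rPerm y) (2 * l + 1)
  · by_cases h2 : ∀ l < k, (z ∘ rPerm y') (2 * l) = (z ∘ rPerm y') (2 * l + 1)
    · rw [if_pos h1, if_pos h2, Pi.single_apply]
      exact ite_congr (propext ⟨fun h3 => ⟨h1, h2, fun j => congrFun h3 j⟩, fun h3 => funext h3.2.2⟩)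
        (fun _ => rfl) fun _ => rfl
    · rw [if_pos h1, if_neg h2, if_neg fun h3 => h2 h3.2.1]
      rfl
  · rw [if_neg h1, if_neg fun h3 => h1 h3.1]

/-- With at least n colours, each edge of the diagram can receive its own colour. Such a colouring
detects the diagram among all those with at least as many horizontal edges, which gives
triangularity in k. -/
theorem _root_.BrIdx.exists_compatible_iff (i : BrIdx n) (hN : n ≤ N + 1) :
    ∃ z z' : ℕ → Fin (N + 1), i.Compatible z z' ∧
      ∀ i' : BrIdx n, i.k ≤ i'.k → i'.Compatible z z' → i' = i := by
  obtain ⟨k, m, h, y, v, y'⟩ := i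
  obtain ⟨t, ht⟩ := exists_isPairing (n := n) (k := k) hN
  have hinv : ∀ x, m ≤ x → (hPerm v)⁻¹ x = x := fun x hx =>
    Equiv.Perm.inv_eq_iff_eq.2 (hPerm_of_le v hx).symm
  have ht' := ht.comp h hinv
  -- The left colouring is twisted by the inverse of the middle permutation, so that the colours at
  -- the two ends of every through strand agree.
  set t' : ℕ → Fin (N + 1) :=
    fun x => if x < 2 * k then t x else t ((hPerm v)⁻¹ (x - 2 * k) + 2 * k) with hdef
  have e' : ∀ j, t' (j + 2 * k) = t ((hPerm v)⁻¹ j + 2 * k) := fun j => by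
    rw [hdef]
    simp only
    rw [if_neg (by omega), Nat.add_sub_cancel]
  refine ⟨fun x => t ((rPerm y')⁻¹ x), fun x => t' ((rPerm y)⁻¹ x), ⟨?_, ?_, ?_⟩, ?_⟩
  · intro l hl
    simpa using ht'.pair l hl
  · intro l hl
    simpa using ht.pair l hl
  · intro j
    simp [e']
  · rintro ⟨k', m', h', w, u, w'⟩ hk ⟨h1, h2, h3⟩
    simp only at hk h1 h2 h3
    -- The colours force the horizontal edges of the competitor into those of the given diagram on
    -- both sides. Since it has at least as many, the edge sets coincide, and the through strands
    -- then determine the permutation.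
    have s1 := edges_subset ht' h1
    have s2 := edges_subset ht h2
    have hkk : k' ≤ k := by
      rw [← card_edges w', ← card_edges y']
      exact Finset.card_le_card s2
    obtain rfl : k = k' := le_antisymm hk hkk
    obtain rfl : m = m' := by omega
    obtain rfl : w = y := edges_injective
      (Finset.eq_of_subset_of_card_le s1 (by rw [card_edges, card_edges]))
    obtain rfl : w' = y' := edges_injective
      (Finset.eq_of_subset_of_card_le s2 (by rw [card_edges, card_edges]))
    have h3 : ∀ j, t ((hPerm v)⁻¹ (hPerm u j) + 2 * k) = t (j + 2 * k) := fun j => by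
      simpa [e'] using h3 j
    obtain rfl : u = v := by
      refine hPerm_injective (Equiv.ext fun j => ?_)
      rcases Nat.lt_or_ge j m with hj | hj
      · have h4 := apply_lt_of_fix hinv (apply_lt_of_fix (fun _ => hPerm_of_le u) hj)
        rcases ht.eq_or _ (by omega) _ (by omega) (h3 j) with h5 | h5
        · exact Equiv.Perm.inv_eq_iff_eq.1 (by omega)
        · omega
      · rw [hPerm_of_le u hj, hPerm_of_le v hj]
    rfl

theorem algebraMap_eq_zero_of_sum (H : WordParam p (1 : B) N) (hN : n ≤ N + 1) (c : BrIdx n →₀ A)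
    (hc : H.rep n (c.sum fun i a => a • brVal p i) = 0) (i : BrIdx n) : algebraMap A B (c i) = 0 := by
  classical
  by_contra hi
  set S := c.support.filter fun i => algebraMap A B (c i) ≠ 0 with hS
  have hne : S.Nonempty := ⟨i, Finset.mem_filter.2 ⟨Finsupp.mem_support_iff.2 fun h0 => hi (by
    rw [h0, map_zero]), hi⟩⟩
  -- Among the indices with nonzero image of the coefficient, take one with the fewest horizontal
  -- edges; its detecting matrix entry then receives no other contribution.
  obtain ⟨i₀, hi₀, hmin⟩ := Finset.exists_min_image S BrIdx.k hne
  obtain ⟨z, z', hz, huniq⟩ := i₀.exists_compatible_iff hN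
  rw [Finsupp.sum, map_sum] at hc
  have hc' := congrFun (LinearMap.congr_fun hc (Pi.single z 1)) z'
  rw [LinearMap.sum_apply, Finset.sum_apply, Finset.sum_eq_single i₀] at hc'
  · have e := H.rep_brVal i₀ z z'
    rw [if_pos hz] at e
    rw [map_smul] at hc'
    change c i₀ • H.rep n (brVal p i₀) (Pi.single z 1) z' = 0 at hc'
    have := congrArg (fun b => (p.d : A) ^ i₀.k • b) hc'
    simp only [smul_zero] at this
    rw [smul_comm, e, Algebra.smul_def, mul_one] at this
    exact (Finset.mem_filter.1 hi₀).2 this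
  · intro i' hi' hne'
    rw [map_smul]
    change c i' • H.rep n (brVal p i') (Pi.single z 1) z' = 0
    by_cases h0 : algebraMap A B (c i') = 0
    · rw [Algebra.smul_def, h0, zero_mul]
    · have e := H.rep_brVal i' z z'
      rw [if_neg fun h1 => hne' (huniq i' (hmin i' (Finset.mem_filter.2 ⟨hi', h0⟩)) h1)] at e
      have hu : ((p.d⁻¹ : Aˣ) : A) ^ i'.k * (p.d : A) ^ i'.k = 1 := by
        rw [← mul_pow, Units.inv_mul, one_pow]
      have := congrArg (fun b => ((p.d⁻¹ : Aˣ) : A) ^ i'.k • b) e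
      simp only [smul_smul, hu, one_smul, smul_zero] at this
      rw [this, smul_zero]
  · intro h
    exact absurd (Finset.mem_filter.1 hi₀).1 h

end WordParam

end Classical

end


noncomputable section

/-! ### The generic ground ring and its specialisations -/

section GenericRing

open Polynomial

/-- The denominator `q d (1 + (q - 1) d)` of the generic ground ring. -/
def genDen : (ℤ[X])[X] := X * C X * (1 + (X - 1) * C X)

/-- The ring `ℤ[q, d]` with `q`, `d` and `r = 1 + (q - 1) d` inverted. -/
abbrev GenRing : Type := Localization.Away genDen

/-- The homomorphism from `ℤ[q, d]` with the given values of `q` and `d`. -/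
def polyEval {B : Type*} [CommRing B] (q d : B) : (ℤ[X])[X] →+* B :=
  eval₂RingHom (eval₂RingHom (Int.castRingHom B) d) q

theorem polyEval_X {B : Type*} [CommRing B] (q d : B) : polyEval q d X = q := by
  simp [polyEval]

theorem polyEval_C_X {B : Type*} [CommRing B] (q d : B) : polyEval q d (C X) = d := by
  simp [polyEval]

theorem polyEval_genDen {B : Type*} [CommRing B] (q d : B) :
    polyEval q d genDen = q * d * (1 + (q - 1) * d) := by
  simp only [genDen, map_mul, map_add, map_sub, map_one, polyEval_X, polyEval_C_X]

theorem genDen_ne_zero : genDen ≠ 0 := fun h => by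
  have := polyEval_genDen (1 : ℤ) 1
  rw [h, map_zero] at this
  norm_num at this

instance : IsDomain GenRing :=
  IsLocalization.isDomain_localization (powers_le_nonZeroDivisors_of_noZeroDivisors genDen_ne_zero)

instance : IsNoetherianRing GenRing :=
  IsLocalization.isNoetherianRing (Submonoid.powers genDen) GenRing inferInstance

theorem isUnit_of_dvd_genDen {f : (ℤ[X])[X]} (h : f ∣ genDen) :
    IsUnit (algebraMap (ℤ[X])[X] GenRing f) :=
  isUnit_of_dvd_unit (map_dvd _ h) (IsLocalization.Away.algebraMap_isUnit genDen)

/-- The parameters over the generic ground ring. -/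
def genParam : BrParam GenRing where
  q := (isUnit_of_dvd_genDen (f := X) (Dvd.intro _ (mul_assoc _ _ _).symm)).unit
  r := (isUnit_of_dvd_genDen (f := 1 + (X - 1) * C X) (Dvd.intro_left _ rfl)).unit
  d := (isUnit_of_dvd_genDen (f := C X) (Dvd.intro_left (X * (1 + (X - 1) * C X))
    (by rw [genDen]; ring))).unit
  rel := by
    simp only [IsUnit.unit_spec, map_add, map_mul, map_sub, map_one]
    ring

theorem genParam_q : (genParam.q : GenRing) = algebraMap _ _ (X : (ℤ[X])[X]) := rfl

theorem genParam_d : (genParam.d : GenRing) = algebraMap _ _ (C X : (ℤ[X])[X]) := rfl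

theorem genParam_r : (genParam.r : GenRing) = algebraMap _ _ (1 + (X - 1) * C X : (ℤ[X])[X]) := rfl

/-- The homomorphism from the generic ground ring with the given values of `q` and `d`. -/
def genEval {B : Type*} [CommRing B] (q d : B) (h : IsUnit (q * d * (1 + (q - 1) * d))) :
    GenRing →+* B :=
  IsLocalization.Away.lift genDen (g := polyEval q d) (by rwa [polyEval_genDen])

theorem genEval_algebraMap {B : Type*} [CommRing B] {q d : B}
    (h : IsUnit (q * d * (1 + (q - 1) * d))) (f : (ℤ[X])[X]) :
    genEval q d h (algebraMap _ _ f) = polyEval q d f :=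
  IsLocalization.Away.lift_eq _ _ f

theorem genEval_q {B : Type*} [CommRing B] {q d : B} (h : IsUnit (q * d * (1 + (q - 1) * d))) :
    genEval q d h genParam.q = q := by
  rw [genParam_q, genEval_algebraMap, polyEval_X]

theorem genEval_d {B : Type*} [CommRing B] {q d : B} (h : IsUnit (q * d * (1 + (q - 1) * d))) :
    genEval q d h genParam.d = d := by
  rw [genParam_d, genEval_algebraMap, polyEval_C_X]

theorem genEval_r {B : Type*} [CommRing B] {q d : B} (h : IsUnit (q * d * (1 + (q - 1) * d))) :
    genEval q d h genParam.r = 1 + (q - 1) * d := by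
  rw [genParam_r, genEval_algebraMap]
  simp only [map_mul, map_add, map_sub, map_one, polyEval_X, polyEval_C_X]

theorem genHom_ext {B : Type*} [CommRing B] {f g : GenRing →+* B}
    (hq : f genParam.q = g genParam.q) (hd : f genParam.d = g genParam.d) : f = g := by
  refine IsLocalization.ringHom_ext (Submonoid.powers genDen) (Polynomial.ringHom_ext' ?_ hq)
  exact Polynomial.ringHom_ext' (RingHom.ext_int _ _) hd

/-- The rationals, with `q = 1` and `d = N + 1`. -/
def ClassicalRing (_ : ℕ) : Type := ℚ

instance (N : ℕ) : Field (ClassicalRing N) := inferInstanceAs (Field ℚ)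

instance (N : ℕ) : CharZero (ClassicalRing N) := inferInstanceAs (CharZero ℚ)

theorem isUnit_classical (N : ℕ) : IsUnit ((1 : ClassicalRing N) * ((N + 1 : ℕ) : ClassicalRing N) *
    (1 + (1 - 1) * ((N + 1 : ℕ) : ClassicalRing N))) := by
  rw [sub_self, zero_mul, add_zero, mul_one, one_mul, isUnit_iff_ne_zero]
  exact Nat.cast_ne_zero.2 (Nat.succ_ne_zero N)

instance (N : ℕ) : Algebra GenRing (ClassicalRing N) :=
  (genEval 1 ((N + 1 : ℕ) : ClassicalRing N) (isUnit_classical N)).toAlgebra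

theorem classical_wordParam (N : ℕ) : WordParam genParam (1 : ClassicalRing N) N where
  map_q := (genEval_q (isUnit_classical N)).trans (one_pow 2).symm
  map_r := (genEval_r (isUnit_classical N)).trans (by simp)
  map_d := (genEval_d (isUnit_classical N)).trans (by simp)

/-- Rational power series in a variable `t`, with `q = (1 + t)²` and `d = 1 + q + ⋯ + q ^ N`. -/
def SeriesRing (_ : ℕ) : Type := PowerSeries ℚ

instance (N : ℕ) : CommRing (SeriesRing N) := inferInstanceAs (CommRing (PowerSeries ℚ))

instance (N : ℕ) : IsDomain (SeriesRing N) := inferInstanceAs (IsDomain (PowerSeries ℚ))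

/-- The square root of `q`. -/
def seriesRoot (N : ℕ) : SeriesRing N := (1 + PowerSeries.X : PowerSeries ℚ)

/-- The constant coefficient of a power series. -/
def seriesConst (N : ℕ) : SeriesRing N →+* ClassicalRing N :=
  (PowerSeries.constantCoeff : PowerSeries ℚ →+* ℚ)

theorem seriesConst_root (N : ℕ) : seriesConst N (seriesRoot N) = 1 := by
  change (PowerSeries.constantCoeff : PowerSeries ℚ →+* ℚ) (1 + PowerSeries.X) = 1
  simp

theorem isUnit_of_seriesConst {N : ℕ} {x : SeriesRing N} (h : seriesConst N x ≠ 0) : IsUnit x :=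
  PowerSeries.isUnit_iff_constantCoeff.2 (isUnit_iff_ne_zero.2 h)

theorem isUnit_series (N : ℕ) : IsUnit (seriesRoot N ^ 2 *
    (∑ c : Fin (N + 1), (seriesRoot N ^ 2) ^ (c : ℕ)) *
      (1 + (seriesRoot N ^ 2 - 1) * ∑ c : Fin (N + 1), (seriesRoot N ^ 2) ^ (c : ℕ))) := by
  refine isUnit_of_seriesConst ?_
  simp only [map_mul, map_add, map_sub, map_one, map_pow, map_sum, seriesConst_root, one_pow,
    sub_self, zero_mul, add_zero, mul_one, one_mul, Finset.sum_const, Finset.card_univ,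
    Fintype.card_fin, nsmul_eq_mul]
  exact Nat.cast_ne_zero.2 (Nat.succ_ne_zero N)

instance (N : ℕ) : Algebra GenRing (SeriesRing N) :=
  (genEval (seriesRoot N ^ 2) (∑ c : Fin (N + 1), (seriesRoot N ^ 2) ^ (c : ℕ))
    (isUnit_series N)).toAlgebra

theorem series_wordParam (N : ℕ) : WordParam genParam (seriesRoot N) N where
  map_q := genEval_q (isUnit_series N)
  map_r := (genEval_r (isUnit_series N)).trans (by
    rw [Fin.sum_univ_eq_sum_range (fun c => (seriesRoot N ^ 2) ^ c), mul_geom_sum]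
    ring)
  map_d := genEval_d (isUnit_series N)

/-- The constant coefficient, as a homomorphism over the generic ground ring. -/
def seriesConstHom (N : ℕ) : SeriesRing N →ₐ[GenRing] ClassicalRing N where
  __ := seriesConst N
  commutes' x := by
    have : (seriesConst N).comp (algebraMap GenRing (SeriesRing N)) =
        algebraMap GenRing (ClassicalRing N) := by
      refine genHom_ext ?_ ?_
      · rw [RingHom.comp_apply, (series_wordParam N).map_q, (classical_wordParam N).map_q, map_pow,
          seriesConst_root]
      · rw [RingHom.comp_apply, (series_wordParam N).map_d, (classical_wordParam N).map_d, map_sum]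
        simp only [map_pow, seriesConst_root]
    exact RingHom.congr_fun this x

theorem seriesConstHom_surjective (N : ℕ) : Function.Surjective (seriesConstHom N) := fun c =>
  ⟨(PowerSeries.C (R := ℚ) c : PowerSeries ℚ), PowerSeries.constantCoeff_C c⟩

/-- Clear denominators. The numerator at q = 1 is a polynomial in d with the infinitely many roots
N+1, hence zero, so q - 1 divides the numerator; the denominator is a unit. -/
theorem q_sub_one_dvd {a : GenRing} {n : ℕ}
    (h : ∀ N, n ≤ N → algebraMap GenRing (ClassicalRing N) a = 0) :
    (genParam.q : GenRing) - 1 ∣ a := by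
  obtain ⟨⟨s, f⟩, hs⟩ := IsLocalization.surj (Submonoid.powers genDen) a
  have hroot : ∀ N, n ≤ N → ((s.eval 1).eval ((N + 1 : ℕ) : ℤ)) = 0 := by
    intro N hN
    have h1 : polyEval 1 ((N + 1 : ℕ) : ClassicalRing N) s = 0 := by
      rw [← genEval_algebraMap (isUnit_classical N), ← hs, map_mul]
      have := h N hN
      change genEval _ _ _ a = 0 at this
      rw [this, zero_mul]
    have h2 : polyEval 1 ((N + 1 : ℕ) : ClassicalRing N) =
        (Int.castRingHom (ClassicalRing N)).comp
          ((evalRingHom ((N + 1 : ℕ) : ℤ)).comp (evalRingHom (1 : ℤ[X]))) := by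
      refine Polynomial.ringHom_ext' (Polynomial.ringHom_ext' (RingHom.ext_int _ _) ?_) ?_
      · simp [polyEval]
      · simp [polyEval]
    rw [h2] at h1
    exact Int.cast_eq_zero.1 h1
  have hz : s.eval 1 = 0 := by
    refine Polynomial.eq_zero_of_infinite_isRoot _ (Set.Infinite.mono ?_
      (Set.infinite_range_of_injective (f := fun N : ℕ => ((N + n + 1 : ℕ) : ℤ)) fun a b hab => ?_))
    · rintro _ ⟨N, rfl⟩
      exact hroot (N + n) (by omega)
    · simp only [Nat.cast_inj] at hab
      omega
  have hd : (X - C 1 : (ℤ[X])[X]) ∣ s := dvd_iff_isRoot.2 hz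
  have hd' := map_dvd (algebraMap (ℤ[X])[X] GenRing) hd
  simp only at hs
  rw [← hs, map_sub, map_one, map_one, ← genParam_q] at hd'
  exact (IsLocalization.map_units GenRing f).dvd_mul_right.1 hd'

theorem algebraMap_q_sub_one_ne_zero (N : ℕ) :
    algebraMap GenRing (SeriesRing N) ((genParam.q : GenRing) - 1) ≠ 0 := by
  rw [map_sub, (series_wordParam N).map_q, map_one]
  have h : (1 + PowerSeries.X : PowerSeries ℚ) ^ 2 - 1 ≠ 0 := by
    intro h
    have := congrArg (PowerSeries.coeff (R := ℚ) 2) h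
    rw [show ((1 + PowerSeries.X : PowerSeries ℚ) ^ 2 - 1) = PowerSeries.X ^ 2 +
      (PowerSeries.X + PowerSeries.X) by ring] at this
    simp [PowerSeries.coeff_X] at this
  exact h

theorem not_isUnit_q_sub_one : ¬ IsUnit ((genParam.q : GenRing) - 1) := fun h => by
  have := h.map (algebraMap GenRing (ClassicalRing 0))
  rw [map_sub, (classical_wordParam 0).map_q, map_one, one_pow, sub_self] at this
  exact not_isUnit_zero this

/-- Krull's intersection theorem: the generic ring is a Noetherian domain and q - 1 is not a unit,
because it vanishes in a classical specialisation. -/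
theorem eq_zero_of_forall_pow_dvd {a : GenRing}
    (h : ∀ j, ((genParam.q : GenRing) - 1) ^ j ∣ a) : a = 0 := by
  have h1 : a ∈ (⨅ j : ℕ, (Ideal.span {(genParam.q : GenRing) - 1}) ^ j) := by
    rw [Ideal.mem_iInf]
    intro j
    rw [Ideal.span_singleton_pow, Ideal.mem_span_singleton]
    exact h j
  rw [Ideal.iInf_pow_eq_bot_of_isDomain] at h1
  · exact h1
  · rw [Ne, Ideal.span_singleton_eq_top]
    exact not_isUnit_q_sub_one

end GenericRing

/-! ### Joint faithfulness, and the generic trace -/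

section Faithful

/-- The matrix coefficients of the generators are polynomials in s, so the representations are
compatible with specialisation. This links the power series representation to q = 1 by taking
constant coefficients. -/
theorem WordParam.map_rep {A B C : Type*} [CommRing A] [CommRing B] [CommRing C] [Algebra A B]
    [Algebra A C] {p : BrParam A} {s : B} {t : C} {N : ℕ} (H : WordParam p s N)
    (H' : WordParam p t N) (f : B →ₐ[A] C) (hf : f s = t) {n : ℕ} (x : QBr p n) (v : WFun B N) :
    f ∘ H.rep n x v = H'.rep n x (f ∘ v) := by
  subst hf
  induction x using QBr.induction generalizing v with
  | hc c =>
    rw [AlgHom.commutes, AlgHom.commutes]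
    funext w
    change f (c • v w) = c • f (v w)
    rw [map_smul]
  | hg i h1 h2 =>
    obtain ⟨i, rfl⟩ : ∃ j, i = j + 1 := ⟨i - 1, by omega⟩
    rw [H.rep_brG h2, H'.rep_brG h2]
    funext w
    rw [Function.comp_apply, tG_apply, tG_apply, map_add, map_mul, map_mul, twA, twA, twB, twB]
    simp only [apply_ite f, map_pow, map_sub, map_one, map_zero, Function.comp_apply]
  | he h =>
    rw [H.rep_brE h, H'.rep_brE h]
    funext w
    obtain ⟨a, w, rfl⟩ := exists_wcons w
    obtain ⟨b, w, rfl⟩ := exists_wcons w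
    rw [Function.comp_apply, Module.End.mul_apply, Module.End.mul_apply, tCup_wcons, tCup_wcons,
      apply_ite f, map_zero, map_mul, tCap_apply, tCap_apply, map_sum, map_pow, map_pow]
    rfl
  | hadd x y hx hy =>
    funext w
    have e1 := congrFun (hx v) w
    have e2 := congrFun (hy v) w
    rw [map_add, map_add, LinearMap.add_apply, LinearMap.add_apply, Function.comp_apply,
      Pi.add_apply, Pi.add_apply, map_add, ← e1, ← e2]
    rfl
  | hmul x y hx hy =>
    rw [map_mul, map_mul, Module.End.mul_apply, Module.End.mul_apply, hx, hy]

/-- Linear independence at q = 1 shows that every coefficient is divisible by q - 1, and the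
quotient again acts by zero. Infinite divisibility then kills the coefficients. -/
theorem eq_zero_of_rep_eq_zero {n : ℕ} {x : QBr genParam n}
    (h : ∀ N, (series_wordParam N).rep n x = 0) : x = 0 := by
  obtain ⟨c, rfl⟩ := (Finsupp.mem_span_range_iff_exists_finsupp).1 (mem_span_brVal genParam x)
  suffices H : ∀ j : ℕ, ∀ c : BrIdx n →₀ GenRing, (∀ N, (series_wordParam N).rep n
      (c.sum fun i a => a • brVal genParam i) = 0) →
        ∀ i, ((genParam.q : GenRing) - 1) ^ j ∣ c i by
    have : c = 0 := Finsupp.ext fun i => eq_zero_of_forall_pow_dvd fun j => H j c h i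
    rw [this, Finsupp.sum_zero_index]
  intro j
  induction j with
  | zero => intro c _ i; rw [pow_zero]; exact one_dvd _
  | succ j ih =>
    intro c hc i
    have hdvd : ∀ i, (genParam.q : GenRing) - 1 ∣ c i := by
      intro i
      refine q_sub_one_dvd (n := n) fun N hN => ?_
      refine (classical_wordParam N).algebraMap_eq_zero_of_sum (by omega) c ?_ i
      refine LinearMap.ext fun v => ?_
      -- Every rational function on words lifts to a power series one, so acting by zero over the
      -- series ring implies acting by zero at q = 1.
      obtain ⟨v, rfl⟩ := (seriesConstHom_surjective N).comp_left v
      rw [← (series_wordParam N).map_rep (classical_wordParam N) (seriesConstHom N)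
        (seriesConst_root N), hc N]
      funext w
      exact map_zero (seriesConstHom N)
    choose b hb using hdvd
    have hq : (genParam.q : GenRing) - 1 ≠ 0 := fun h0 => by
      apply algebraMap_q_sub_one_ne_zero 0
      rw [h0, map_zero]
    set c' : BrIdx n →₀ GenRing := Finsupp.onFinset c.support b fun i hi => by
      rw [Finsupp.mem_support_iff, hb]
      exact mul_ne_zero hq hi
    have hcc : c = ((genParam.q : GenRing) - 1) • c' := Finsupp.ext hb
    have hc' := ih c' fun N => by
      have e := hc N
      rw [hcc, ← Finsupp.linearCombination_apply, map_smul, map_smul] at e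
      refine LinearMap.ext fun v => funext fun w => ?_
      have e' : ((genParam.q : GenRing) - 1) • ((series_wordParam N).rep n
          (Finsupp.linearCombination _ (brVal genParam) c') v w) = 0 :=
        congrFun (LinearMap.congr_fun e v) w
      rw [Algebra.smul_def] at e'
      -- The factor q - 1 cancels because the series ring is a domain in which it is nonzero; this
      -- is the reason for deforming q = 1 to power series.
      exact (mul_eq_zero.1 e').resolve_left (algebraMap_q_sub_one_ne_zero N)
    rw [hb, pow_succ']
    exact mul_dvd_mul_left _ (hc' i)

theorem cupMap_genParam_injective {m n : ℕ} (h : m + 2 ≤ n) :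
    Function.Injective (cupMap genParam h) := by
  rw [injective_iff_map_eq_zero]
  intro x hx
  refine eq_zero_of_rep_eq_zero fun N => (series_wordParam N).rep_eq_zero_of_cupMap h ?_
  rw [hx, map_zero]

theorem genRing_eq_zero {a : GenRing} (h : ∀ N, algebraMap GenRing (SeriesRing N) a = 0) :
    a = 0 := by
  suffices H : ∀ j : ℕ, ∀ a : GenRing, (∀ N, algebraMap GenRing (SeriesRing N) a = 0) →
      ((genParam.q : GenRing) - 1) ^ j ∣ a from eq_zero_of_forall_pow_dvd fun j => H j a h
  intro j
  induction j with
  | zero => intro a _; rw [pow_zero]; exact one_dvd _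
  | succ j ih =>
    intro a ha
    obtain ⟨b, rfl⟩ := q_sub_one_dvd (n := 0) (a := a) fun N _ => by
      rw [← (seriesConstHom N).commutes, ha, map_zero]
    rw [pow_succ']
    refine mul_dvd_mul_left _ (ih b fun N => ?_)
    have e := ha N
    rw [map_mul] at e
    exact (mul_eq_zero.1 e).resolve_left (algebraMap_q_sub_one_ne_zero N)

theorem linearMap_genRing_injective :
    Function.Injective (Algebra.linearMap GenRing (∀ N, SeriesRing N)) := by
  rw [injective_iff_map_eq_zero]
  exact fun a ha => genRing_eq_zero fun N => congrFun ha N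

/-- The quantum traces for all `N`. -/
def piTrace (n : ℕ) : QBr genParam n →ₗ[GenRing] (∀ N, SeriesRing N) :=
  LinearMap.pi fun N => (series_wordParam N).trace n

theorem piTrace_markovFamily : MarkovFamily genParam piTrace where
  incl n x := funext fun N => (series_wordParam N).markovFamily.incl n x
  conj n h hh x := funext fun N => (series_wordParam N).markovFamily.conj n h hh x
  markov n hn x y := funext fun N => (series_wordParam N).markovFamily.markov n hn x y
  cup := funext fun N => (series_wordParam N).markovFamily.cup

theorem piTrace_zero_one : piTrace 0 1 = 1 := funext fun N => (series_wordParam N).trace_zero_one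

/-- The defining properties alone force all values to be generic multiples of the value at 1, which
is 1 in the product. Hence the values computed for the separate N are specialisations of one element
of the generic ring. -/
theorem piTrace_mem_range {n : ℕ} (x : QBr genParam n) :
    piTrace n x ∈ LinearMap.range (Algebra.linearMap GenRing (∀ N, SeriesRing N)) := by
  obtain ⟨c, hc⟩ := Submodule.mem_span_singleton.1 (piTrace_markovFamily.apply_mem_span x)
  exact ⟨c, by rw [← hc, piTrace_zero_one, Algebra.linearMap_apply, Algebra.algebraMap_eq_smul_one]⟩

/-- The extended trace over the generic ground ring. -/
def genTrace (n : ℕ) : QBr genParam n →ₗ[GenRing] GenRing :=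
  (LinearEquiv.ofInjective _ linearMap_genRing_injective).symm.toLinearMap.comp
    ((piTrace n).codRestrict _ piTrace_mem_range)

theorem linearMap_genTrace {n : ℕ} (x : QBr genParam n) :
    Algebra.linearMap GenRing (∀ N, SeriesRing N) (genTrace n x) = piTrace n x := by
  have := LinearEquiv.apply_symm_apply (LinearEquiv.ofInjective _ linearMap_genRing_injective)
    ((piTrace n).codRestrict _ piTrace_mem_range x)
  exact congrArg Subtype.val this

theorem genTrace_markovFamily : MarkovFamily genParam genTrace where
  incl n x := linearMap_genRing_injective (by
    rw [linearMap_genTrace, linearMap_genTrace, piTrace_markovFamily.incl])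
  conj n h hh x := linearMap_genRing_injective (by
    rw [linearMap_genTrace, linearMap_genTrace, piTrace_markovFamily.conj n h hh])
  markov n hn x y := linearMap_genRing_injective (by
    rw [map_smul, linearMap_genTrace, linearMap_genTrace, piTrace_markovFamily.markov n hn])
  cup := linearMap_genRing_injective (by
    rw [map_smul, linearMap_genTrace, linearMap_genTrace, piTrace_markovFamily.cup])

theorem genTrace_zero_one : genTrace 0 1 = 1 := linearMap_genRing_injective (by
  rw [linearMap_genTrace, piTrace_zero_one, Algebra.linearMap_apply, map_one])

/-- The left inverse `x ↦ e x e` of the embedding of the algebra on `m` strands as a corner. -/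
def genCorner (m : ℕ) : QBr genParam (m + 2) →ₗ[GenRing] QBr genParam m :=
  (LinearEquiv.ofInjective _ (cupMap_genParam_injective (le_refl (m + 2)))).symm.toLinearMap.comp
    (((LinearMap.mulRight GenRing (brF genParam (m + 2))).comp
      (LinearMap.mulLeft GenRing (brF genParam (m + 2)))).codRestrict _
        (brF_mul_mul_brF_mem genParam))

theorem cupMap_genCorner {m : ℕ} (x : QBr genParam (m + 2)) :
    cupMap genParam (le_refl (m + 2)) (genCorner m x) =
      brF genParam (m + 2) * x * brF genParam (m + 2) := by
  have := LinearEquiv.apply_symm_apply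
    (LinearEquiv.ofInjective _ (cupMap_genParam_injective (le_refl (m + 2))))
    (((LinearMap.mulRight GenRing (brF genParam (m + 2))).comp
      (LinearMap.mulLeft GenRing (brF genParam (m + 2)))).codRestrict _
        (brF_mul_mul_brF_mem genParam) x)
  exact congrArg Subtype.val this

theorem genCorner_cupMap {m : ℕ} (x : QBr genParam m) :
    genCorner m (cupMap genParam (le_refl (m + 2)) x) = x :=
  cupMap_genParam_injective le_rfl (by
    rw [cupMap_genCorner, brF_mul_cupMap, cupMap_mul_brF])

end Faithful

end


noncomputable section

/-! ### Base change to arbitrary parameters -/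

section BaseChange

open TensorProduct

variable {A R : Type*} [CommRing A] [CommRing R] [Algebra A R]

/-- The parameters over `R` are the images of the parameters over `A`. -/
structure BrParam.IsBaseChange (p : BrParam A) (p' : BrParam R) : Prop where
  q : Units.map (algebraMap A R : A →* R) p.q = p'.q
  r : Units.map (algebraMap A R : A →* R) p.r = p'.r
  d : Units.map (algebraMap A R : A →* R) p.d = p'.d

variable {p : BrParam A} {p' : BrParam R}

theorem baseChange_smul {M : Type*} [AddCommMonoid M] [Module A M] [Module R M] [IsScalarTower A R M]
    {u : Aˣ} {u' : Rˣ} (h : Units.map (algebraMap A R : A →* R) u = u') (x : M) :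
    (u : A) • x = (u' : R) • x := by
  rw [← h, ← algebraMap_smul R (u : A)]
  rfl

theorem baseChange_inv_smul {M : Type*} [AddCommMonoid M] [Module A M] [Module R M]
    [IsScalarTower A R M] {u : Aˣ} {u' : Rˣ} (h : Units.map (algebraMap A R : A →* R) u = u')
    (x : M) : ((u⁻¹ : Aˣ) : A) • x = ((u'⁻¹ : Rˣ) : R) • x :=
  baseChange_smul (by rw [map_inv, h]) x

theorem heckeInv_baseChange (hp : p.IsBaseChange p') {C : Type*} [Ring C] [Algebra A C]
    [Algebra R C] [IsScalarTower A R C] (x : C) : heckeInv p x = heckeInv p' x := by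
  rw [heckeInv, heckeInv, sub_smul, sub_smul, one_smul, one_smul, baseChange_inv_smul hp.q,
    baseChange_inv_smul hp.q]

theorem BrRelations.baseChange_iff (hp : p.IsBaseChange p') {C : Type*} [Ring C] [Algebra A C]
    [Algebra R C] [IsScalarTower A R C] {n : ℕ} {G : ℕ → C} {E : C} :
    BrRelations p n G E ↔ BrRelations p' n G E := by
  have hs : ∀ x : C, ((p.q : A) - 1) • x = ((p'.q : R) - 1) • x := fun x => by
    rw [sub_smul, sub_smul, one_smul, one_smul, baseChange_smul hp.q]
  constructor
  · intro H
    refine ⟨fun i h1 h2 => ?_, H.braid, H.far, fun h => ?_, H.e_far, fun h => ?_, fun h => ?_,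
      fun h => ?_, fun h => ?_, fun h => ?_, fun h => ?_⟩
    · rw [← hs, ← baseChange_smul hp.q]; exact H.quad i h1 h2
    · rw [← baseChange_smul hp.d]; exact H.e_sq h
    · rw [← baseChange_smul hp.q]; exact H.e_g1 h
    · rw [← baseChange_smul hp.q]; exact H.g1_e h
    · rw [← baseChange_smul hp.r]; exact H.e_g2_e h
    · rw [← heckeInv_baseChange hp, ← baseChange_inv_smul hp.q]; exact H.e_g2inv_e h
    · have := H.twist_left h
      simpa only [heckeInv_baseChange hp, twistWord] using this
    · have := H.twist_right h
      simpa only [heckeInv_baseChange hp, twistWord] using this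
  · intro H
    refine ⟨fun i h1 h2 => ?_, H.braid, H.far, fun h => ?_, H.e_far, fun h => ?_, fun h => ?_,
      fun h => ?_, fun h => ?_, fun h => ?_, fun h => ?_⟩
    · rw [hs, baseChange_smul hp.q]; exact H.quad i h1 h2
    · rw [baseChange_smul hp.d]; exact H.e_sq h
    · rw [baseChange_smul hp.q]; exact H.e_g1 h
    · rw [baseChange_smul hp.q]; exact H.g1_e h
    · rw [baseChange_smul hp.r]; exact H.e_g2_e h
    · rw [heckeInv_baseChange hp, baseChange_inv_smul hp.q]; exact H.e_g2inv_e h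
    · have := H.twist_left h
      simpa only [← heckeInv_baseChange hp, twistWord] using this
    · have := H.twist_right h
      simpa only [← heckeInv_baseChange hp, twistWord] using this

theorem BrRelations.map {C C' : Type*} [Ring C] [Ring C'] [Algebra A C] [Algebra A C'] {n : ℕ}
    {G : ℕ → C} {E : C} (H : BrRelations p n G E) (f : C →ₐ[A] C') :
    BrRelations p n (fun i => f (G i)) (f E) where
  quad i h1 h2 := by simpa using congrArg f (H.quad i h1 h2)
  braid i h1 h2 := by simpa using congrArg f (H.braid i h1 h2)
  far i j h1 h2 h3 := by simpa using congrArg f (H.far i j h1 h2 h3)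
  e_sq h := by simpa using congrArg f (H.e_sq h)
  e_far i h1 h2 := by simpa using congrArg f (H.e_far i h1 h2)
  e_g1 h := by simpa using congrArg f (H.e_g1 h)
  g1_e h := by simpa using congrArg f (H.g1_e h)
  e_g2_e h := by simpa using congrArg f (H.e_g2_e h)
  e_g2inv_e h := by simpa [lift_heckeInv] using congrArg f (H.e_g2inv_e h)
  twist_left h := by simpa [lift_heckeInv, twistWord] using congrArg f (H.twist_left h)
  twist_right h := by simpa [lift_heckeInv, twistWord] using congrArg f (H.twist_right h)

/-- Extension of scalars for `q`-Brauer algebras. -/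
def brMap (hp : p.IsBaseChange p') (n : ℕ) : QBr p n →ₐ[A] QBr p' n :=
  ((BrRelations.baseChange_iff hp).2 (brRelations p' n)).lift

variable (hp : p.IsBaseChange p') {n : ℕ}

theorem brMap_brG {i : ℕ} (h1 : 1 ≤ i) (h2 : i < n) : brMap hp n (brG p n i) = brG p' n i :=
  BrRelations.lift_brG _ h1 h2

theorem brMap_brE (h : 2 ≤ n) : brMap hp n (brE p n) = brE p' n := BrRelations.lift_brE _ h

theorem brMap_brI {i : ℕ} (h1 : 1 ≤ i) (h2 : i < n) : brMap hp n (brI p n i) = brI p' n i := by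
  rw [brI, lift_heckeInv, brMap_brG hp h1 h2, heckeInv_baseChange hp, brI]

theorem brMap_brF (h : 2 ≤ n) : brMap hp n (brF p n) = brF p' n := by
  rw [brF, map_smul, brMap_brE hp h, baseChange_inv_smul hp.d, brF]

theorem brMap_brIncl (x : QBr p n) :
    brMap hp (n + 1) (brIncl p n x) = brIncl p' n (brMap hp n x) := by
  have : (brMap hp (n + 1)).comp (brIncl p n) =
      ((brIncl p' n).restrictScalars A).comp (brMap hp n) := by
    refine QBr.algHom_ext (fun i h1 h2 => ?_) fun h => ?_
    · rw [AlgHom.comp_apply, AlgHom.comp_apply, AlgHom.restrictScalars_apply, brIncl_brG p h1 h2,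
        brMap_brG hp h1 (by omega), brMap_brG hp h1 h2, brIncl_brG p' h1 h2]
    · rw [AlgHom.comp_apply, AlgHom.comp_apply, AlgHom.restrictScalars_apply, brIncl_brE p h,
        brMap_brE hp (by omega), brMap_brE hp h, brIncl_brE p' h]
  exact DFunLike.congr_fun this x

theorem brMap_cupMap {m : ℕ} (h : m + 2 ≤ n) (x : QBr p m) :
    brMap hp n (cupMap p h x) = cupMap p' h (brMap hp m x) := by
  induction x using QBr.induction with
  | hc c =>
    rw [Algebra.algebraMap_eq_smul_one, map_smul, map_smul, map_smul, map_one (brMap hp m),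
      cupMap_one, brMap_brF hp (by omega), ← algebraMap_smul R c (1 : QBr p' m), map_smul, cupMap_one,
      algebraMap_smul]
  | hg i h1 h2 =>
    rw [cupMap_brG p h h1 h2, map_mul, brMap_brF hp (by omega), brMap_brG hp (by omega) (by omega),
      brMap_brG hp h1 h2, cupMap_brG p' h h1 h2]
  | he h2 =>
    rw [cupMap_brE p h h2, map_smul, brMap_brE hp h2, cupMap_brE p' h h2, baseChange_smul hp.d]
    congr 1
    simp only [brX, brT, map_mul, zero_add]
    rw [brMap_brF hp (by omega), brMap_brG hp (by omega) (by omega),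
      brMap_brG hp (by omega) (by omega), brMap_brI hp (by omega) (by omega),
      brMap_brI hp (by omega) (by omega)]
  | hadd x y hx hy => simp only [map_add, hx, hy]
  | hmul x y hx hy => rw [cupMap_mul, map_mul, hx, hy, map_mul, cupMap_mul]

theorem mem_span_brMap (x : QBr p' n) : x ∈ Submodule.span R (Set.range (brMap hp n)) := by
  induction x using QBr.induction with
  | hc c =>
    rw [Algebra.algebraMap_eq_smul_one]
    exact Submodule.smul_mem _ c (Submodule.subset_span ⟨1, map_one _⟩)
  | hg i h1 h2 => exact Submodule.subset_span ⟨_, brMap_brG hp h1 h2⟩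
  | he h => exact Submodule.subset_span ⟨_, brMap_brE hp h⟩
  | hadd x y hx hy => exact Submodule.add_mem _ hx hy
  | hmul x y hx hy =>
    have := Submodule.mul_mem_mul hx hy
    rw [Submodule.span_mul_span] at this
    refine Submodule.span_mono ?_ this
    rintro _ ⟨_, ⟨a, rfl⟩, _, ⟨b, rfl⟩, rfl⟩
    exact ⟨a * b, map_mul _ _ _⟩

theorem brMap_ext {M : Type*} [AddCommGroup M] [Module R M] {f g : QBr p' n →ₗ[R] M}
    (h : ∀ x, f (brMap hp n x) = g (brMap hp n x)) : f = g := by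
  refine LinearMap.ext fun x => ?_
  have hx := mem_span_brMap hp x
  induction hx using Submodule.span_induction with
  | mem x hx => obtain ⟨y, rfl⟩ := hx; exact h y
  | zero => rw [map_zero, map_zero]
  | add x y _ _ hx hy => rw [map_add, map_add, hx, hy]
  | smul c x _ hx => rw [map_smul, map_smul, hx]

/-- The homomorphism from the `q`-Brauer algebra over `R` to the tensor product of `R` with the
`q`-Brauer algebra over `A`. -/
def brTensor (hp : p.IsBaseChange p') (n : ℕ) : QBr p' n →ₐ[R] R ⊗[A] QBr p n :=
  ((BrRelations.baseChange_iff hp).1 ((brRelations p n).map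
    (Algebra.TensorProduct.includeRight : QBr p n →ₐ[A] R ⊗[A] QBr p n))).lift

theorem brTensor_brMap (x : QBr p n) : brTensor hp n (brMap hp n x) = (1 : R) ⊗ₜ[A] x := by
  have : ((brTensor hp n).restrictScalars A).comp (brMap hp n) =
      (Algebra.TensorProduct.includeRight : QBr p n →ₐ[A] R ⊗[A] QBr p n) := by
    refine QBr.algHom_ext (fun i h1 h2 => ?_) fun h => ?_
    · rw [AlgHom.comp_apply, AlgHom.restrictScalars_apply, brMap_brG hp h1 h2]
      exact BrRelations.lift_brG _ h1 h2
    · rw [AlgHom.comp_apply, AlgHom.restrictScalars_apply, brMap_brE hp h]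
      exact BrRelations.lift_brE _ h
  exact DFunLike.congr_fun this x

/-- The extension of scalars of a linear map on the `q`-Brauer algebra over `A`. -/
def brExtend {M : Type*} [AddCommGroup M] [Module A M] [Module R M] [IsScalarTower A R M]
    (hp : p.IsBaseChange p') (f : QBr p n →ₗ[A] M) : QBr p' n →ₗ[R] M :=
  (f.liftBaseChange R).comp (brTensor hp n).toLinearMap

theorem brExtend_brMap {M : Type*} [AddCommGroup M] [Module A M] [Module R M] [IsScalarTower A R M]
    (f : QBr p n →ₗ[A] M) (x : QBr p n) : brExtend hp f (brMap hp n x) = f x := by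
  rw [brExtend, LinearMap.comp_apply, AlgHom.toLinearMap_apply, brTensor_brMap,
    LinearMap.liftBaseChange_tmul, one_smul]

theorem MarkovFamily.baseChange (hp : p.IsBaseChange p') {T : ∀ n, QBr p n →ₗ[A] A} (hT : MarkovFamily p T) :
    MarkovFamily p' fun n => brExtend hp ((Algebra.linearMap A R).comp (T n)) where
  incl n x := by
    refine DFunLike.congr_fun (f := (brExtend hp ((Algebra.linearMap A R).comp (T (n + 1)))).comp
      (brIncl p' n).toLinearMap) (brMap_ext hp fun y => ?_) x
    rw [LinearMap.comp_apply, AlgHom.toLinearMap_apply, ← brMap_brIncl, brExtend_brMap,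
      brExtend_brMap, LinearMap.comp_apply, LinearMap.comp_apply, hT.incl]
  conj n h hh := by
    induction hh using Algebra.adjoin_induction with
    | mem h hh =>
      obtain ⟨i, h1, h2, rfl⟩ := hh
      intro x
      refine DFunLike.congr_fun (f := (brExtend hp ((Algebra.linearMap A R).comp (T n))).comp
        (LinearMap.mulLeft R (brG p' n i))) (g := (brExtend hp ((Algebra.linearMap A R).comp
          (T n))).comp (LinearMap.mulRight R (brG p' n i))) (brMap_ext hp fun y => ?_) x
      rw [LinearMap.comp_apply, LinearMap.comp_apply, LinearMap.mulLeft_apply,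
        LinearMap.mulRight_apply, ← brMap_brG hp h1 h2, ← map_mul (brMap hp n),
        ← map_mul (brMap hp n), brExtend_brMap, brExtend_brMap, LinearMap.comp_apply,
        LinearMap.comp_apply, hT.conj n _ (Algebra.subset_adjoin ⟨i, h1, h2, rfl⟩)]
    | algebraMap c => intro x; rw [Algebra.commutes]
    | add x y _ _ hx hy => intro z; rw [add_mul, mul_add, map_add, map_add, hx, hy]
    | mul x y _ _ hx hy => intro z; rw [mul_assoc, hx, mul_assoc, hy, mul_assoc]
  markov n hn x y := by
    set T' := brExtend hp ((Algebra.linearMap A R).comp (T n))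
    set T'' := brExtend hp ((Algebra.linearMap A R).comp (T (n + 1)))
    refine DFunLike.congr_fun (f := T''.comp ((LinearMap.mulRight R (brIncl p' n y)).comp
      ((LinearMap.mulRight R (brG p' (n + 1) n)).comp (brIncl p' n).toLinearMap)))
      (g := ((p'.r * p'.d⁻¹ : Rˣ) : R) • T'.comp (LinearMap.mulRight R y))
      (brMap_ext hp fun x => ?_) x
    refine DFunLike.congr_fun (f := T''.comp ((LinearMap.mulLeft R (brIncl p' n (brMap hp n x) *
      brG p' (n + 1) n)).comp (brIncl p' n).toLinearMap))
      (g := ((p'.r * p'.d⁻¹ : Rˣ) : R) • T'.comp (LinearMap.mulLeft R (brMap hp n x)))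
      (brMap_ext hp fun y => ?_) y
    simp only [LinearMap.comp_apply, LinearMap.mulLeft_apply, AlgHom.toLinearMap_apply,
      LinearMap.smul_apply]
    rw [← brMap_brG hp hn (Nat.lt_succ_self n), ← brMap_brIncl, ← brMap_brIncl,
      ← map_mul (brMap hp _), ← map_mul (brMap hp _), ← map_mul (brMap hp _), brExtend_brMap,
      brExtend_brMap, LinearMap.comp_apply, LinearMap.comp_apply, hT.markov n hn, map_smul,
      baseChange_smul (u' := p'.r * p'.d⁻¹) (by rw [map_mul, map_inv, hp.r, hp.d])]
  cup := by
    rw [← brMap_brF hp le_rfl, ← map_one (brMap hp 2), brExtend_brMap, brExtend_brMap,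
      LinearMap.comp_apply, LinearMap.comp_apply, hT.cup, map_smul,
      baseChange_smul (u' := p'.r * p'.q⁻¹ * p'.d⁻¹ * p'.d⁻¹) (by
        simp only [map_mul, map_inv, hp.r, hp.q, hp.d])]

theorem cupMap_injective_of_leftInverse (hp : p.IsBaseChange p') {m : ℕ} (h : m + 2 ≤ n) (L : QBr p n →ₗ[A] QBr p m)
    (hL : ∀ x, L (cupMap p h x) = x) : Function.Injective (cupMap p' h) := by
  have e : (brExtend hp ((brMap hp m).toLinearMap.comp L)).comp (cupMap p' h) = LinearMap.id :=
    brMap_ext hp fun x => by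
      rw [LinearMap.comp_apply, ← brMap_cupMap, brExtend_brMap, LinearMap.comp_apply, hL]
      rfl
  exact Function.LeftInverse.injective (g := brExtend hp ((brMap hp m).toLinearMap.comp L))
    fun x => DFunLike.congr_fun e x

end BaseChange

section GroundRing

theorem isUnit_brParam {R : Type*} [CommRing R] (p : BrParam R) :
    IsUnit ((p.q : R) * (p.d : R) * (1 + ((p.q : R) - 1) * (p.d : R))) := by
  rw [p.rel, add_sub_cancel, ← Units.val_mul, ← Units.val_mul]
  exact Units.isUnit _

/-- Every choice of parameters is a base change of the generic one. -/
theorem genParam_isBaseChange {R : Type*} [CommRing R] (p : BrParam R) :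
    letI := (genEval (p.q : R) (p.d : R) (isUnit_brParam p)).toAlgebra
    genParam.IsBaseChange p :=
  letI := (genEval (p.q : R) (p.d : R) (isUnit_brParam p)).toAlgebra
  { q := Units.ext (genEval_q (isUnit_brParam p))
    r := Units.ext ((genEval_r (isUnit_brParam p)).trans (by rw [p.rel, add_sub_cancel]))
    d := Units.ext (genEval_d (isUnit_brParam p)) }

end GroundRing

end

theorem theorem4p5 (N : ℤ) (hN : N ≠ 0) :
    (∃! tr : ∀ n : ℕ, QBr (brParam N) n →ₗ[GroundRing N] GroundRing N,
      IsExtendedTrace (brParam N) tr) ∧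
    ∀ tr : ∀ n : ℕ, QBr (brParam N) n →ₗ[GroundRing N] GroundRing N,
      IsExtendedTrace (brParam N) tr →
        ∀ n : ℕ, 1 ≤ n → ∀ c : QBr (brParam N) n,
          tr (n + 1) (brIncl (brParam N) n c) = tr n c ∧
          tr (n + 1) (brIncl (brParam N) n c * brG (brParam N) (n + 1) n) =
            tr n c * tr (n + 1) (brG (brParam N) (n + 1) n) := by
  let _ := (genEval ((brParam N).q : GroundRing N) (brParam N).d (isUnit_brParam (brParam N))).toAlgebra
  have hp := genParam_isBaseChange (brParam N)
  refine (MarkovFamily.baseChange hp genTrace_markovFamily).existsUnique (brParam N) ?_ fun m =>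
    cupMap_injective_of_leftInverse hp le_rfl (genCorner m) genCorner_cupMap
  rw [← map_one (brMap hp 0), brExtend_brMap, LinearMap.comp_apply, genTrace_zero_one,
    Algebra.linearMap_apply, map_one]
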